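/- Let $Q$ be a positive definite quadratic form on $\mathbb R^2$ whose symmetric matrix has determinant $1$, and let $a$ be the off-diagonal entry of that matrix, so $Q(x,y)=ux^2+2a\,xy+wy^2$ with $u>0$ and $uw-a^2=1$. Consider on $\mathbb R^2\setminus\{0\}$ the metric $g=\dfrac{2\,dx\,dy}{Q(x,y)}$ and the vector field $K=x\partial_x+y\partial_y$. Then $g$ is a smooth Lorentzian metric, $K$ is a Killing field of $g$, and all homotheties $p\mapsto cp$, $c\in\mathbb R\setminus\{0\}$, are isometries of $g$. For $|c|\neq 1$ let $T_c$ be the Lorentzian torus $(\mathbb R^2\setminus\{0\},g)/\langle p\mapsto cp\rangle$; its universal cover $(\widetilde T,\widetilde g,\widetilde K)$ is $\mathbb R^2$ with the pull-back of $g$ by $(s,\theta)\mapsto(e^s\cos\theta,e^s\sin\theta)$ and $\widetilde K=\partial_s$. Put $$f(x)=\sin(2x)-2a\cos^2x .$$ (1) $(\widetilde T,\widetilde g,\widetilde K)$ is modeled on $E^u_f$: there is a smooth function $\mathbf x:\widetilde T\to\mathbb R$ with $d\mathbf x=i_{\widetilde K}\nu$, where $\nu$ is a volume form of $\widetilde g$,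 such that $\widetilde g(\widetilde K,\widetilde K)=f\circ\mathbf x$; and $\mathbb R$ is covered by open intervals $I_k$ ($k\in\mathbb Z$) whose end points are zeros of $f$, with increasing left end points, $I_k$ disjoint from $I_{k+2}$ and $I_k\cap I_{k+1}$ a component of $\{f\ne0\}$, for which there are charts $(\mathbf x,y_k)$ mapping $\mathbf x^{-1}(I_k)$ isometrically onto $\bigl(I_k\times\mathbb R,\ (-1)^k2\,dx\,dy+f(x)\,dy^2\bigr)$ and $\widetilde K$ to $\partial_y$. (2) $f$ is smooth and periodic, and: (i) its zeros are simple; (ii) $f'$ changes sign exactly once on each bounded component of $\{f\neq0\}$; (iii) $f'f'''\le0$; (iv) there is $t_0\in\mathbb R$ with $f(t_0+t)=f(t_0-t)$ for all $t$; (v) $f$ has a smallest positive period $\tau$, and has exactly two zeros in $[0,\tau)$. (3) All bands of $\widetilde T$ are of type II: the closure of each connected component of $\{\widetilde g(\widetilde K,\widetilde K)\neq0\}$ is saturated by $\widetilde K$ and homeomorphic to $[0,1]\times\mathbb R$, with $\widetilde g(\widetilde K,\widetilde K)$ vanishing exactly on the boundary; on it, the foliation by the orbits of $\widetilde K$ is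 homeomorphic to the product foliation of $[0,1]\times\mathbb R$ by the lines $\{x\}\times\mathbb R$, and the foliation tangent to $\widetilde K^\perp$ is a Reeb component, i.e. homeomorphic to the foliation of $[0,1]\times\mathbb R$ defined by $\cos(\pi x)\,dx+\sin(\pi x)\,dy=0$. (4) Neither $(\mathbb R^2\setminus\{0\},g)$ nor any of the tori $T_c$, $|c|\ne1$, has conjugate points: a Jacobi field along a geodesic that vanishes at two distinct parameters vanishes identically. -/

import Mathlib

open Set Topology
open scoped ContDiff Matrix

noncomputable section

namespace LorentzTorus

/-! ### Lorentzian metrics in global coordinates -/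

/-- The coordinate plane; all surfaces below are open subsets of it or quotients of such. -/
abbrev Plane : Type := Fin 2 → ℝ

/-- A (not necessarily everywhere meaningful) metric: the matrix `g_ij` at each point. -/
abbrev MetricTensor : Type := Plane → Matrix (Fin 2) (Fin 2) ℝ

/-- A vector field. -/
abbrev VField : Type := Plane → Plane

/-- The scalar product `⟨v, w⟩` at the point `p`. -/
def ip (g : MetricTensor) (p v w : Plane) : ℝ := v ⬝ᵥ (g p *ᵥ w)

/-- The partial derivative `∂_i F`. -/
def pd (i : Fin 2) (F : Plane → ℝ) (p : Plane) : ℝ := fderiv ℝ F p (Pi.single i 1)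

/-- `g` is a smooth Lorentzian metric on the open set `U` (a symmetric `2 × 2` matrix has signature
`(1, 1)` exactly when its determinant is negative). -/
structure IsLorentzianOn (g : MetricTensor) (U : Set Plane) : Prop where
  smooth : ∀ i j, ContDiffOn ℝ ∞ (fun p => g p i j) U
  symm : ∀ p ∈ U, (g p).IsSymm
  det_neg : ∀ p ∈ U, (g p).det < 0

/-- `K` is a smooth Killing field of `g` on `U`: the Lie derivative
`(L_K g)_ij = K^k ∂_k g_ij + g_kj ∂_i K^k + g_ik ∂_j K^k` vanishes. -/
structure IsKillingOn (g : MetricTensor) (K : VField) (U : Set Plane) : Prop where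
  smooth : ContDiffOn ℝ ∞ K U
  lie_eq_zero : ∀ p ∈ U, ∀ i j,
    ∑ k, (K p k * pd k (fun q => g q i j) p + g p k j * pd i (fun q => K q k) p
      + g p i k * pd j (fun q => K q k) p) = 0

/-- The Christoffel symbol `Γ^k_ij` of the Levi-Civita connection. -/
def christoffel (g : MetricTensor) (k i j : Fin 2) (p : Plane) : ℝ :=
  (1 / 2) * ∑ l, (g p)⁻¹ k l *
    (pd i (fun q => g q j l) p + pd j (fun q => g q i l) p - pd l (fun q => g q i j) p)

/-- The curvature coefficient `R^a_bcd`, i.e. `R(∂_c, ∂_d) ∂_b = ∑ a, R^a_bcd ∂_a` with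
`R(X, Y) Z = ∇_X ∇_Y Z - ∇_Y ∇_X Z - ∇_[X,Y] Z`. -/
def riemann (g : MetricTensor) (a b c d : Fin 2) (p : Plane) : ℝ :=
  pd c (christoffel g a d b) p - pd d (christoffel g a c b) p
    + ∑ e, (christoffel g a c e p * christoffel g e d b p
      - christoffel g a d e p * christoffel g e c b p)

/-- The vector `R(X, Y) Z` at `p`. -/
def curvature (g : MetricTensor) (p X Y Z : Plane) : Plane :=
  fun a => ∑ b, ∑ c, ∑ d, riemann g a b c d p * Z b * X c * Y d

/-- The covariant derivative `DY/dt` of a vector field `Y` along the curve `γ`. -/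
def covDeriv (g : MetricTensor) (γ Y : ℝ → Plane) (t : ℝ) : Plane :=
  fun k => deriv Y t k + ∑ i, ∑ j, christoffel g k i j (γ t) * deriv γ t i * Y t j

/-- `γ` is a geodesic of `(U, g)` on the open parameter set `J`. -/
structure IsGeodesicOn (g : MetricTensor) (U : Set Plane) (γ : ℝ → Plane) (J : Set ℝ) : Prop where
  contDiffOn : ContDiffOn ℝ 2 γ J
  mapsTo : MapsTo γ J U
  geodesic_eq : ∀ t ∈ J, covDeriv g γ (deriv γ) t = 0

/-- `Y` is a Jacobi field along the geodesic `γ`: `D²Y/dt² + R(Y, γ')γ' = 0`. -/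
structure IsJacobiOn (g : MetricTensor) (U : Set Plane) (γ Y : ℝ → Plane) (J : Set ℝ) : Prop where
  geodesic : IsGeodesicOn g U γ J
  contDiffOn : ContDiffOn ℝ 2 Y J
  jacobi_eq : ∀ t ∈ J, covDeriv g γ (covDeriv g γ Y) t
    + curvature g (γ t) (Y t) (deriv γ t) (deriv γ t) = 0

/-- `(U, g)` has no conjugate points: a Jacobi field along a geodesic that vanishes at two distinct
parameters is trivial. -/
def NoConjugatePoints (g : MetricTensor) (U : Set Plane) : Prop :=
  ∀ (J : Set ℝ) (γ Y : ℝ → Plane), IsOpen J → J.OrdConnected → IsJacobiOn g U γ Y J →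
    ∀ t₀ ∈ J, ∀ t₁ ∈ J, t₀ ≠ t₁ → Y t₀ = 0 → Y t₁ = 0 → ∀ t ∈ J, Y t = 0

/-! ### Quadratic variations of the Clifton–Pohl metric and their tori -/

/-- The metric `2 dx dy / Q(x, y)`. -/
def quadraticMetric (Q : QuadraticForm ℝ Plane) : MetricTensor :=
  fun p => (Q p)⁻¹ • !![0, 1; 1, 0]

/-- The punctured plane `ℝ² - {0}`. -/
def punctured : Set Plane := {0}ᶜ

/-- The radial field `x ∂_x + y ∂_y`. -/
def radial : VField := fun p => p

/-- Two points of the punctured plane are equivalent when a power of the homothety of ratio `c`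
maps one to the other. -/
def homothetySetoid (c : ℝˣ) : Setoid punctured where
  r p q := ∃ n : ℤ, q.1 = ((c ^ n : ℝˣ) : ℝ) • p.1
  iseqv :=
    { refl := fun p => ⟨0, by simp⟩
      symm := by
        rintro p q ⟨n, h⟩
        exact ⟨-n, by rw [h, smul_smul, ← Units.val_mul, ← zpow_add]; simp⟩
      trans := by
        rintro p q r ⟨n, h⟩ ⟨m, h'⟩
        exact ⟨m + n, by rw [h', h, smul_smul, ← Units.val_mul, ← zpow_add]⟩ }

/-- The quotient of the punctured plane by the group generated by the homothety of ratio `c`. -/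
def HomothetyTorus (c : ℝˣ) : Type := Quotient (homothetySetoid c)

/-- The projection of the punctured plane onto the torus. -/
def HomothetyTorus.mk (c : ℝˣ) (p : punctured) : HomothetyTorus c :=
  Quotient.mk (homothetySetoid c) p

/-- Two tangent vectors `(p, v)`, `(q, w)` of the punctured plane are equivalent when the
differential of a power of the homothety of ratio `c` maps one to the other. -/
def tangentSetoid (c : ℝˣ) : Setoid (punctured × Plane) where
  r P R := ∃ n : ℤ, R.1.1 = ((c ^ n : ℝˣ) : ℝ) • P.1.1 ∧ R.2 = ((c ^ n : ℝˣ) : ℝ) • P.2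
  iseqv :=
    { refl := fun p => ⟨0, by simp⟩
      symm := by
        rintro p q ⟨n, h, k⟩
        exact ⟨-n, by rw [h, smul_smul, ← Units.val_mul, ← zpow_add]; simp,
          by rw [k, smul_smul, ← Units.val_mul, ← zpow_add]; simp⟩
      trans := by
        rintro p q r ⟨n, h, k⟩ ⟨m, h', k'⟩
        exact ⟨m + n, by rw [h', h, smul_smul, ← Units.val_mul, ← zpow_add],
          by rw [k', k, smul_smul, ← Units.val_mul, ← zpow_add]⟩ }

/-- The tangent bundle of the torus. -/
def TorusTangent (c : ℝˣ) : Type := Quotient (tangentSetoid c)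

/-- The differential of the projection onto the torus. -/
def TorusTangent.mk (c : ℝˣ) (p : punctured) (v : Plane) : TorusTangent c :=
  Quotient.mk (tangentSetoid c) (p, v)

/-- The zero vectors of the tangent bundle of the torus. -/
def TorusTangent.IsZero {c : ℝˣ} (V : TorusTangent c) : Prop :=
  ∃ p : punctured, V = TorusTangent.mk c p 0

/-- `κ` is a geodesic of the torus on `J`, and `Y` a Jacobi field along it. The metric of the torus
is the one for which the projection is a local isometry, so this means that `(κ, Y)` is locally the
projection of a geodesic of the punctured plane with a Jacobi field. -/
def IsTorusJacobiOn (g : MetricTensor) (c : ℝˣ) (κ : ℝ → HomothetyTorus c)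
    (Y : ℝ → TorusTangent c) (J : Set ℝ) : Prop :=
  ∀ t ∈ J, ∃ ε > 0, Ioo (t - ε) (t + ε) ⊆ J ∧ ∃ γ W : ℝ → Plane,
    IsJacobiOn g punctured γ W (Ioo (t - ε) (t + ε)) ∧
    ∀ s ∈ Ioo (t - ε) (t + ε), ∃ h : γ s ∈ punctured,
      κ s = HomothetyTorus.mk c ⟨γ s, h⟩ ∧ Y s = TorusTangent.mk c ⟨γ s, h⟩ (W s)

/-- The torus obtained from `(ℝ² - {0}, g)` and the homothety of ratio `c` (an isometry of `g`) has
no conjugate points. -/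
def TorusNoConjugatePoints (g : MetricTensor) (c : ℝˣ) : Prop :=
  ∀ (J : Set ℝ) (κ : ℝ → HomothetyTorus c) (Y : ℝ → TorusTangent c),
    IsOpen J → J.OrdConnected → IsTorusJacobiOn g c κ Y J →
    ∀ t₀ ∈ J, ∀ t₁ ∈ J, t₀ ≠ t₁ → (Y t₀).IsZero → (Y t₁).IsZero → ∀ t ∈ J, (Y t).IsZero

/-- The homothety of ratio `c` is an isometry of `(ℝ² - {0}, g)`, so that `g` descends. -/
def HomothetyInvariant (g : MetricTensor) (c : ℝˣ) : Prop :=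
  ∀ p ∈ punctured, ∀ v w : Plane, ip g ((c : ℝ) • p) ((c : ℝ) • v) ((c : ℝ) • w) = ip g p v w

/-! ### The universal cover -/

/-- The universal covering `(s, θ) ↦ (e^s cos θ, e^s sin θ)` of the punctured plane, hence of all
the tori obtained from it. -/
def polar : Plane → Plane :=
  fun p => ![Real.exp (p 0) * Real.cos (p 1), Real.exp (p 0) * Real.sin (p 1)]

/-- The Jacobian matrix of a map. -/
def jacobian (F : Plane → Plane) (p : Plane) : Matrix (Fin 2) (Fin 2) ℝ :=
  Matrix.of fun i j => pd j (fun q => F q i) p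

/-- The pull-back metric `F^* g`. -/
def pullback (F : Plane → Plane) (g : MetricTensor) : MetricTensor :=
  fun p => (jacobian F p)ᵀ * g (F p) * jacobian F p

/-- The lift `∂_s` of the radial field to the universal cover. -/
def liftedRadial : VField := fun _ => ![1, 0]

/-- `liftedRadial` is the lift of `radial`. -/
theorem jacobian_polar_liftedRadial (p : Plane) :
    jacobian polar p *ᵥ liftedRadial p = radial (polar p) := by
  have h0 : HasFDerivAt (fun q : Plane => q 0) (ContinuousLinearMap.proj (R := ℝ) 0) p :=
    hasFDerivAt_apply 0 p
  have h1 : HasFDerivAt (fun q : Plane => q 1) (ContinuousLinearMap.proj (R := ℝ) 1) p :=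
    hasFDerivAt_apply 1 p
  have hx : fderiv ℝ (fun q : Plane => Real.exp (q 0) * Real.cos (q 1)) p = _ :=
    (h0.exp.mul h1.cos).fderiv
  have hy : fderiv ℝ (fun q : Plane => Real.exp (q 0) * Real.sin (q 1)) p = _ :=
    (h0.exp.mul h1.sin).fderiv
  ext i
  fin_cases i
  · simp [jacobian, liftedRadial, radial, Matrix.mulVec, dotProduct, pd, polar, hx]
    ring
  · simp [jacobian, liftedRadial, radial, Matrix.mulVec, dotProduct, pd, polar, hy]
    ring

/-! ### Bands -/

/-- `p` and `q` lie on the same leaf, in `B`, of the foliation tangent to the line field `D`: they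
are joined by a `C¹` curve in `B` that is tangent to `D`. -/
def SameLeaf (D : Plane → Set Plane) (B : Set Plane) (p q : Plane) : Prop :=
  ∃ c : ℝ → Plane, ContDiff ℝ 1 c ∧ c 0 = p ∧ c 1 = q ∧
    ∀ t ∈ Icc (0 : ℝ) 1, c t ∈ B ∧ deriv c t ∈ D (c t)

/-- The direction of `K`. -/
def kLine (K : VField) (p : Plane) : Set Plane := {v | ∃ r : ℝ, v = r • K p}

/-- The direction orthogonal to `K`. -/
def kPerp (g : MetricTensor) (K : VField) (p : Plane) : Set Plane := {v | ip g p (K p) v = 0}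

/-- A band of the simply connected surface `(ℝ², g, K)`: a subset that is saturated by `K`,
homeomorphic to `[0, 1] × ℝ`, on which `K` does not vanish, and on which `⟨K, K⟩` vanishes exactly on
the boundary. -/
def IsBand (g : MetricTensor) (K : VField) (B : Set Plane) : Prop :=
  (∀ p ∈ B, K p ≠ 0) ∧ (∀ p ∈ B, ∀ q, SameLeaf (kLine K) univ p q → q ∈ B) ∧
    ∃ h : B ≃ₜ Icc (0 : ℝ) 1 × ℝ, ∀ p : B,
      ip g p (K p) (K p) = 0 ↔ ((h p).1 : ℝ) = 0 ∨ ((h p).1 : ℝ) = 1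

/-- The foliation of the strip `B` by the leaves of `D` is a suspension: it is homeomorphic to the
product foliation of `[0, 1] × ℝ` by the lines `{x} × ℝ`. -/
def IsSuspension (D : Plane → Set Plane) (B : Set Plane) : Prop :=
  ∃ h : B ≃ₜ Icc (0 : ℝ) 1 × ℝ, ∀ p q : B, SameLeaf D B p q ↔ (h p).1 = (h q).1

/-- The partition into leaves of the standard Reeb component
`cos (π x) dx + sin (π x) dy = 0` of `[0, 1] × ℝ`: two boundary lines, and the curves
`sin (π x) e^(π y) = constant > 0`, asymptotic to both boundary lines as `y → +∞`. -/
def ReebSameLeaf (P R : Icc (0 : ℝ) 1 × ℝ) : Prop :=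
  ((P.1 : ℝ) = 0 ∧ (R.1 : ℝ) = 0) ∨ ((P.1 : ℝ) = 1 ∧ (R.1 : ℝ) = 1) ∨
    ((P.1 : ℝ) ∈ Ioo (0 : ℝ) 1 ∧ (R.1 : ℝ) ∈ Ioo (0 : ℝ) 1 ∧
      Real.sin (Real.pi * P.1) * Real.exp (Real.pi * P.2)
        = Real.sin (Real.pi * R.1) * Real.exp (Real.pi * R.2))

/-- The foliation of the strip `B` by the leaves of `D` is a Reeb component. -/
def IsReebComponent (D : Plane → Set Plane) (B : Set Plane) : Prop :=
  ∃ h : B ≃ₜ Icc (0 : ℝ) 1 × ℝ, ∀ p q : B, SameLeaf D B p q ↔ ReebSameLeaf (h p) (h q)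

/-- A band of type II: the foliation of `K` is a suspension and that of `K^⊥` a Reeb component. -/
def IsTypeIIBand (g : MetricTensor) (K : VField) (B : Set Plane) : Prop :=
  IsBand g K B ∧ IsSuspension (kLine K) B ∧ IsReebComponent (kPerp g K) B

/-- All bands of `(ℝ², g, K)` are of type II. The bands are the closures of the connected components
of `{⟨K, K⟩ ≠ 0}`. -/
def AllBandsTypeII (g : MetricTensor) (K : VField) : Prop :=
  ∀ p : Plane, ip g p (K p) (K p) ≠ 0 →
    IsTypeIIBand g K (closure (connectedComponentIn {q | ip g q (K q) (K q) ≠ 0} p))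

/-! ### The norm function and surfaces modeled on `E^u_f` -/

/-- `x` is a transverse coordinate of `(ℝ², g, K)`: `dx = i_K ν` where `ν` is one of the two volume
forms `± |det g|^(1/2) dp⁰ ∧ dp¹` of `g`. -/
def IsTransverseCoordinate (g : MetricTensor) (K : VField) (x : Plane → ℝ) : Prop :=
  ContDiff ℝ ∞ x ∧ ∃ σ : ℝ, (σ = 1 ∨ σ = -1) ∧ ∀ p v : Plane,
    fderiv ℝ x p v = σ * √|(g p).det| * (K p 0 * v 1 - K p 1 * v 0)

/-- An atlas of `(ℝ², g, K)` by ribbons: the `k`-th chart `(x, y k)` is an isometry from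
`{x ∈ I_k}`, `I_k = ]a k, b k[`, onto the ribbon
`(I_k × ℝ, (-1)^k 2 dx dy + f(x) dy²)` carrying `K` to `∂_y`. The end points of the `I_k` are zeros
of `f`, the `I_k` cover the line, and `I_k` meets `I_(k+1)` in one component of `{f ≠ 0}`. (Being
isometries that agree in `x` and `K`, two consecutive charts differ by
`(x, y) ↦ (x, y ± 2 G(x))` with `G` a primitive of `-1/f`.) -/
structure IsRibbonAtlas (g : MetricTensor) (K : VField) (f : ℝ → ℝ) (x : Plane → ℝ)
    (a b : ℤ → ℝ) (y : ℤ → Plane → ℝ) : Prop where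
  zero_left : ∀ k, f (a k) = 0
  zero_right : ∀ k, f (b k) = 0
  left_lt : ∀ k, a k < a (k + 1)
  overlap : ∀ k, a (k + 1) < b k
  no_triple : ∀ k, b k ≤ a (k + 2)
  overlap_ne_zero : ∀ k, ∀ t ∈ Ioo (a (k + 1)) (b k), f t ≠ 0
  cover : ∀ t : ℝ, ∃ k, t ∈ Ioo (a k) (b k)
  smooth : ∀ k, ContDiffOn ℝ ∞ (y k) (x ⁻¹' Ioo (a k) (b k))
  bijOn : ∀ k, BijOn (fun m => (x m, y k m)) (x ⁻¹' Ioo (a k) (b k)) (Ioo (a k) (b k) ×ˢ univ)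
  isometry : ∀ k, ∀ m, x m ∈ Ioo (a k) (b k) → ∀ v w : Plane,
    ip g m v w = (-1 : ℝ) ^ k *
        (fderiv ℝ x m v * fderiv ℝ (y k) m w + fderiv ℝ x m w * fderiv ℝ (y k) m v)
      + f (x m) * fderiv ℝ (y k) m v * fderiv ℝ (y k) m w
  killing_x : ∀ k, ∀ m, x m ∈ Ioo (a k) (b k) → fderiv ℝ x m (K m) = 0
  killing_y : ∀ k, ∀ m, x m ∈ Ioo (a k) (b k) → fderiv ℝ (y k) m (K m) = 1

/-- The simply connected surface `(ℝ², g, K)` is modeled on `E^u_f`: it has a transverse coordinate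
`x` with `⟨K, K⟩ = f ∘ x`, and an atlas by ribbons associated to `f`. -/
def IsModeledOnEuf (g : MetricTensor) (K : VField) (f : ℝ → ℝ) : Prop :=
  ∃ x : Plane → ℝ, IsTransverseCoordinate g K x ∧ (∀ p, ip g p (K p) (K p) = f (x p)) ∧
    ∃ (a b : ℤ → ℝ) (y : ℤ → Plane → ℝ), IsRibbonAtlas g K f x a b y

/-- `h` changes sign exactly once on `]p, q[`. -/
def ChangesSignOnce (h : ℝ → ℝ) (p q : ℝ) : Prop :=
  (∃ t ∈ Ioo p q, 0 < h t) ∧ (∃ t ∈ Ioo p q, h t < 0) ∧ ∃ c ∈ Ioo p q,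
    ((∀ t ∈ Ioo p c, 0 ≤ h t) ∧ ∀ t ∈ Ioo c q, h t ≤ 0) ∨
    ((∀ t ∈ Ioo p c, h t ≤ 0) ∧ ∀ t ∈ Ioo c q, 0 ≤ h t)

/-- The conditions on a smooth periodic function `f` that define the family. -/
structure InFamily (f : ℝ → ℝ) : Prop where
  smooth : ContDiff ℝ ∞ f
  simple_zeros : ∀ t, f t = 0 → deriv f t ≠ 0
  deriv_sign : ∀ p q, p < q → f p = 0 → f q = 0 → (∀ t ∈ Ioo p q, f t ≠ 0) →
    ChangesSignOnce (deriv f) p q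
  deriv_mul_le : ∀ t, deriv f t * iteratedDeriv 3 f t ≤ 0
  symmetric : ∃ a, ∀ t, f (a + t) = f (a - t)
  two_zeros : ∃ T, IsLeast {T | 0 < T ∧ Function.Periodic f T} T ∧
    {t ∈ Ico 0 T | f t = 0}.ncard = 2

end LorentzTorus

end

noncomputable section

namespace LorentzTorus

/-! The coordinates x, y are null for g, so the only Christoffel symbols are Γ^k_kk = -∂_k log Q.
Covariant differentiation therefore acts on the two components separately, and uw - a² = 1 gives
∂_x∂_y log Q = -(2aQ + 4xy)/Q².

Universal cover. In polar coordinates g = (sin 2θ (ds² - dθ²) + 2 cos 2θ ds dθ)/q(θ), with q the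
restriction of Q to the unit circle. A transverse coordinate is a primitive of 1/q. Suitably
normalised, it is a continuous angle of the vector (cos θ, w sin θ + a cos θ)
(`cos_sin_transverse`), and this turns sin 2θ / q into f (`normFun_transverse`). The ribbon charts
are s + log cos(θ - kπ/2). The bands are the strips between consecutive multiples of π/2, and e^{2s}
sin 2θ is a first integral of the foliation orthogonal to ∂_s, which matches the Reeb model. With α
= arctan a one has cos α · f(x) = sin(2x - α) - sin α, from which the properties of f can be read.

Conjugate points. Along a null geodesic the Jacobi equation decouples into affine functions. Along a
non-null geodesic (x, y) with velocity (p, q), the product of a Jacobi field with the velocity is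
affine, and its area l against the velocity solves l'' + k l = 0. If some r satisfies r' + r² + k ≤
0, then l l' - l² r is monotone, and a solution vanishing at both ends is trivial
(`eq_zero_of_riccati`). It remains to produce r. Symmetries reduce to p, q > 0 and Clairaut constant
C ≥ 0. The Killing field gives the solution β = (xq - yp)/Q. If C = 0, it has no zero and r = β'/β
works. If C > 0, write u = U², w = V², s = (Ux + Vy)/√Q, c = (Ux - Vy)/√Q, κ₁ = UV - a, κ₂ = UV + a.
Then κ₁κ₂ = 1 and s' = κ₁cβ, c' = -κ₂sβ, β' = -Esc, where E is the energy. Moreover s'' + ks = -Ms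
with M = β² + Eκ₂s² constant, so r = s'/s works while s > 0, in particular in the first quadrant.
For a curve that starts in the fourth quadrant, put D = s + β/C. Then r = β'/β + κ₁M/(βD) works
while y ≤ 0, r = D'/D works while y ≥ 0, and the two agree at y = 0
(`deriv_eq_zero_of_start_right`).

The tori follow by lifting: a geodesic of the torus with a Jacobi field lifts over any compact
interval, because two lifts differ by a single deck transformation. -/

/-! ### The metric 2 dx dy / Q in null coordinates: connection, curvature, symmetries -/

/-- The binary quadratic form `u x² + 2 a x y + w y²`. -/
def quad (u a w x y : ℝ) : ℝ := u * x ^ 2 + 2 * a * x * y + w * y ^ 2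

theorem quad_pos {u a w x y : ℝ} (hu : 0 < u) (h : u * w - a ^ 2 = 1) (hxy : x ≠ 0 ∨ y ≠ 0) :
    0 < quad u a w x y := by
  have key : u * quad u a w x y = (u * x + a * y) ^ 2 + y ^ 2 := by
    unfold quad; linear_combination y ^ 2 * h
  have : 0 < (u * x + a * y) ^ 2 + y ^ 2 := by
    rcases eq_or_ne y 0 with rfl | hy
    · have hx : x ≠ 0 := by simpa using hxy
      have : u * x ≠ 0 := mul_ne_zero hu.ne' hx
      simpa using sq_pos_of_ne_zero this
    · positivity
  rw [← key] at this
  exact pos_of_mul_pos_right this hu.le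

/-- The metric `2 dx dy / (u x² + 2 a x y + w y²)`. -/
def quadMetric (u a w : ℝ) : MetricTensor :=
  fun p => (quad u a w (p 0) (p 1))⁻¹ • !![0, 1; 1, 0]

theorem quadraticForm_apply (Q : QuadraticForm ℝ Plane) (p : Plane) :
    Q p = quad (QuadraticForm.toMatrix' Q 0 0) (QuadraticForm.toMatrix' Q 0 1)
      (QuadraticForm.toMatrix' Q 1 1) (p 0) (p 1) := by
  have h1 : Q p = p ⬝ᵥ (QuadraticForm.toMatrix' Q *ᵥ p) := by
    conv_lhs => rw [← QuadraticMap.associated_eq_self_apply ℝ Q p]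
    unfold QuadraticForm.toMatrix'
    rw [← Matrix.toLinearMap₂'_apply', Matrix.toLinearMap₂'_toMatrix']
  have h2 := QuadraticForm.isSymm_toMatrix' Q
  have h3 := h2.apply 0 1
  rw [h1]
  simp [Matrix.mulVec, dotProduct, quad, h3]
  ring

theorem quadraticMetric_eq (Q : QuadraticForm ℝ Plane) :
    quadraticMetric Q = quadMetric (QuadraticForm.toMatrix' Q 0 0)
      (QuadraticForm.toMatrix' Q 0 1) (QuadraticForm.toMatrix' Q 1 1) := by
  funext p
  rw [quadraticMetric, quadMetric, quadraticForm_apply]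

theorem ip_quadMetric (u a w : ℝ) (p v v' : Plane) :
    ip (quadMetric u a w) p v v' = (quad u a w (p 0) (p 1))⁻¹ * (v 0 * v' 1 + v 1 * v' 0) := by
  simp [ip, quadMetric, Matrix.mulVec, dotProduct]
  ring

theorem mem_punctured_iff {p : Plane} : p ∈ punctured ↔ p 0 ≠ 0 ∨ p 1 ≠ 0 := by
  have : p = 0 ↔ p 0 = 0 ∧ p 1 = 0 := by
    constructor
    · rintro rfl; simp
    · rintro ⟨h0, h1⟩; ext i; fin_cases i <;> simp [h0, h1]
  simp only [punctured, mem_compl_iff, mem_singleton_iff, this]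
  tauto

theorem contDiff_quad (u a w : ℝ) : ContDiff ℝ ∞ (fun p : Plane => quad u a w (p 0) (p 1)) := by
  unfold quad; fun_prop

theorem pd_of_hasFDerivAt {F : Plane → ℝ} {F' : Plane →L[ℝ] ℝ} {p : Plane}
    (h : HasFDerivAt F F' p) (i : Fin 2) : pd i F p = F' (Pi.single i 1) := by
  rw [pd, h.fderiv]

/-- The partial derivatives of `quad`. -/
def quadD (u a w : ℝ) (i : Fin 2) (x y : ℝ) : ℝ :=
  if i = 0 then 2 * (u * x + a * y) else 2 * (a * x + w * y)

theorem hasFDerivAt_quad (u a w : ℝ) (p : Plane) :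
    HasFDerivAt (fun q : Plane => quad u a w (q 0) (q 1))
      (quadD u a w 0 (p 0) (p 1) • ContinuousLinearMap.proj (R := ℝ) (φ := fun _ : Fin 2 => ℝ) 0
        + quadD u a w 1 (p 0) (p 1) •
          ContinuousLinearMap.proj (R := ℝ) (φ := fun _ : Fin 2 => ℝ) 1) p := by
  have h0 : HasFDerivAt (fun q : Plane => q 0) (ContinuousLinearMap.proj (R := ℝ) 0) p :=
    hasFDerivAt_apply 0 p
  have h1 : HasFDerivAt (fun q : Plane => q 1) (ContinuousLinearMap.proj (R := ℝ) 1) p :=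
    hasFDerivAt_apply 1 p
  unfold quad
  refine ((((h0.pow 2).const_mul u).add ((h0.const_mul (2 * a)).mul h1)).add
    ((h1.pow 2).const_mul w)).congr_fderiv ?_
  ext v
  simp [quadD]
  ring

/-- The logarithmic derivatives of `quad`. -/
def quadLog (u a w : ℝ) (i : Fin 2) (p : Plane) : ℝ :=
  quadD u a w i (p 0) (p 1) / quad u a w (p 0) (p 1)

theorem pd_quad_inv {u a w : ℝ} {p : Plane} (hp : quad u a w (p 0) (p 1) ≠ 0) (i : Fin 2) :
    pd i (fun q => (quad u a w (q 0) (q 1))⁻¹) p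
      = - quadLog u a w i p * (quad u a w (p 0) (p 1))⁻¹ := by
  have := ((hasDerivAt_inv hp).comp_hasFDerivAt p (hasFDerivAt_quad u a w p))
  refine (pd_of_hasFDerivAt this i).trans ?_
  fin_cases i <;> simp [quadLog, quadD] <;> field_simp

theorem pd_zero (i : Fin 2) (p : Plane) : pd i (fun _ => 0) p = 0 := by
  simp [pd]

theorem quadMetric_apply (u a w : ℝ) (p : Plane) (i j : Fin 2) :
    quadMetric u a w p i j = if i = j then 0 else (quad u a w (p 0) (p 1))⁻¹ := by
  fin_cases i <;> fin_cases j <;> simp [quadMetric]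

theorem quadMetric_inv {u a w : ℝ} {p : Plane} (hp : quad u a w (p 0) (p 1) ≠ 0) :
    (quadMetric u a w p)⁻¹ = quad u a w (p 0) (p 1) • !![0, 1; 1, 0] := by
  apply Matrix.inv_eq_right_inv
  ext i j
  fin_cases i <;> fin_cases j <;> simp [quadMetric, hp]

theorem christoffel_quadMetric {u a w : ℝ} {p : Plane} (hp : quad u a w (p 0) (p 1) ≠ 0)
    (k i j : Fin 2) : christoffel (quadMetric u a w) k i j p =
      if k = i ∧ k = j then - quadLog u a w k p else 0 := by
  unfold christoffel
  rw [quadMetric_inv hp]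
  simp only [quadMetric_apply]
  fin_cases k <;> fin_cases i <;> fin_cases j <;>
    simp [pd_quad_inv hp, pd_zero] <;> field_simp <;> ring

/-- The mixed second derivative of `- log quad`. -/
def quadMixed (u a w : ℝ) (p : Plane) : ℝ :=
  (2 * a * quad u a w (p 0) (p 1) + 4 * (p 0 * p 1)) / quad u a w (p 0) (p 1) ^ 2

/-- The product (ux + ay)(ax + wy) equals aQ + (uw - a²)xy, so with determinant 1 the mixed second
derivative of log Q involves only Q and xy. -/
theorem pd_quadLog {u a w : ℝ} (h : u * w - a ^ 2 = 1) {p : Plane}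
    (hp : quad u a w (p 0) (p 1) ≠ 0) {i j : Fin 2} (hij : i ≠ j) :
    pd i (quadLog u a w j) p = - quadMixed u a w p := by
  have h0 : HasFDerivAt (fun q : Plane => q 0) (ContinuousLinearMap.proj (R := ℝ) 0) p :=
    hasFDerivAt_apply 0 p
  have h1 : HasFDerivAt (fun q : Plane => q 1) (ContinuousLinearMap.proj (R := ℝ) 1) p :=
    hasFDerivAt_apply 1 p
  have hi := (hasDerivAt_inv hp).comp_hasFDerivAt p (hasFDerivAt_quad u a w p)
  have e0 := (((h0.const_mul u).add (h1.const_mul a)).const_mul 2).mul hi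
  have e1 := (((h0.const_mul a).add (h1.const_mul w)).const_mul 2).mul hi
  fin_cases i <;> fin_cases j
  · simp at hij
  · have : quadLog u a w 1 = fun q => 2 * (a * q 0 + w * q 1) * (quad u a w (q 0) (q 1))⁻¹ := by
      funext q; simp [quadLog, quadD, div_eq_mul_inv]
    simp only [Fin.mk_one, Fin.zero_eta, this]
    refine (pd_of_hasFDerivAt e1 0).trans ?_
    simp [quadD, quadMixed]
    field_simp
    simp only [quad]
    linear_combination (-4 * p 0 * p 1) * h
  · have : quadLog u a w 0 = fun q => 2 * (u * q 0 + a * q 1) * (quad u a w (q 0) (q 1))⁻¹ := by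
      funext q; simp [quadLog, quadD, div_eq_mul_inv]
    simp only [Fin.mk_one, Fin.zero_eta, this]
    refine (pd_of_hasFDerivAt e0 1).trans ?_
    simp [quadD, quadMixed]
    field_simp
    simp only [quad]
    linear_combination (-4 * p 0 * p 1) * h
  · simp at hij

theorem eventually_quad_ne_zero {u a w : ℝ} {p : Plane} (hp : quad u a w (p 0) (p 1) ≠ 0) :
    ∀ᶠ q : Plane in 𝓝 p, quad u a w (q 0) (q 1) ≠ 0 :=
  (contDiff_quad u a w).continuous.continuousAt.eventually_ne hp

theorem pd_christoffel {u a w : ℝ} {p : Plane}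
    (hp : quad u a w (p 0) (p 1) ≠ 0) (c k i j : Fin 2) :
    pd c (christoffel (quadMetric u a w) k i j) p =
      if k = i ∧ k = j then - pd c (quadLog u a w k) p else 0 := by
  have : christoffel (quadMetric u a w) k i j =ᶠ[𝓝 p]
      fun q => if k = i ∧ k = j then - quadLog u a w k q else 0 := by
    filter_upwards [eventually_quad_ne_zero hp] with q hq
    exact christoffel_quadMetric hq k i j
  rw [pd, this.fderiv_eq]
  split_ifs
  · simp [pd, fderiv_fun_neg]
  · simp

/-- The terms quadratic in the Christoffel symbols cancel, and antisymmetry removes the pure second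
derivatives of log Q, so only the mixed one is left. -/
theorem curvature_quadMetric {u a w : ℝ} (h : u * w - a ^ 2 = 1) {p : Plane}
    (hp : quad u a w (p 0) (p 1) ≠ 0) (Y v : Plane) :
    curvature (quadMetric u a w) p Y v v =
      (quadMixed u a w p * (Y 0 * v 1 - Y 1 * v 0)) • ![- v 0, v 1] := by
  have e01 := pd_quadLog h hp (i := 0) (j := 1) (by simp)
  have e10 := pd_quadLog h hp (i := 1) (j := 0) (by simp)
  ext k
  fin_cases k <;>
    simp [curvature, riemann, pd_christoffel hp, christoffel_quadMetric hp, e01, e10] <;> ring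

theorem covDeriv_quadMetric {u a w : ℝ} {γ : ℝ → Plane} {t : ℝ}
    (hp : quad u a w (γ t 0) (γ t 1) ≠ 0) (Y : ℝ → Plane) (k : Fin 2) :
    covDeriv (quadMetric u a w) γ Y t k
      = deriv Y t k - quadLog u a w k (γ t) * deriv γ t k * Y t k := by
  fin_cases k <;> simp [covDeriv, christoffel_quadMetric hp] <;> ring

theorem isLorentzianOn_quadMetric {u a w : ℝ} (hu : 0 < u) (h : u * w - a ^ 2 = 1) :
    IsLorentzianOn (quadMetric u a w) punctured where
  smooth i j := by
    simp only [quadMetric_apply]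
    split_ifs
    · exact contDiffOn_const
    · exact (contDiff_quad u a w).contDiffOn.inv
        fun p hp => (quad_pos hu h (mem_punctured_iff.1 hp)).ne'
  symm p _ := by
    ext i j
    simp only [Matrix.transpose_apply, quadMetric_apply, eq_comm]
  det_neg p hp := by
    have := quad_pos hu h (mem_punctured_iff.1 hp)
    rw [Matrix.det_fin_two]
    simp only [quadMetric_apply]
    simp
    positivity

theorem isKillingOn_quadMetric {u a w : ℝ} (hu : 0 < u) (h : u * w - a ^ 2 = 1) :
    IsKillingOn (quadMetric u a w) radial punctured where
  smooth := contDiff_id.contDiffOn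
  lie_eq_zero p hp i j := by
    have hq := (quad_pos hu h (mem_punctured_iff.1 hp)).ne'
    have hk : ∀ i k : Fin 2, pd i (fun q : Plane => q k) p = if i = k then 1 else 0 := by
      intro i k
      rw [pd_of_hasFDerivAt (hasFDerivAt_apply k p)]
      fin_cases i <;> fin_cases k <;> simp
    simp only [quadMetric_apply, radial, Fin.sum_univ_two, hk]
    fin_cases i <;> fin_cases j <;> simp [pd_quad_inv hq, pd_zero, quadLog, quadD] <;>
      field_simp <;> simp only [quad] <;> ring

theorem homothetyInvariant_quadMetric (u a w : ℝ) (c : ℝˣ) :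
    HomothetyInvariant (quadMetric u a w) c := by
  intro p _ v v'
  have hc : (c : ℝ) ≠ 0 := c.ne_zero
  have : quad u a w (c * p 0) (c * p 1) = (c : ℝ) ^ 2 * quad u a w (p 0) (p 1) := by
    unfold quad; ring
  simp only [ip_quadMetric, Pi.smul_apply, smul_eq_mul, this, mul_inv]
  field_simp

/-! ### Riccati comparison -/

/-- The quantity is l²(l'/l - r), written without division so that zeros of l do no harm. Its
derivative is a square plus l² times the nonnegative Riccati defect of r. -/
theorem monotoneOn_riccati {l m r r' k : ℝ → ℝ} {b c : ℝ}
    (hl : ∀ t ∈ Icc b c, HasDerivAt l (m t) t)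
    (hm : ∀ t ∈ Icc b c, HasDerivAt m (-k t * l t) t)
    (hr : ∀ t ∈ Icc b c, HasDerivAt r (r' t) t)
    (hk : ∀ t ∈ Icc b c, r' t + r t ^ 2 + k t ≤ 0) :
    (∀ t ∈ Icc b c, HasDerivAt (fun t => l t * m t - l t ^ 2 * r t)
      ((m t - l t * r t) ^ 2 - l t ^ 2 * (r' t + r t ^ 2 + k t)) t) ∧
    MonotoneOn (fun t => l t * m t - l t ^ 2 * r t) (Icc b c) := by
  have hd : ∀ t ∈ Icc b c, HasDerivAt (fun t => l t * m t - l t ^ 2 * r t)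
      ((m t - l t * r t) ^ 2 - l t ^ 2 * (r' t + r t ^ 2 + k t)) t := by
    intro t ht
    refine (((hl t ht).mul (hm t ht)).sub (((hl t ht).pow 2).mul (hr t ht))).congr_deriv ?_
    simp
    ring
  refine ⟨hd, monotoneOn_of_deriv_nonneg (convex_Icc b c)
    (fun t ht => (hd t ht).continuousAt.continuousWithinAt)
    (fun t ht => (hd t (interior_subset ht)).differentiableAt.differentiableWithinAt) ?_⟩
  intro t ht
  have ht' := interior_subset ht
  rw [(hd t ht').deriv]
  nlinarith [sq_nonneg (m t - l t * r t), mul_nonneg (sq_nonneg (l t)) (neg_nonneg.2 (hk t ht'))]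

/-- The monotone quantity is 0 at b and at most 0 at c, hence identically zero. Its one-sided
derivative at b, which is (m b)² because l b = 0, must then vanish. -/
theorem eq_zero_of_riccati {l m r r' k : ℝ → ℝ} {b c : ℝ} (hbc : b < c)
    (hl : ∀ t ∈ Icc b c, HasDerivAt l (m t) t)
    (hm : ∀ t ∈ Icc b c, HasDerivAt m (-k t * l t) t)
    (hr : ∀ t ∈ Icc b c, HasDerivAt r (r' t) t)
    (hk : ∀ t ∈ Icc b c, r' t + r t ^ 2 + k t ≤ 0)
    (hb : l b = 0) (hc : l c * m c - l c ^ 2 * r c ≤ 0) : m b = 0 := by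
  obtain ⟨hd, hmono⟩ := monotoneOn_riccati hl hm hr hk
  have hb' : b ∈ Icc b c := left_mem_Icc.2 hbc.le
  have hZ : ∀ t ∈ Icc b c, l t * m t - l t ^ 2 * r t = 0 := by
    intro t ht
    have h1 := hmono hb' ht ht.1
    have h2 := hmono ht (right_mem_Icc.2 hbc.le) ht.2
    simp only [hb] at h1
    simp only at h2
    linarith
  have h1 : HasDerivWithinAt (fun t => l t * m t - l t ^ 2 * r t) 0 (Icc b c) b :=
    (hasDerivWithinAt_const b (Icc b c) (0 : ℝ)).congr hZ (hZ b hb')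
  have h2 := (uniqueDiffOn_Icc hbc b hb').eq_deriv _ h1 (hd b hb').hasDerivWithinAt
  simp only [hb] at h2
  nlinarith

/-- Only values have to match at c, not derivatives: monotonicity on the second interval and l d = 0
supply the sign at c that the first interval needs. -/
theorem eq_zero_of_riccati_glue {l m r₁ r₁' r₂ r₂' k : ℝ → ℝ} {b c d : ℝ} (hbc : b < c)
    (hcd : c ≤ d)
    (hl : ∀ t ∈ Icc b d, HasDerivAt l (m t) t)
    (hm : ∀ t ∈ Icc b d, HasDerivAt m (-k t * l t) t)
    (hr₁ : ∀ t ∈ Icc b c, HasDerivAt r₁ (r₁' t) t)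
    (hk₁ : ∀ t ∈ Icc b c, r₁' t + r₁ t ^ 2 + k t ≤ 0)
    (hr₂ : ∀ t ∈ Icc c d, HasDerivAt r₂ (r₂' t) t)
    (hk₂ : ∀ t ∈ Icc c d, r₂' t + r₂ t ^ 2 + k t ≤ 0)
    (hc : r₁ c = r₂ c) (hb : l b = 0) (hd : l d = 0) : m b = 0 := by
  have s1 : Icc b c ⊆ Icc b d := Icc_subset_Icc_right hcd
  have s2 : Icc c d ⊆ Icc b d := Icc_subset_Icc_left hbc.le
  refine eq_zero_of_riccati hbc (fun t ht => hl t (s1 ht)) (fun t ht => hm t (s1 ht)) hr₁ hk₁ hb ?_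
  have h := (monotoneOn_riccati (fun t ht => hl t (s2 ht)) (fun t ht => hm t (s2 ht)) hr₂ hk₂).2
    (left_mem_Icc.2 hcd) (right_mem_Icc.2 hcd) hcd
  simpa [hc, hd] using h

theorem hasDerivAt_log_deriv {D D₁ : ℝ → ℝ} {D₂ t : ℝ} (h : HasDerivAt D (D₁ t) t)
    (h₁ : HasDerivAt D₁ D₂ t) (h0 : D t ≠ 0) :
    HasDerivAt (fun t => D₁ t / D t) (D₂ / D t - (D₁ t / D t) ^ 2) t := by
  refine (h₁.div h h0).congr_deriv ?_
  field_simp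

/-- With the Wronskian W = B₁D - BD₁, the Riccati defect is N(W + N)/(BD)². Where W = -N the
function takes the value D₁/D, and this makes gluing to D₁/D possible. -/
theorem hasDerivAt_shifted_log_deriv {B B₁ D : ℝ → ℝ} {N D₁ k t : ℝ} (h : HasDerivAt B (B₁ t) t)
    (h₁ : HasDerivAt B₁ (-k * B t) t) (hD : HasDerivAt D D₁ t) (h0 : B t ≠ 0) (hD0 : D t ≠ 0) :
    HasDerivAt (fun t => B₁ t / B t + N / (B t * D t))
      (-(B₁ t / B t + N / (B t * D t)) ^ 2 - k
        + N * (B₁ t * D t - B t * D₁ + N) / (B t * D t) ^ 2) t := by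
  refine ((h₁.div h h0).add
    ((hasDerivAt_const t N).div (h.mul hD) (mul_ne_zero h0 hD0))).congr_deriv ?_
  simp only [Pi.mul_apply]
  field_simp
  ring

/-! ### The scalar Jacobi equation -/

/-- A curve `(x, y)` with velocity `(p, q)` that is a geodesic of `2 dx dy / Q`, together with a
solution `l`, of derivative `m`, of the Jacobi equation of its normal component. -/
structure ScalarJacobi (u a w : ℝ) (x y p q l m : ℝ → ℝ) (J : Set ℝ) : Prop where
  ne : ∀ t ∈ J, x t ≠ 0 ∨ y t ≠ 0
  dx : ∀ t ∈ J, HasDerivAt x (p t) t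
  dy : ∀ t ∈ J, HasDerivAt y (q t) t
  dp : ∀ t ∈ J, HasDerivAt p (2 * (u * x t + a * y t) / quad u a w (x t) (y t) * p t ^ 2) t
  dq : ∀ t ∈ J, HasDerivAt q (2 * (a * x t + w * y t) / quad u a w (x t) (y t) * q t ^ 2) t
  dl : ∀ t ∈ J, HasDerivAt l (m t) t
  dm : ∀ t ∈ J, HasDerivAt m (2 * (2 * a * quad u a w (x t) (y t) + 4 * (x t * y t))
    / quad u a w (x t) (y t) ^ 2 * (p t * q t) * l t) t

namespace ScalarJacobi

variable {u a w : ℝ} {x y p q l m : ℝ → ℝ} {J : Set ℝ}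

theorem swap (S : ScalarJacobi u a w x y p q l m J) : ScalarJacobi w a u y x q p l m J where
  ne t ht := (S.ne t ht).symm
  dx := S.dy
  dy := S.dx
  dp t ht := (S.dq t ht).congr_deriv (by unfold quad; ring_nf)
  dq t ht := (S.dp t ht).congr_deriv (by unfold quad; ring_nf)
  dl := S.dl
  dm t ht := (S.dm t ht).congr_deriv (by unfold quad; ring_nf)

theorem neg (S : ScalarJacobi u a w x y p q l m J) :
    ScalarJacobi u a w (fun t => - x t) (fun t => - y t) (fun t => - p t) (fun t => - q t) l m J
    where
  ne t ht := by simpa using S.ne t ht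
  dx t ht := (S.dx t ht).neg
  dy t ht := (S.dy t ht).neg
  dp t ht := (S.dp t ht).neg.congr_deriv (by
    have : quad u a w (-x t) (-y t) = quad u a w (x t) (y t) := by unfold quad; ring
    rw [this]; ring)
  dq t ht := (S.dq t ht).neg.congr_deriv (by
    have : quad u a w (-x t) (-y t) = quad u a w (x t) (y t) := by unfold quad; ring
    rw [this]; ring)
  dl := S.dl
  dm t ht := (S.dm t ht).congr_deriv (by
    have : quad u a w (-x t) (-y t) = quad u a w (x t) (y t) := by unfold quad; ring
    rw [this]; ring)

/-- The map x ↦ -x carries the metric to the negative of the one with -a for a. A global sign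
changes neither the connection nor the Jacobi equation, so timelike and spacelike geodesics are
interchanged. -/
theorem reflect (S : ScalarJacobi u a w x y p q l m J) :
    ScalarJacobi u (-a) w (fun t => - x t) y (fun t => - p t) q l m J where
  ne t ht := by simpa using S.ne t ht
  dx t ht := (S.dx t ht).neg
  dy := S.dy
  dp t ht := (S.dp t ht).neg.congr_deriv (by
    have : quad u (-a) w (-x t) (y t) = quad u a w (x t) (y t) := by unfold quad; ring
    rw [this]; ring)
  dq t ht := (S.dq t ht).congr_deriv (by
    have : quad u (-a) w (-x t) (y t) = quad u a w (x t) (y t) := by unfold quad; ring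
    rw [this]; ring)
  dl := S.dl
  dm t ht := (S.dm t ht).congr_deriv (by
    have : quad u (-a) w (-x t) (y t) = quad u a w (x t) (y t) := by unfold quad; ring
    rw [this]; ring)

/-- Time reversal, composed with the central symmetry. -/
theorem reverse (S : ScalarJacobi u a w x y p q l m J) :
    ScalarJacobi u a w (fun t => - x (-t)) (fun t => - y (-t)) (fun t => p (-t)) (fun t => q (-t))
      (fun t => l (-t)) (fun t => - m (-t)) (Neg.neg ⁻¹' J) := by
  have comp : ∀ {F : ℝ → ℝ} {F' t : ℝ}, HasDerivAt F F' (-t) →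
      HasDerivAt (fun t => F (-t)) (-F') t := by
    intro F F' t h
    exact (h.comp t (hasDerivAt_neg t)).congr_deriv (by ring)
  have e : ∀ t, quad u a w (-x (-t)) (-y (-t)) = quad u a w (x (-t)) (y (-t)) := by
    intro t; unfold quad; ring
  exact
  { ne := fun t ht => by simpa using S.ne (-t) ht
    dx := fun t ht => (comp (S.dx (-t) ht)).neg.congr_deriv (by ring)
    dy := fun t ht => (comp (S.dy (-t) ht)).neg.congr_deriv (by ring)
    dp := fun t ht => (comp (S.dp (-t) ht)).congr_deriv (by rw [e]; ring)
    dq := fun t ht => (comp (S.dq (-t) ht)).congr_deriv (by rw [e]; ring)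
    dl := fun t ht => comp (S.dl (-t) ht)
    dm := fun t ht => (comp (S.dm (-t) ht)).neg.congr_deriv (by rw [e]; ring) }

theorem hasDerivAt_quad (S : ScalarJacobi u a w x y p q l m J) {t : ℝ} (ht : t ∈ J) :
    HasDerivAt (fun t => quad u a w (x t) (y t))
      (2 * (u * x t + a * y t) * p t + 2 * (a * x t + w * y t) * q t) t := by
  unfold quad
  refine (((((S.dx t ht).pow 2).const_mul u).add (((S.dx t ht).const_mul (2 * a)).mul
    (S.dy t ht))).add (((S.dy t ht).pow 2).const_mul w)).congr_deriv ?_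
  simp
  ring

/-- The energy is constant. -/
theorem hasDerivAt_energy (S : ScalarJacobi u a w x y p q l m J) {t : ℝ} (ht : t ∈ J)
    (h0 : quad u a w (x t) (y t) ≠ 0) :
    HasDerivAt (fun t => 2 * (p t * q t) / quad u a w (x t) (y t)) 0 t := by
  refine ((((S.dp t ht).mul (S.dq t ht)).const_mul 2).div (S.hasDerivAt_quad ht) h0).congr_deriv ?_
  simp only [Pi.mul_apply]
  field_simp
  ring

/-- The Clairaut integral is constant. -/
theorem hasDerivAt_clairaut (S : ScalarJacobi u a w x y p q l m J) {t : ℝ} (ht : t ∈ J)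
    (h0 : quad u a w (x t) (y t) ≠ 0) :
    HasDerivAt (fun t => (x t * q t + y t * p t) / quad u a w (x t) (y t)) 0 t := by
  refine ((((S.dx t ht).mul (S.dq t ht)).add ((S.dy t ht).mul (S.dp t ht))).div
    (S.hasDerivAt_quad ht) h0).congr_deriv ?_
  simp only [Pi.mul_apply, Pi.add_apply]
  field_simp
  simp only [quad]
  ring

/-- This is the area spanned by the radial Killing field and the velocity. Being the normal part of
a Killing field, it will serve as an explicit solution of the scalar Jacobi equation. -/
theorem hasDerivAt_beta (S : ScalarJacobi u a w x y p q l m J) {t : ℝ} (ht : t ∈ J)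
    (h0 : quad u a w (x t) (y t) ≠ 0) :
    HasDerivAt (fun t => (x t * q t - y t * p t) / quad u a w (x t) (y t))
      (-(2 * (p t * q t) / quad u a w (x t) (y t)) *
        ((u * x t ^ 2 - w * y t ^ 2) / quad u a w (x t) (y t))) t := by
  refine ((((S.dx t ht).mul (S.dq t ht)).sub ((S.dy t ht).mul (S.dp t ht))).div
    (S.hasDerivAt_quad ht) h0).congr_deriv ?_
  simp only [Pi.mul_apply, Pi.sub_apply]
  field_simp
  simp only [quad]
  ring

end ScalarJacobi

/-! ### The pendulum variables s, c, β and the Riccati subsolutions for C > 0 -/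

namespace ScalarJacobi

variable {a U V : ℝ} {x y p q l m : ℝ → ℝ} {J : Set ℝ}

/-- Taking square roots of the diagonal entries makes the derivative of s a multiple of cβ, and that
of c a multiple of sβ. With β' = -Esc this is a closed quadratic system of Euler type. -/
theorem hasDerivAt_s (S : ScalarJacobi (U ^ 2) a (V ^ 2) x y p q l m J) {t : ℝ} (ht : t ∈ J)
    (h0 : 0 < quad (U ^ 2) a (V ^ 2) (x t) (y t)) :
    HasDerivAt (fun t => (U * x t + V * y t) / √(quad (U ^ 2) a (V ^ 2) (x t) (y t)))
      ((U * V - a) * ((U * x t - V * y t) / √(quad (U ^ 2) a (V ^ 2) (x t) (y t))) *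
        ((x t * q t - y t * p t) / quad (U ^ 2) a (V ^ 2) (x t) (y t))) t := by
  have hR : 0 < √(quad (U ^ 2) a (V ^ 2) (x t) (y t)) := Real.sqrt_pos.2 h0
  refine ((((S.dx t ht).const_mul U).add ((S.dy t ht).const_mul V)).div
    ((S.hasDerivAt_quad ht).sqrt h0.ne') hR.ne').congr_deriv ?_
  have key : (U * p t + V * q t) * quad (U ^ 2) a (V ^ 2) (x t) (y t)
      - (U * x t + V * y t) * ((U ^ 2 * x t + a * y t) * p t + (a * x t + V ^ 2 * y t) * q t)
      = (U * V - a) * (U * x t - V * y t) * (x t * q t - y t * p t) := by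
    unfold quad; ring
  have hsq : √(quad (U ^ 2) a (V ^ 2) (x t) (y t)) ^ 2 = quad (U ^ 2) a (V ^ 2) (x t) (y t) :=
    Real.sq_sqrt h0.le
  simp only [Pi.add_apply]
  generalize √(quad (U ^ 2) a (V ^ 2) (x t) (y t)) = R at hR hsq ⊢
  rw [← hsq] at key ⊢
  field_simp
  linear_combination key

theorem hasDerivAt_c (S : ScalarJacobi (U ^ 2) a (V ^ 2) x y p q l m J) {t : ℝ} (ht : t ∈ J)
    (h0 : 0 < quad (U ^ 2) a (V ^ 2) (x t) (y t)) :
    HasDerivAt (fun t => (U * x t - V * y t) / √(quad (U ^ 2) a (V ^ 2) (x t) (y t)))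
      (-(U * V + a) * ((U * x t + V * y t) / √(quad (U ^ 2) a (V ^ 2) (x t) (y t))) *
        ((x t * q t - y t * p t) / quad (U ^ 2) a (V ^ 2) (x t) (y t))) t := by
  have hR : 0 < √(quad (U ^ 2) a (V ^ 2) (x t) (y t)) := Real.sqrt_pos.2 h0
  refine ((((S.dx t ht).const_mul U).sub ((S.dy t ht).const_mul V)).div
    ((S.hasDerivAt_quad ht).sqrt h0.ne') hR.ne').congr_deriv ?_
  have key : (U * p t - V * q t) * quad (U ^ 2) a (V ^ 2) (x t) (y t)
      - (U * x t - V * y t) * ((U ^ 2 * x t + a * y t) * p t + (a * x t + V ^ 2 * y t) * q t)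
      = -(U * V + a) * (U * x t + V * y t) * (x t * q t - y t * p t) := by
    unfold quad; ring
  have hsq : √(quad (U ^ 2) a (V ^ 2) (x t) (y t)) ^ 2 = quad (U ^ 2) a (V ^ 2) (x t) (y t) :=
    Real.sq_sqrt h0.le
  simp only [Pi.sub_apply]
  generalize √(quad (U ^ 2) a (V ^ 2) (x t) (y t)) = R at hR hsq ⊢
  rw [← hsq] at key ⊢
  field_simp
  linear_combination key

set_option maxHeartbeats 1000000 in
/-- The pendulum form of the equations: a Jacobi field that vanishes at both ends is trivial when
the curve starts in the half plane `0 ≤ x` and is increasing with positive Clairaut integral. -/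
theorem deriv_eq_zero_of_start_right (S : ScalarJacobi (U ^ 2) a (V ^ 2) x y p q l m J)
    (hU : 0 < U) (hV : 0 < V) (hUV : (U * V) ^ 2 = 1 + a ^ 2) {t₀ t₁ : ℝ} (h01 : t₀ < t₁)
    (hJ : Icc t₀ t₁ ⊆ J) {E C : ℝ} (hp : ∀ t ∈ Icc t₀ t₁, 0 < p t) (hq : ∀ t ∈ Icc t₀ t₁, 0 < q t)
    (hE : ∀ t ∈ Icc t₀ t₁, 2 * (p t * q t) / quad (U ^ 2) a (V ^ 2) (x t) (y t) = E)
    (hC : ∀ t ∈ Icc t₀ t₁, (x t * q t + y t * p t) / quad (U ^ 2) a (V ^ 2) (x t) (y t) = C)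
    (hC0 : 0 < C) (hx : 0 ≤ x t₀) (hl₀ : l t₀ = 0) (hl₁ : l t₁ = 0) : m t₀ = 0 := by
  have hdet : U ^ 2 * V ^ 2 - a ^ 2 = 1 := by linarith [mul_pow U V 2]
  have hQ : ∀ t ∈ Icc t₀ t₁, 0 < quad (U ^ 2) a (V ^ 2) (x t) (y t) := fun t ht =>
    quad_pos (by positivity) hdet (S.ne t (hJ ht))
  have hUVa : |a| < U * V := by
    apply abs_lt_of_sq_lt_sq _ (by positivity)
    linarith
  obtain ⟨ha1, ha2⟩ := abs_lt.1 hUVa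
  have hk1 : 0 < U * V - a := by linarith
  have hk2 : 0 < U * V + a := by linarith
  have hkk : (U * V - a) * (U * V + a) = 1 := by linarith
  obtain ⟨Q, hQdef⟩ : ∃ g : ℝ → ℝ, g = fun t => quad (U ^ 2) a (V ^ 2) (x t) (y t) := ⟨_, rfl⟩
  obtain ⟨s, hs⟩ : ∃ g : ℝ → ℝ, g = fun t => (U * x t + V * y t) / √(Q t) := ⟨_, rfl⟩
  obtain ⟨c, hc⟩ : ∃ g : ℝ → ℝ, g = fun t => (U * x t - V * y t) / √(Q t) := ⟨_, rfl⟩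
  obtain ⟨B, hB⟩ : ∃ g : ℝ → ℝ, g = fun t => (x t * q t - y t * p t) / Q t := ⟨_, rfl⟩
  obtain ⟨f, hf⟩ : ∃ g : ℝ → ℝ, g = fun t => 2 * (x t * y t) / Q t := ⟨_, rfl⟩
  have hQ : ∀ t ∈ Icc t₀ t₁, 0 < Q t := by simpa only [hQdef] using hQ
  have hE : ∀ t ∈ Icc t₀ t₁, 2 * (p t * q t) / Q t = E := by simpa only [hQdef] using hE
  have hC : ∀ t ∈ Icc t₀ t₁, (x t * q t + y t * p t) / Q t = C := by simpa only [hQdef] using hC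
  have hsq : ∀ t ∈ Icc t₀ t₁, √(Q t) ^ 2 = Q t := fun t ht => Real.sq_sqrt (hQ t ht).le
  have hRpos : ∀ t ∈ Icc t₀ t₁, 0 < √(Q t) := fun t ht => Real.sqrt_pos.2 (hQ t ht)
  have ds : ∀ t ∈ Icc t₀ t₁, HasDerivAt s ((U * V - a) * c t * B t) t :=
    fun t ht => by
    simp only [hQdef] at hQ; simp only [hs, hc, hB, hQdef]; exact S.hasDerivAt_s (hJ ht) (hQ t ht)
  have dc : ∀ t ∈ Icc t₀ t₁, HasDerivAt c (-(U * V + a) * s t * B t) t :=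
    fun t ht => by
    simp only [hQdef] at hQ; simp only [hs, hc, hB, hQdef]; exact S.hasDerivAt_c (hJ ht) (hQ t ht)
  have dB : ∀ t ∈ Icc t₀ t₁, HasDerivAt B (-E * s t * c t) t := by
    intro t ht
    have hq' := (hQ t ht).ne'
    have hE' := hE t ht
    have h1 := hsq t ht
    have h2 := hRpos t ht
    have h3 : s t * c t = (U ^ 2 * x t ^ 2 - V ^ 2 * y t ^ 2) / Q t := by
      simp only [hs, hc]
      rw [div_mul_div_comm, ← pow_two, h1]
      ring
    rw [hB]
    simp only [hQdef] at hq' hE' h3 ⊢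
    refine (S.hasDerivAt_beta (hJ ht) hq').congr_deriv ?_
    rw [hE', ← h3]
    ring
  have hs2 : ∀ t ∈ Icc t₀ t₁, s t ^ 2 = 1 + (U * V - a) * f t := by
    intro t ht
    have h0 := (hQ t ht).ne'
    simp only [hs, hf, div_pow]
    rw [hsq t ht]
    simp only [hQdef] at h0 ⊢
    field_simp
    unfold quad
    ring
  have hc2 : ∀ t ∈ Icc t₀ t₁, c t ^ 2 = 1 - (U * V + a) * f t := by
    intro t ht
    have h0 := (hQ t ht).ne'
    simp only [hc, hf, div_pow]
    rw [hsq t ht]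
    simp only [hQdef] at h0 ⊢
    field_simp
    unfold quad
    ring
  have hB2 : ∀ t ∈ Icc t₀ t₁, B t ^ 2 = C ^ 2 - E * f t := by
    intro t ht
    have h0 := (hQ t ht).ne'
    rw [← hC t ht, ← hE t ht]
    simp only [hB, hf]
    simp only [hQdef] at h0 ⊢
    field_simp
    ring
  have hE0 : 0 < E := by
    have ht : t₀ ∈ Icc t₀ t₁ := left_mem_Icc.2 h01.le
    rw [← hE t₀ ht]
    have h1 := hp t₀ ht
    have h2 := hq t₀ ht
    have h3 := hQ t₀ ht
    exact div_pos (by positivity) h3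
  obtain ⟨k, hk⟩ : ∃ g : ℝ → ℝ, g = fun t => E * ((U * V - a) * c t ^ 2 - (U * V + a) * s t ^ 2) := ⟨_, rfl⟩
  have dl : ∀ t ∈ Icc t₀ t₁, HasDerivAt l (m t) t := fun t ht => S.dl t (hJ ht)
  have dm : ∀ t ∈ Icc t₀ t₁, HasDerivAt m (-k t * l t) t := by
    intro t ht
    refine (S.dm t (hJ ht)).congr_deriv ?_
    have h0 := (hQ t ht).ne'
    congr 1
    simp only [hk, hs2 t ht, hc2 t ht, ← hE t ht, hf]
    simp only [hQdef] at h0 ⊢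
    field_simp
    linear_combination (-4) * x t * y t * p t * q t * hkk
  -- The conserved quantity β² + E(UV + a)s² of the quadratic system, expressed through C and E.
  obtain ⟨M, hM⟩ : ∃ g : ℝ, g = C ^ 2 + E * (U * V + a) := ⟨_, rfl⟩
  have hM0 : 0 < M := by rw [hM]; positivity
  have hMB : ∀ t ∈ Icc t₀ t₁, B t ^ 2 + E * (U * V + a) * s t ^ 2 = M := by
    intro t ht
    rw [hB2 t ht, hs2 t ht, hM]
    linear_combination E * f t * hkk
  -- In the fourth quadrant s may be negative. Adding the solution β/C leaves the right-hand side of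
  -- s'' + ks = -Ms unchanged, and D turns out to be positive along a curve that starts there.
  obtain ⟨D, hD⟩ : ∃ g : ℝ → ℝ, g = fun t => s t + B t / C := ⟨_, rfl⟩
  obtain ⟨D₁, hD₁⟩ : ∃ g : ℝ → ℝ, g = fun t => c t * ((U * V - a) * B t - E * s t / C) := ⟨_, rfl⟩
  have dD : ∀ t ∈ Icc t₀ t₁, HasDerivAt D (D₁ t) t := fun t ht => by
    rw [hD]
    exact ((ds t ht).add ((dB t ht).div_const C)).congr_deriv (by simp only [hD₁]; ring)
  have dD₁ : ∀ t ∈ Icc t₀ t₁, HasDerivAt D₁ (-M * s t - k t * D t) t := by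
    intro t ht
    rw [hD₁]
    refine ((dc t ht).mul (((dB t ht).const_mul (U * V - a)).sub
      (((ds t ht).const_mul E).div_const C))).congr_deriv ?_
    simp only [hk, hD, ← hMB t ht, Pi.sub_apply]
    field_simp
    linear_combination (-s t * B t ^ 2 * C) * hkk
  have dB₁ : ∀ t ∈ Icc t₀ t₁, HasDerivAt (fun t => -E * s t * c t) (-k t * B t) t := by
    intro t ht
    refine (((ds t ht).const_mul (-E)).mul (dc t ht)).congr_deriv ?_
    simp only [hk]
    ring
  have hxmono : ∀ t ∈ Icc t₀ t₁, ∀ t' ∈ Icc t₀ t₁, t < t' → x t < x t' := by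
    have : StrictMonoOn x (Icc t₀ t₁) := strictMonoOn_of_deriv_pos (convex_Icc _ _)
      (fun t ht => (S.dx t (hJ ht)).continuousAt.continuousWithinAt)
      (fun t ht => by
        rw [(S.dx t (hJ (interior_subset ht))).deriv]; exact hp t (interior_subset ht))
    exact fun t ht t' ht' h => this ht ht' h
  have hymono : ∀ t ∈ Icc t₀ t₁, ∀ t' ∈ Icc t₀ t₁, t < t' → y t < y t' := by
    have : StrictMonoOn y (Icc t₀ t₁) := strictMonoOn_of_deriv_pos (convex_Icc _ _)
      (fun t ht => (S.dy t (hJ ht)).continuousAt.continuousWithinAt)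
      (fun t ht => by
        rw [(S.dy t (hJ (interior_subset ht))).deriv]; exact hq t (interior_subset ht))
    exact fun t ht t' ht' h => this ht ht' h
  have h0mem : t₀ ∈ Icc t₀ t₁ := left_mem_Icc.2 h01.le
  have h1mem : t₁ ∈ Icc t₀ t₁ := right_mem_Icc.2 h01.le
  have hClair : ∀ t ∈ Icc t₀ t₁, 0 < x t * q t + y t * p t := by
    intro t ht
    have h := hC t ht
    rw [div_eq_iff (hQ t ht).ne'] at h
    rw [h]
    exact mul_pos hC0 (hQ t ht)
  rcases le_or_gt 0 (y t₀) with hy | hy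
  · -- the curve stays in the first quadrant
    have hspos : ∀ t ∈ Icc t₀ t₁, 0 < s t := by
      intro t ht
      have hx' : 0 ≤ x t := by
        rcases eq_or_lt_of_le ht.1 with h | h
        · rwa [← h]
        · exact hx.trans (hxmono _ h0mem _ ht h).le
      have hy' : 0 ≤ y t := by
        rcases eq_or_lt_of_le ht.1 with h | h
        · rwa [← h]
        · exact hy.trans (hymono _ h0mem _ ht h).le
      simp only [hs]
      refine div_pos ?_ (hRpos t ht)
      rcases S.ne t (hJ ht) with h | h
      · have := hx'.lt_of_ne' h
        positivity
      · have := hy'.lt_of_ne' h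
        positivity
    -- This is s'' + ks = -Ms. Since s > 0 here, s'/s has the constant Riccati defect -M.
    have ds₁ : ∀ t ∈ Icc t₀ t₁, HasDerivAt (fun t => (U * V - a) * c t * B t)
        (-M * s t - k t * s t) t := by
      intro t ht
      refine (((dc t ht).const_mul (U * V - a)).mul (dB t ht)).congr_deriv ?_
      simp only [hk, ← hMB t ht]
      linear_combination (-s t * B t ^ 2) * hkk
    refine eq_zero_of_riccati h01 dl dm
      (fun t ht => hasDerivAt_log_deriv (ds t ht) (ds₁ t ht) (hspos t ht).ne') ?_ hl₀
      (by simp [hl₁])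
    intro t ht
    have h := hspos t ht
    have : (-M * s t - k t * s t) / s t - ((U * V - a) * c t * B t / s t) ^ 2
        + ((U * V - a) * c t * B t / s t) ^ 2 + k t = -M := by field_simp; ring
    rw [this]
    linarith
  · -- the curve starts in the fourth quadrant
    have hx' : ∀ t ∈ Icc t₀ t₁, 0 < x t := by
      intro t ht
      have h0 : 0 < x t₀ := by
        have h1 := hClair t₀ h0mem
        have h2 := mul_neg_of_neg_of_pos hy (hp t₀ h0mem)
        exact pos_of_mul_pos_left (by linarith) (hq t₀ h0mem).le
      rcases eq_or_lt_of_le ht.1 with h | h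
      · rwa [← h]
      · exact h0.trans (hxmono _ h0mem _ ht h)
    have hfneg : ∀ t ∈ Icc t₀ t₁, y t ≤ 0 → f t ≤ 0 := fun t ht h => by
      rw [hf]
      exact div_nonpos_of_nonpos_of_nonneg
        (by nlinarith [mul_nonneg (hx' t ht).le (neg_nonneg.2 h)]) (hQ t ht).le
    -- β and C differ by -2yp/Q, which is nonnegative below the x-axis.
    have hBpos : ∀ t ∈ Icc t₀ t₁, y t ≤ 0 → C ≤ B t := by
      intro t ht h
      rw [← hC t ht, hB]
      refine div_le_div_of_nonneg_right ?_ (hQ t ht).le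
      nlinarith [mul_nonneg (neg_nonneg.2 h) (hp t ht).le]
    have hcge : ∀ t ∈ Icc t₀ t₁, y t ≤ 0 → 1 ≤ c t := by
      intro t ht h
      have h1 : 0 < c t := by
        simp only [hc]
        refine div_pos ?_ (hRpos t ht)
        nlinarith [mul_pos hU (hx' t ht), mul_nonneg hV.le (neg_nonneg.2 h)]
      have h2 := hc2 t ht
      have h3 := mul_nonneg hk2.le (neg_nonneg.2 (hfneg t ht h))
      nlinarith
    have hsgt : ∀ t ∈ Icc t₀ t₁, y t ≤ 0 → -1 < s t := by
      intro t ht h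
      rcases h.lt_or_eq with h | h
      · have h1 : f t < 0 := by
          rw [hf]
          exact div_neg_of_neg_of_pos
            (by nlinarith [mul_pos (hx' t ht) (neg_pos.2 h)]) (hQ t ht)
        have h2 := hs2 t ht
        have h3 := mul_pos hk1 (neg_pos.2 h1)
        nlinarith
      · have : 0 ≤ s t := by
          simp only [hs]
          refine div_nonneg ?_ (hRpos t ht).le
          rw [h]
          nlinarith [mul_pos hU (hx' t ht)]
        linarith
    have hDneg : ∀ t ∈ Icc t₀ t₁, y t ≤ 0 → 0 < D t := by
      intro t ht h
      have h1 : 1 ≤ B t / C := (one_le_div hC0).2 (hBpos t ht h)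
      have h2 := hsgt t ht h
      simp only [hD]
      linarith
    have hspos : ∀ t ∈ Icc t₀ t₁, 0 ≤ y t → 0 < s t := by
      intro t ht h
      simp only [hs]
      refine div_pos ?_ (hRpos t ht)
      nlinarith [mul_pos hU (hx' t ht), mul_nonneg hV.le h]
    have hDpos : ∀ t ∈ Icc t₀ t₁, 0 ≤ y t → 0 < D t := by
      intro t ht h
      have h1 : -1 < B t / C := by
        rw [lt_div_iff₀ hC0, neg_one_mul, ← hC t ht, ← neg_div, hB]
        refine (div_lt_div_iff_of_pos_right (hQ t ht)).2 ?_
        nlinarith [mul_pos (hx' t ht) (hq t ht)]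
      have h2 : 0 ≤ f t := by
        rw [hf]
        exact div_nonneg (by nlinarith [mul_nonneg (hx' t ht).le h]) (hQ t ht).le
      have h3 := hs2 t ht
      have h4 := mul_nonneg hk1.le h2
      have h5 := hspos t ht h
      have h6 : 1 ≤ s t := by nlinarith
      simp only [hD]
      linarith
    -- The Wronskian of β and D is -Nc with N = (UV - a)M. With this N the shifted logarithmic
    -- derivative has defect N²(1 - c)/(βD)², nonpositive because c ≥ 1 while y ≤ 0.
    have hW : ∀ t ∈ Icc t₀ t₁, -E * s t * c t * D t - B t * D₁ t
        = -((U * V - a) * M) * c t := by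
      intro t ht
      simp only [hD, hD₁, ← hMB t ht]
      field_simp
      linear_combination (E * C * s t ^ 2 * c t) * hkk
    have dr₁ : ∀ t ∈ Icc t₀ t₁, y t ≤ 0 → HasDerivAt
        (fun t => -E * s t * c t / B t + (U * V - a) * M / (B t * D t)) _ t := fun t ht h =>
      hasDerivAt_shifted_log_deriv (dB t ht) (dB₁ t ht) (dD t ht)
        (hC0.trans_le (hBpos t ht h)).ne' (hDneg t ht h).ne'
    have hr₁ : ∀ t ∈ Icc t₀ t₁, y t ≤ 0 →
        (-(-E * s t * c t / B t + (U * V - a) * M / (B t * D t)) ^ 2 - k t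
        + (U * V - a) * M * (-E * s t * c t * D t - B t * D₁ t + (U * V - a) * M)
          / (B t * D t) ^ 2)
        + (-E * s t * c t / B t + (U * V - a) * M / (B t * D t)) ^ 2 + k t ≤ 0 := by
      intro t ht h
      rw [hW t ht]
      have h1 := hcge t ht h
      have : (U * V - a) * M * (-((U * V - a) * M) * c t + (U * V - a) * M) / (B t * D t) ^ 2 ≤ 0 := by
        refine div_nonpos_of_nonpos_of_nonneg ?_ (by positivity)
        nlinarith [mul_nonneg (sq_nonneg ((U * V - a) * M)) (sub_nonneg.2 h1)]
      linarith
    rcases le_or_gt (y t₁) 0 with hy1 | hy1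
    · have hy' : ∀ t ∈ Icc t₀ t₁, y t ≤ 0 := by
        intro t ht
        rcases eq_or_lt_of_le ht.2 with h | h
        · rwa [h]
        · exact (hymono _ ht _ h1mem h).le.trans hy1
      exact eq_zero_of_riccati h01 dl dm (fun t ht => dr₁ t ht (hy' t ht))
        (fun t ht => hr₁ t ht (hy' t ht)) hl₀ (by simp [hl₁])
    · obtain ⟨τ, hτ, hyτ⟩ : ∃ τ ∈ Icc t₀ t₁, y τ = 0 :=
        intermediate_value_Icc h01.le
          (fun t ht => (S.dy t (hJ ht)).continuousAt.continuousWithinAt) ⟨hy.le, hy1.le⟩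
      have hτ0 : t₀ < τ := lt_of_le_of_ne hτ.1 (by rintro rfl; linarith)
      have hle : ∀ t ∈ Icc t₀ τ, t ∈ Icc t₀ t₁ ∧ y t ≤ 0 := by
        intro t ht
        have ht' : t ∈ Icc t₀ t₁ := ⟨ht.1, ht.2.trans hτ.2⟩
        refine ⟨ht', ?_⟩
        rcases eq_or_lt_of_le ht.2 with h | h
        · rw [h, hyτ]
        · exact hyτ ▸ (hymono _ ht' _ hτ h).le
      have hge : ∀ t ∈ Icc τ t₁, t ∈ Icc t₀ t₁ ∧ 0 ≤ y t := by
        intro t ht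
        have ht' : t ∈ Icc t₀ t₁ := ⟨hτ.1.trans ht.1, ht.2⟩
        refine ⟨ht', ?_⟩
        rcases eq_or_lt_of_le ht.1 with h | h
        · rw [← h, hyτ]
        · exact hyτ ▸ (hymono _ hτ _ ht' h).le
      -- At the crossing y = 0 one has c = 1, so the Wronskian is exactly -N and the two Riccati
      -- functions agree. Beyond it, D'/D has defect -Ms/D < 0.
      refine eq_zero_of_riccati_glue hτ0 hτ.2 dl dm
        (fun t ht => dr₁ t (hle t ht).1 (hle t ht).2)
        (fun t ht => hr₁ t (hle t ht).1 (hle t ht).2)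
        (fun t ht => hasDerivAt_log_deriv (dD t (hge t ht).1) (dD₁ t (hge t ht).1)
          (hDpos t (hge t ht).1 (hge t ht).2).ne') ?_ ?_ hl₀ hl₁
      · intro t ht
        have h1 := hDpos t (hge t ht).1 (hge t ht).2
        have h2 := hspos t (hge t ht).1 (hge t ht).2
        have : (-M * s t - k t * D t) / D t - (D₁ t / D t) ^ 2 + (D₁ t / D t) ^ 2 + k t
            = -(M * s t / D t) := by field_simp; ring
        rw [this]
        have : 0 < M * s t / D t := by positivity
        linarith
      · have h1 := hDneg τ hτ hyτ.le
        have h2 := hC0.trans_le (hBpos τ hτ hyτ.le)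
        have h3 := hW τ hτ
        have h4 : c τ = 1 := by
          have h5 := hcge τ hτ hyτ.le
          have h6 := hc2 τ hτ
          simp only [hf, hyτ, mul_zero, zero_div, sub_zero] at h6
          nlinarith
        rw [h4] at h3
        change -E * s τ * c τ / B τ + (U * V - a) * M / (B τ * D τ) = D₁ τ / D τ
        rw [h4]
        field_simp
        linear_combination h3

end ScalarJacobi

/-! ### Disconjugacy along every non-null geodesic, by symmetry -/

theorem quad_swap (u a w x y : ℝ) : quad w a u y x = quad u a w x y := by
  unfold quad; ring

theorem quad_neg (u a w x y : ℝ) : quad u a w (-x) (-y) = quad u a w x y := by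
  unfold quad; ring

namespace ScalarJacobi

variable {u a w : ℝ} {x y p q l m : ℝ → ℝ} {J : Set ℝ}

theorem quad_pos (S : ScalarJacobi u a w x y p q l m J) (hu : 0 < u) (h : u * w - a ^ 2 = 1)
    {t : ℝ} (ht : t ∈ J) : 0 < quad u a w (x t) (y t) :=
  LorentzTorus.quad_pos hu h (S.ne t ht)

theorem exists_energy (S : ScalarJacobi u a w x y p q l m J) (hu : 0 < u)
    (h : u * w - a ^ 2 = 1) {t₀ t₁ : ℝ} (hJ : Icc t₀ t₁ ⊆ J) :
    ∃ E, ∀ t ∈ Icc t₀ t₁, 2 * (p t * q t) / quad u a w (x t) (y t) = E :=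
  ⟨_, constant_of_has_deriv_right_zero
    (fun _ ht => (S.hasDerivAt_energy (hJ ht)
      (S.quad_pos hu h (hJ ht)).ne').continuousAt.continuousWithinAt)
    (fun _ ht => (S.hasDerivAt_energy (hJ (Ico_subset_Icc_self ht))
      (S.quad_pos hu h (hJ (Ico_subset_Icc_self ht))).ne').hasDerivWithinAt)⟩

theorem exists_clairaut (S : ScalarJacobi u a w x y p q l m J) (hu : 0 < u)
    (h : u * w - a ^ 2 = 1) {t₀ t₁ : ℝ} (hJ : Icc t₀ t₁ ⊆ J) :
    ∃ C, ∀ t ∈ Icc t₀ t₁, (x t * q t + y t * p t) / quad u a w (x t) (y t) = C :=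
  ⟨_, constant_of_has_deriv_right_zero
    (fun _ ht => (S.hasDerivAt_clairaut (hJ ht)
      (S.quad_pos hu h (hJ ht)).ne').continuousAt.continuousWithinAt)
    (fun _ ht => (S.hasDerivAt_clairaut (hJ (Ico_subset_Icc_self ht))
      (S.quad_pos hu h (hJ (Ico_subset_Icc_self ht))).ne').hasDerivWithinAt)⟩

/-- Since xq + yp > 0 with p, q > 0, the starting point cannot have both coordinates negative. If x
< 0 there, then y ≥ 0, and exchanging the coordinates leads back to a start with x ≥ 0. -/
theorem deriv_eq_zero_of_clairaut_pos (S : ScalarJacobi u a w x y p q l m J) (hu : 0 < u)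
    (h : u * w - a ^ 2 = 1) {t₀ t₁ C : ℝ} (h01 : t₀ < t₁) (hJ : Icc t₀ t₁ ⊆ J)
    (hp : ∀ t ∈ Icc t₀ t₁, 0 < p t) (hq : ∀ t ∈ Icc t₀ t₁, 0 < q t)
    (hC : ∀ t ∈ Icc t₀ t₁, (x t * q t + y t * p t) / quad u a w (x t) (y t) = C)
    (hC0 : 0 < C) (hl₀ : l t₀ = 0) (hl₁ : l t₁ = 0) : m t₀ = 0 := by
  obtain ⟨E, hE⟩ := S.exists_energy hu h hJ
  have hw : 0 < w := by
    have : 0 < u * w := by nlinarith [sq_nonneg a]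
    exact pos_of_mul_pos_right this hu.le
  obtain ⟨U, hU, rfl⟩ : ∃ U : ℝ, 0 < U ∧ u = U ^ 2 :=
    ⟨√u, Real.sqrt_pos.2 hu, (Real.sq_sqrt hu.le).symm⟩
  obtain ⟨V, hV, rfl⟩ : ∃ V : ℝ, 0 < V ∧ w = V ^ 2 :=
    ⟨√w, Real.sqrt_pos.2 hw, (Real.sq_sqrt hw.le).symm⟩
  rcases le_or_gt 0 (x t₀) with hx | hx
  · exact S.deriv_eq_zero_of_start_right hU hV (by rw [mul_pow]; linarith) h01 hJ hp hq hE hC hC0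
      hx hl₀ hl₁
  · have h0 : t₀ ∈ Icc t₀ t₁ := left_mem_Icc.2 h01.le
    have hy : 0 ≤ y t₀ := by
      have h1 := hC t₀ h0
      have h2 := S.quad_pos hu h (hJ h0)
      rw [div_eq_iff h2.ne'] at h1
      have h3 := mul_pos hC0 h2
      have h4 := mul_neg_of_neg_of_pos hx (hq t₀ h0)
      exact (pos_of_mul_pos_left (b := p t₀) (by linarith) (hp t₀ h0).le).le
    refine S.swap.deriv_eq_zero_of_start_right hV hU (by rw [mul_pow]; linarith) h01 hJ hq hp
      (E := E) (C := C) ?_ ?_ hC0 hy hl₀ hl₁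
    · intro t ht
      rw [quad_swap, mul_comm (q t)]
      exact hE t ht
    · intro t ht
      rw [quad_swap, add_comm]
      exact hC t ht

/-- Here β has no zero: β = 0 together with C = 0 would give xq = yp = 0, that is, the origin. As β
solves the Jacobi equation, β'/β satisfies the Riccati equation exactly. -/
theorem deriv_eq_zero_of_clairaut_zero (S : ScalarJacobi u a w x y p q l m J) (hu : 0 < u)
    (h : u * w - a ^ 2 = 1) {t₀ t₁ : ℝ} (h01 : t₀ < t₁) (hJ : Icc t₀ t₁ ⊆ J)
    (hp : ∀ t ∈ Icc t₀ t₁, 0 < p t) (hq : ∀ t ∈ Icc t₀ t₁, 0 < q t)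
    (hC : ∀ t ∈ Icc t₀ t₁, x t * q t + y t * p t = 0)
    (hl₀ : l t₀ = 0) (hl₁ : l t₁ = 0) : m t₀ = 0 := by
  have hQ := fun t (ht : t ∈ Icc t₀ t₁) => (S.quad_pos hu h (hJ ht)).ne'
  have dB₁ : ∀ t ∈ Icc t₀ t₁, HasDerivAt (fun t => -(2 * (p t * q t) / quad u a w (x t) (y t)) *
        ((u * x t ^ 2 - w * y t ^ 2) / quad u a w (x t) (y t)))
      (-(-(2 * (2 * a * quad u a w (x t) (y t) + 4 * (x t * y t)) / quad u a w (x t) (y t) ^ 2 *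
        (p t * q t))) * ((x t * q t - y t * p t) / quad u a w (x t) (y t))) t := by
    intro t ht
    have h0 := hQ t ht
    refine ((S.hasDerivAt_energy (hJ ht) h0).neg.mul
      (((((S.dx t (hJ ht)).pow 2).const_mul u).sub (((S.dy t (hJ ht)).pow 2).const_mul w)).div
        (S.hasDerivAt_quad (hJ ht)) h0)).congr_deriv ?_
    simp only [Pi.sub_apply, Pi.pow_apply, Pi.neg_apply]
    field_simp
    simp only [quad]
    norm_num
    linear_combination (8 * x t * y t * (p t * q t) * (x t * q t - y t * p t)) * h
  have hB : ∀ t ∈ Icc t₀ t₁, (x t * q t - y t * p t) / quad u a w (x t) (y t) ≠ 0 := by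
    intro t ht
    refine div_ne_zero ?_ (hQ t ht)
    intro h1
    have h2 := hC t ht
    have h3 : x t * q t = 0 := by linarith
    have h4 : y t * p t = 0 := by linarith
    rcases S.ne t (hJ ht) with h5 | h5
    · exact mul_ne_zero h5 (hq t ht).ne' h3
    · exact mul_ne_zero h5 (hp t ht).ne' h4
  refine eq_zero_of_riccati (k := fun t => -(2 * (2 * a * quad u a w (x t) (y t)
      + 4 * (x t * y t)) / quad u a w (x t) (y t) ^ 2 * (p t * q t))) h01
    (fun t ht => S.dl t (hJ ht))
    (fun t ht => (S.dm t (hJ ht)).congr_deriv (by ring))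
    (fun t ht => hasDerivAt_log_deriv (S.hasDerivAt_beta (hJ ht) (hQ t ht)) (dB₁ t ht)
      (hB t ht)) ?_ hl₀ (by simp [hl₁])
  intro t ht
  apply le_of_eq
  rw [mul_div_assoc, div_self (hB t ht)]
  ring

/-- The time is left unspecified because for C < 0 time reversal exchanges the end points, and the
derivative is found to vanish at the later one. -/
theorem exists_trivial_of_pos (S : ScalarJacobi u a w x y p q l m J) (hu : 0 < u)
    (h : u * w - a ^ 2 = 1) {t₀ t₁ : ℝ} (h01 : t₀ < t₁) (hJ : Icc t₀ t₁ ⊆ J)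
    (hp : ∀ t ∈ Icc t₀ t₁, 0 < p t) (hq : ∀ t ∈ Icc t₀ t₁, 0 < q t)
    (hl₀ : l t₀ = 0) (hl₁ : l t₁ = 0) : ∃ t ∈ Icc t₀ t₁, l t = 0 ∧ m t = 0 := by
  obtain ⟨C, hC⟩ := S.exists_clairaut hu h hJ
  rcases lt_trichotomy C 0 with hC0 | hC0 | hC0
  · have hn : ∀ t ∈ Icc (-t₁) (-t₀), -t ∈ Icc t₀ t₁ := fun t ht =>
      ⟨by linarith [ht.2], by linarith [ht.1]⟩
    have := S.reverse.deriv_eq_zero_of_clairaut_pos hu h (neg_lt_neg h01) (C := -C)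
      (fun t ht => hJ (hn t ht)) (fun t ht => hp _ (hn t ht)) (fun t ht => hq _ (hn t ht))
      (fun t ht => by rw [quad_neg, ← hC _ (hn t ht)]; ring) (by linarith) (by simpa) (by simpa)
    exact ⟨t₁, right_mem_Icc.2 h01.le, hl₁, by simpa using this⟩
  · refine ⟨t₀, left_mem_Icc.2 h01.le, hl₀, S.deriv_eq_zero_of_clairaut_zero hu h h01 hJ hp hq ?_
      hl₀ hl₁⟩
    intro t ht
    have := hC t ht
    rwa [hC0, div_eq_zero_iff, or_iff_left (S.quad_pos hu h (hJ ht)).ne'] at this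
  · exact ⟨t₀, left_mem_Icc.2 h01.le, hl₀,
      S.deriv_eq_zero_of_clairaut_pos hu h h01 hJ hp hq hC hC0 hl₀ hl₁⟩

theorem pos_or_neg_of_ne_zero {g : ℝ → ℝ} {t₀ t₁ : ℝ} (hg : ContinuousOn g (Icc t₀ t₁))
    (h0 : ∀ t ∈ Icc t₀ t₁, g t ≠ 0) :
    (∀ t ∈ Icc t₀ t₁, 0 < g t) ∨ ∀ t ∈ Icc t₀ t₁, 0 < - g t := by
  by_contra! hcon
  obtain ⟨⟨s, hs, hs'⟩, ⟨t, ht, ht'⟩⟩ := hcon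
  obtain ⟨r, hr, hr'⟩ := isPreconnected_Icc.intermediate_value hs ht hg
    ⟨hs', by linarith⟩
  exact h0 r hr hr'

/-- Disconjugacy of the scalar Jacobi equation along a non-null geodesic. -/
theorem exists_trivial (S : ScalarJacobi u a w x y p q l m J) (hu : 0 < u)
    (h : u * w - a ^ 2 = 1) {t₀ t₁ : ℝ} (h01 : t₀ < t₁) (hJ : Icc t₀ t₁ ⊆ J)
    (hp : ∀ t ∈ Icc t₀ t₁, p t ≠ 0) (hq : ∀ t ∈ Icc t₀ t₁, q t ≠ 0)
    (hl₀ : l t₀ = 0) (hl₁ : l t₁ = 0) : ∃ t ∈ Icc t₀ t₁, l t = 0 ∧ m t = 0 := by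
  have h' : u * w - (-a) ^ 2 = 1 := by linarith [neg_sq a]
  rcases pos_or_neg_of_ne_zero
    (fun t ht => (S.dp t (hJ ht)).continuousAt.continuousWithinAt) hp with hp | hp <;>
  rcases pos_or_neg_of_ne_zero
    (fun t ht => (S.dq t (hJ ht)).continuousAt.continuousWithinAt) hq with hq | hq
  · exact S.exists_trivial_of_pos hu h h01 hJ hp hq hl₀ hl₁
  · refine S.neg.reflect.exists_trivial_of_pos hu h' h01 hJ ?_ hq hl₀ hl₁
    simpa using hp
  · exact S.reflect.exists_trivial_of_pos hu h' h01 hJ hp hq hl₀ hl₁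
  · exact S.neg.exists_trivial_of_pos hu h h01 hJ hp hq hl₀ hl₁

end ScalarJacobi

/-! ### From the scalar equation to Jacobi fields of the punctured plane -/

/-- Grönwall in both time directions: φ is bounded on the compact interval from t₀ to t, and
reversing time handles t < t₀. It serves as uniqueness for linear equations. -/
theorem eq_zero_of_norm_deriv_le {E : Type*} [NormedAddCommGroup E] [NormedSpace ℝ E]
    {f f' : ℝ → E} {φ : ℝ → ℝ} {J : Set ℝ} (hJ : J.OrdConnected) (hφ : ContinuousOn φ J)
    (hf : ∀ t ∈ J, HasDerivAt f (f' t) t) (hb : ∀ t ∈ J, ‖f' t‖ ≤ φ t * ‖f t‖)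
    {t₀ : ℝ} (h₀ : t₀ ∈ J) (h0 : f t₀ = 0) {t : ℝ} (ht : t ∈ J) : f t = 0 := by
  rcases le_total t₀ t with hle | hle
  · have hsub : Icc t₀ t ⊆ J := hJ.out h₀ ht
    obtain ⟨K, hK⟩ := (isCompact_Icc.image_of_continuousOn (hφ.mono hsub)).bddAbove
    refine eq_zero_of_abs_deriv_le_mul_abs_self_of_eq_zero_right (K := K)
      (fun s hs => (hf s (hsub hs)).continuousAt.continuousWithinAt)
      (fun s hs => (hf s (hsub (Ico_subset_Icc_self hs))).hasDerivWithinAt) h0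
      (fun s hs => (hb s (hsub (Ico_subset_Icc_self hs))).trans
        (mul_le_mul_of_nonneg_right (hK ⟨s, Ico_subset_Icc_self hs, rfl⟩) (norm_nonneg _))) t
      (right_mem_Icc.2 hle)
  · have hsub : Icc t t₀ ⊆ J := hJ.out ht h₀
    have hsub' : ∀ s ∈ Icc (-t₀) (-t), -s ∈ Icc t t₀ := fun s hs =>
      ⟨by linarith [hs.2], by linarith [hs.1]⟩
    obtain ⟨K, hK⟩ := (isCompact_Icc.image_of_continuousOn (hφ.mono hsub)).bddAbove
    have hd : ∀ s ∈ Icc (-t₀) (-t), HasDerivAt (fun s => f (-s)) (-f' (-s)) s := by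
      intro s hs
      exact ((hf (-s) (hsub (hsub' s hs))).scomp s (hasDerivAt_neg s)).congr_deriv (by simp)
    have := eq_zero_of_abs_deriv_le_mul_abs_self_of_eq_zero_right (K := K)
      (fun s hs => (hd s hs).continuousAt.continuousWithinAt)
      (fun s hs => (hd s (Ico_subset_Icc_self hs)).hasDerivWithinAt) (by simpa using h0)
      (fun s hs => by
        rw [norm_neg]
        exact (hb _ (hsub (hsub' s (Ico_subset_Icc_self hs)))).trans
          (mul_le_mul_of_nonneg_right (hK ⟨-s, hsub' s (Ico_subset_Icc_self hs), rfl⟩)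
            (norm_nonneg _))) (-t) (right_mem_Icc.2 (neg_le_neg hle))
    simpa using this

/-- Rolle gives a zero of the slope h, which is constant. -/
theorem eq_zero_of_affine {g h : ℝ → ℝ} {J : Set ℝ} (hJ : J.OrdConnected)
    (hg : ∀ t ∈ J, HasDerivAt g (h t) t) (hh : ∀ t ∈ J, HasDerivAt h 0 t)
    {t₀ t₁ : ℝ} (h₀ : t₀ ∈ J) (h₁ : t₁ ∈ J) (h01 : t₀ < t₁) (hg₀ : g t₀ = 0) (hg₁ : g t₁ = 0)
    {t : ℝ} (ht : t ∈ J) : g t = 0 := by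
  have hsub := hJ.out h₀ h₁
  obtain ⟨c, hc, hc'⟩ := exists_hasDerivAt_eq_zero h01
    (fun s hs => (hg s (hsub hs)).continuousAt.continuousWithinAt) (hg₀.trans hg₁.symm)
    (fun s hs => hg s (hsub (Ioo_subset_Icc_self hs)))
  have hh0 : ∀ s ∈ J, h s = 0 := fun s hs =>
    eq_zero_of_norm_deriv_le (φ := fun _ => 0) hJ continuousOn_const hh (by simp)
      (hsub (Ioo_subset_Icc_self hc)) hc' hs
  exact eq_zero_of_norm_deriv_le (φ := fun _ => 0) hJ continuousOn_const hg
    (fun s hs => by simp [hh0 s hs]) h₀ hg₀ ht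

section Jacobi

variable {u a w : ℝ} {γ Y : ℝ → Plane} {J : Set ℝ}

theorem IsGeodesicOn.hasDerivAt {g : MetricTensor} {U : Set Plane} (h : IsGeodesicOn g U γ J)
    (hJ : IsOpen J) {t : ℝ} (ht : t ∈ J) (k : Fin 2) :
    HasDerivAt (fun s => γ s k) (deriv γ t k) t :=
  hasDerivAt_pi.1 ((h.contDiffOn.differentiableOn (by norm_num)).differentiableAt
    (hJ.mem_nhds ht)).hasDerivAt k

theorem IsGeodesicOn.quad_ne_zero (hG : IsGeodesicOn (quadMetric u a w) punctured γ J)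
    (hu : 0 < u) (h : u * w - a ^ 2 = 1) {t : ℝ} (ht : t ∈ J) :
    quad u a w (γ t 0) (γ t 1) ≠ 0 :=
  (quad_pos hu h (mem_punctured_iff.1 (hG.mapsTo ht))).ne'

theorem IsGeodesicOn.hasDerivAt_deriv (hG : IsGeodesicOn (quadMetric u a w) punctured γ J)
    (hu : 0 < u) (h : u * w - a ^ 2 = 1) (hJ : IsOpen J) {t : ℝ} (ht : t ∈ J) (k : Fin 2) :
    HasDerivAt (fun s => deriv γ s k) (quadLog u a w k (γ t) * deriv γ t k ^ 2) t := by
  have h1 := hasDerivAt_pi.1 (((hG.contDiffOn.deriv_of_isOpen hJ (m := 1)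
    (by norm_num)).differentiableOn (by norm_num)).differentiableAt (hJ.mem_nhds ht)).hasDerivAt k
  have h2 := congrFun (hG.geodesic_eq t ht) k
  rw [covDeriv_quadMetric (hG.quad_ne_zero hu h ht)] at h2
  refine h1.congr_deriv ?_
  simp only [Pi.zero_apply] at h2
  linarith

theorem IsJacobiOn.hasDerivAt (hY : IsJacobiOn (quadMetric u a w) punctured γ Y J)
    (hu : 0 < u) (h : u * w - a ^ 2 = 1) (hJ : IsOpen J) {t : ℝ} (ht : t ∈ J) (k : Fin 2) :
    HasDerivAt (fun s => Y s k) (covDeriv (quadMetric u a w) γ Y t k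
      + quadLog u a w k (γ t) * deriv γ t k * Y t k) t := by
  have h1 := hasDerivAt_pi.1 ((hY.contDiffOn.differentiableOn (by norm_num)).differentiableAt
    (hJ.mem_nhds ht)).hasDerivAt k
  refine h1.congr_deriv ?_
  rw [covDeriv_quadMetric (hY.geodesic.quad_ne_zero hu h ht)]
  ring

theorem differentiableAt_quadLog {p : Plane} (hp : quad u a w (p 0) (p 1) ≠ 0) (k : Fin 2) :
    DifferentiableAt ℝ (quadLog u a w k) p := by
  have h1 : DifferentiableAt ℝ (fun q : Plane => quad u a w (q 0) (q 1)) p :=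
    ((contDiff_quad u a w).differentiable (by norm_num)).differentiableAt
  have h2 : DifferentiableAt ℝ (fun q : Plane => quadD u a w k (q 0) (q 1)) p := by
    unfold quadD
    split_ifs <;> fun_prop
  exact h2.mul (h1.inv hp)

theorem IsJacobiOn.hasDerivAt_covDeriv (hY : IsJacobiOn (quadMetric u a w) punctured γ Y J)
    (hu : 0 < u) (h : u * w - a ^ 2 = 1) (hJ : IsOpen J) {t : ℝ} (ht : t ∈ J) (k : Fin 2) :
    HasDerivAt (fun s => covDeriv (quadMetric u a w) γ Y s k)
      (quadLog u a w k (γ t) * deriv γ t k * covDeriv (quadMetric u a w) γ Y t k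
        - (quadMixed u a w (γ t) * (Y t 0 * deriv γ t 1 - Y t 1 * deriv γ t 0))
          * (![- deriv γ t 0, deriv γ t 1] : Plane) k) t := by
  have hq := hY.geodesic.quad_ne_zero hu h ht
  -- The Jacobi equation alone does not give this, as `deriv` is 0 at points of
  -- non-differentiability. It comes from γ and Y being C².
  have hdiff : DifferentiableAt ℝ (covDeriv (quadMetric u a w) γ Y) t := by
    have he : covDeriv (quadMetric u a w) γ Y =ᶠ[𝓝 t] fun s k =>
        deriv Y s k - quadLog u a w k (γ s) * deriv γ s k * Y s k := by
      filter_upwards [hJ.mem_nhds ht] with s hs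
      funext k
      exact covDeriv_quadMetric (hY.geodesic.quad_ne_zero hu h hs) Y k
    refine DifferentiableAt.congr_of_eventuallyEq ?_ he
    refine differentiableAt_pi.2 fun k => ?_
    have h1 := differentiableAt_pi.1 (((hY.contDiffOn.deriv_of_isOpen hJ (m := 1)
      (by norm_num)).differentiableOn (by norm_num)).differentiableAt (hJ.mem_nhds ht)) k
    have h2 := (hY.geodesic.hasDerivAt_deriv hu h hJ ht k).differentiableAt
    have h3 := (hY.hasDerivAt hu h hJ ht k).differentiableAt
    have h4 : DifferentiableAt ℝ (fun s => quadLog u a w k (γ s)) t :=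
      (differentiableAt_quadLog hq k).comp t
        ((hY.geodesic.contDiffOn.differentiableOn (by norm_num)).differentiableAt
          (hJ.mem_nhds ht))
    exact h1.sub ((h4.mul h2).mul h3)
  have h1 := hasDerivAt_pi.1 hdiff.hasDerivAt k
  have h2 := congrFun (hY.jacobi_eq t ht) k
  rw [curvature_quadMetric h hq, Pi.add_apply, covDeriv_quadMetric hq, Pi.smul_apply,
    smul_eq_mul, Pi.zero_apply] at h2
  refine h1.congr_deriv ?_
  linarith

end Jacobi

theorem noConjugatePoints_quadMetric {u a w : ℝ} (hu : 0 < u) (h : u * w - a ^ 2 = 1) :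
    NoConjugatePoints (quadMetric u a w) punctured := by
  suffices H : ∀ (J : Set ℝ) (γ Y : ℝ → Plane), IsOpen J → J.OrdConnected →
      IsJacobiOn (quadMetric u a w) punctured γ Y J →
      ∀ t₀ ∈ J, ∀ t₁ ∈ J, t₀ < t₁ → Y t₀ = 0 → Y t₁ = 0 → ∀ t ∈ J, Y t = 0 by
    intro J γ Y hJ hJ' hY t₀ h₀ t₁ h₁ h01 hY₀ hY₁
    rcases h01.lt_or_gt with h01 | h01
    · exact H J γ Y hJ hJ' hY t₀ h₀ t₁ h₁ h01 hY₀ hY₁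
    · exact H J γ Y hJ hJ' hY t₁ h₁ t₀ h₀ h01 hY₁ hY₀
  intro J γ Y hJ hJ' hY t₀ h₀ t₁ h₁ h01 hY₀ hY₁
  have hsub := hJ'.out h₀ h₁
  set DY := covDeriv (quadMetric u a w) γ Y with hDY
  have hq : ∀ t ∈ J, quad u a w (γ t 0) (γ t 1) ≠ 0 := fun t ht =>
    hY.geodesic.quad_ne_zero hu h ht
  have dγ : ∀ k, ∀ t ∈ J, HasDerivAt (fun s => γ s k) (deriv γ t k) t := fun k t ht =>
    hY.geodesic.hasDerivAt hJ ht k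
  have dp : ∀ k, ∀ t ∈ J, HasDerivAt (fun s => deriv γ s k)
      (quadLog u a w k (γ t) * deriv γ t k ^ 2) t := fun k t ht =>
    hY.geodesic.hasDerivAt_deriv hu h hJ ht k
  have dY : ∀ k, ∀ t ∈ J, HasDerivAt (fun s => Y s k)
      (DY t k + quadLog u a w k (γ t) * deriv γ t k * Y t k) t := fun k t ht =>
    hY.hasDerivAt hu h hJ ht k
  have dDY : ∀ k, ∀ t ∈ J, HasDerivAt (fun s => DY s k)
      (quadLog u a w k (γ t) * deriv γ t k * DY t k
        - (quadMixed u a w (γ t) * (Y t 0 * deriv γ t 1 - Y t 1 * deriv γ t 0))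
          * (![- deriv γ t 0, deriv γ t 1] : Plane) k) t := fun k t ht =>
    hY.hasDerivAt_covDeriv hu h hJ ht k
  -- The geodesic equation for one component of the velocity is linear in it, with a coefficient
  -- continuous along the curve, so one zero propagates to all of J.
  have hv : ∀ k, (∃ t ∈ J, deriv γ t k = 0) → ∀ t ∈ J, deriv γ t k = 0 := by
    rintro k ⟨s, hs, hs0⟩ t ht
    refine eq_zero_of_norm_deriv_le (φ := fun t => |quadLog u a w k (γ t) * deriv γ t k|) hJ' ?_
      (dp k) (fun t _ => by rw [← Real.norm_eq_abs, ← norm_mul]; ring_nf; rfl) hs hs0 ht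
    refine ContinuousOn.abs (ContinuousOn.mul ?_
      fun t ht => (dp k t ht).continuousAt.continuousWithinAt)
    intro t ht
    exact ((differentiableAt_quadLog (hq t ht) k).continuousAt.comp
      (hY.geodesic.contDiffOn.continuousOn.continuousAt (hJ.mem_nhds ht))).continuousWithinAt
  -- A component of `Y` vanishes when its second covariant derivative does.
  have hcomp : ∀ k, (∀ t ∈ J, (Y t 0 * deriv γ t 1 - Y t 1 * deriv γ t 0)
      * (![- deriv γ t 0, deriv γ t 1] : Plane) k = 0) → ∀ t ∈ J, Y t k = 0 := by
    intro k hk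
    have dDY' : ∀ t ∈ J, HasDerivAt (fun s => DY s k)
        (quadLog u a w k (γ t) * deriv γ t k * DY t k) t := fun t ht =>
      (dDY k t ht).congr_deriv (by rw [mul_assoc (quadMixed u a w (γ t)), hk t ht]; ring)
    by_cases hz : ∃ t ∈ J, deriv γ t k = 0
    · have hz' := hv k hz
      exact fun t ht => eq_zero_of_affine hJ'
        (fun t ht => (dY k t ht).congr_deriv (by rw [hz' t ht]; ring))
        (fun t ht => (dDY' t ht).congr_deriv (by rw [hz' t ht]; ring)) h₀ h₁ h01
        (by simp [hY₀]) (by simp [hY₁]) ht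
    · push Not at hz
      intro t ht
      -- The velocity component is parallel, so dividing by it turns covariant derivatives into
      -- ordinary ones, and the quotient is affine.
      have := eq_zero_of_affine hJ' (g := fun s => Y s k / deriv γ s k)
        (h := fun s => DY s k / deriv γ s k)
        (fun t ht => ((dY k t ht).div (dp k t ht) (hz t ht)).congr_deriv (by
          have := hz t ht
          field_simp
          ring))
        (fun t ht => ((dDY' t ht).div (dp k t ht) (hz t ht)).congr_deriv (by
          have := hz t ht
          field_simp
          ring)) h₀ h₁ h01
        (by simp [hY₀]) (by simp [hY₁]) ht
      simpa [hz t ht] using this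
  have hext : (∀ t ∈ J, Y t 0 = 0) → (∀ t ∈ J, Y t 1 = 0) → ∀ t ∈ J, Y t = 0 := by
    intro h0 h1 t ht
    ext k
    fin_cases k
    · exact h0 t ht
    · exact h1 t ht
  -- Null geodesic: the curvature term has no component along the vanishing velocity direction, so
  -- that component of Y is zero. The area of Y and γ' then vanishes too, and with it the curvature
  -- term of the other component.
  by_cases hz0 : ∃ t ∈ J, deriv γ t 0 = 0
  · have hz := hv 0 hz0
    have e0 := hcomp 0 (fun t ht => by simp [hz t ht])
    exact hext e0 (hcomp 1 (fun t ht => by simp [hz t ht, e0 t ht]))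
  by_cases hz1 : ∃ t ∈ J, deriv γ t 1 = 0
  · have hz := hv 1 hz1
    have e1 := hcomp 1 (fun t ht => by simp [hz t ht])
    exact hext (hcomp 0 (fun t ht => by simp [hz t ht, e1 t ht])) e1
  push Not at hz0 hz1
  have hlog : ∀ k t, quadLog u a w k (γ t)
      = quadD u a w k (γ t 0) (γ t 1) / quad u a w (γ t 0) (γ t 1) := fun _ _ => rfl
  have dquad : ∀ t ∈ J, HasDerivAt (fun s => quad u a w (γ s 0) (γ s 1))
      (quadD u a w 0 (γ t 0) (γ t 1) * deriv γ t 0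
        + quadD u a w 1 (γ t 0) (γ t 1) * deriv γ t 1) t := by
    intro t ht
    exact ((hasFDerivAt_quad u a w (γ t)).comp_hasDerivAt t
      (hasDerivAt_pi.2 fun k => dγ k t ht)).congr_deriv (by simp)
  -- The velocity is parallel, so differentiating this pairing only replaces F and G by covariant
  -- derivatives. With G = Y₁ it is the product of Y with γ', and with G = -Y₁ their area.
  have dmul : ∀ {F G : ℝ → ℝ} {F' G' t : ℝ}, t ∈ J → HasDerivAt F F' t → HasDerivAt G G' t →
      HasDerivAt (fun s => (F s * deriv γ s 1 + G s * deriv γ s 0)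
        / quad u a w (γ s 0) (γ s 1))
        (((F' - quadLog u a w 0 (γ t) * deriv γ t 0 * F t) * deriv γ t 1
          + (G' - quadLog u a w 1 (γ t) * deriv γ t 1 * G t) * deriv γ t 0)
            / quad u a w (γ t 0) (γ t 1)) t := by
    intro F G F' G' t ht hF hG
    refine (((hF.mul (dp 1 t ht)).add (hG.mul (dp 0 t ht))).div (dquad t ht)
      (hq t ht)).congr_deriv ?_
    have h0 := hq t ht
    simp only [Pi.add_apply, Pi.mul_apply, hlog]
    field_simp
    ring
  -- The curvature term is orthogonal to the velocity, so the product of Y with γ' is affine in t.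
  -- It vanishes twice.
  have hg : ∀ t ∈ J, (Y t 0 * deriv γ t 1 + Y t 1 * deriv γ t 0)
      / quad u a w (γ t 0) (γ t 1) = 0 := by
    intro t ht
    refine eq_zero_of_affine hJ' (g := fun t => (Y t 0 * deriv γ t 1 + Y t 1 * deriv γ t 0)
      / quad u a w (γ t 0) (γ t 1)) (h := fun t => (DY t 0 * deriv γ t 1 + DY t 1 * deriv γ t 0)
      / quad u a w (γ t 0) (γ t 1))
      (fun t ht => (dmul ht (dY 0 t ht) (dY 1 t ht)).congr_deriv (by ring))
      (fun t ht => (dmul ht (dDY 0 t ht) (dDY 1 t ht)).congr_deriv (by simp; ring_nf; simp))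
      h₀ h₁ h01 (by simp [hY₀]) (by simp [hY₁]) ht
  set l : ℝ → ℝ := fun t => (Y t 0 * deriv γ t 1 + (- Y t 1) * deriv γ t 0)
    / quad u a w (γ t 0) (γ t 1) with hl
  set m : ℝ → ℝ := fun t => (DY t 0 * deriv γ t 1 + (- DY t 1) * deriv γ t 0)
    / quad u a w (γ t 0) (γ t 1) with hm
  have S : ScalarJacobi u a w (fun t => γ t 0) (fun t => γ t 1) (fun t => deriv γ t 0)
      (fun t => deriv γ t 1) l m J :=
    { ne := fun t ht => mem_punctured_iff.1 (hY.geodesic.mapsTo ht)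
      dx := dγ 0
      dy := dγ 1
      dp := fun t ht => (dp 0 t ht).congr_deriv (by simp [hlog, quadD])
      dq := fun t ht => (dp 1 t ht).congr_deriv (by simp [hlog, quadD])
      dl := fun t ht => (dmul ht (dY 0 t ht) (dY 1 t ht).neg).congr_deriv (by
        simp only [hm, Pi.neg_apply]; ring)
      dm := fun t ht => (dmul ht (dDY 0 t ht) (dDY 1 t ht).neg).congr_deriv (by
        have h0 := hq t ht
        simp only [hl, Pi.neg_apply, quadMixed]
        simp
        field_simp
        ring) }
  obtain ⟨τ, hτ, hl0, hm0⟩ := S.exists_trivial hu h h01 hsub (fun t ht => hz0 t (hsub ht))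
    (fun t ht => hz1 t (hsub ht)) (by simp [hl, hY₀]) (by simp [hl, hY₁])
  have hlz : ∀ t ∈ J, l t = 0 := by
    intro t ht
    have hcont : ContinuousOn (fun t => max 1 |2 * (2 * a * quad u a w (γ t 0) (γ t 1)
        + 4 * (γ t 0 * γ t 1)) / quad u a w (γ t 0) (γ t 1) ^ 2
          * (deriv γ t 0 * deriv γ t 1)|) J := by
      have c1 : ∀ k, ContinuousOn (fun t => γ t k) J := fun k t ht =>
        (dγ k t ht).continuousAt.continuousWithinAt
      have c2 : ∀ k, ContinuousOn (fun t => deriv γ t k) J := fun k t ht =>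
        (dp k t ht).continuousAt.continuousWithinAt
      have c3 : ContinuousOn (fun s => quad u a w (γ s 0) (γ s 1)) J := fun t ht =>
        (dquad t ht).continuousAt.continuousWithinAt
      refine continuousOn_const.sup (ContinuousOn.abs (ContinuousOn.mul (ContinuousOn.div ?_
        (c3.pow 2) fun t ht => pow_ne_zero 2 (hq t ht)) ((c2 0).mul (c2 1))))
      exact continuousOn_const.mul ((continuousOn_const.mul c3).add
        (continuousOn_const.mul ((c1 0).mul (c1 1))))
    have := eq_zero_of_norm_deriv_le (f := fun t => (l t, m t)) hJ' hcont
      (fun t ht => (S.dl t ht).prodMk (S.dm t ht)) ?_ (hsub hτ)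
      (by rw [hl0, hm0]; rfl) ht
    · exact congrArg Prod.fst this
    · intro t ht
      rw [Prod.norm_def, Prod.norm_def]
      simp only [norm_mul]
      refine max_le ?_ ?_
      · calc ‖m t‖ ≤ 1 * max ‖l t‖ ‖m t‖ := by rw [one_mul]; exact le_max_right _ _
          _ ≤ _ := mul_le_mul_of_nonneg_right (le_max_left _ _) (by positivity)
      · refine mul_le_mul ?_ (le_max_left _ _) (norm_nonneg _) (by positivity)
        rw [← norm_mul, ← norm_mul, ← Real.norm_eq_abs]
        exact le_max_right _ _
  refine hext ?_ ?_
  · intro t ht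
    have h1 := hg t ht
    have h2 := hlz t ht
    simp only [hl] at h2
    rw [div_eq_zero_iff, or_iff_left (hq t ht)] at h1 h2
    have : Y t 0 * deriv γ t 1 = 0 := by linarith
    exact (mul_eq_zero.1 this).resolve_right (hz1 t ht)
  · intro t ht
    have h1 := hg t ht
    have h2 := hlz t ht
    simp only [hl] at h2
    rw [div_eq_zero_iff, or_iff_left (hq t ht)] at h1 h2
    have : Y t 1 * deriv γ t 0 = 0 := by linarith
    exact (mul_eq_zero.1 this).resolve_right (hz0 t ht)

/-! ### Geodesics and Jacobi fields of the tori: locality, homotheties, lifts -/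

section Locality

variable {g : MetricTensor} {U : Set Plane} {γ γ' Y Y' : ℝ → Plane} {t : ℝ}

theorem covDeriv_congr (hγ : γ =ᶠ[𝓝 t] γ') (hY : Y =ᶠ[𝓝 t] Y') :
    covDeriv g γ Y =ᶠ[𝓝 t] covDeriv g γ' Y' := by
  filter_upwards [hγ, hY, hγ.deriv, hY.deriv] with s h1 h2 h3 h4
  funext k
  simp only [covDeriv, h1, h2, h3, h4]

/-- All conditions at t depend only on the germs of γ and Y at t. This is what permits splicing of
lifts. -/
theorem IsJacobiOn.of_local {J : Set ℝ} (H : ∀ t ∈ J, ∃ (γ' Y' : ℝ → Plane) (J' : Set ℝ),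
    IsOpen J' ∧ t ∈ J' ∧ IsJacobiOn g U γ' Y' J' ∧ γ =ᶠ[𝓝 t] γ' ∧ Y =ᶠ[𝓝 t] Y') :
    IsJacobiOn g U γ Y J where
  geodesic :=
    { contDiffOn := fun t ht => by
        obtain ⟨γ', Y', J', hJ', htJ, hY', e1, e2⟩ := H t ht
        exact ((hY'.geodesic.contDiffOn.contDiffAt (hJ'.mem_nhds htJ)).congr_of_eventuallyEq
          e1).contDiffWithinAt
      mapsTo := fun t ht => by
        obtain ⟨γ', Y', J', hJ', htJ, hY', e1, e2⟩ := H t ht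
        rw [e1.self_of_nhds]
        exact hY'.geodesic.mapsTo htJ
      geodesic_eq := fun t ht => by
        obtain ⟨γ', Y', J', hJ', htJ, hY', e1, e2⟩ := H t ht
        rw [(covDeriv_congr e1 e1.deriv).self_of_nhds]
        exact hY'.geodesic.geodesic_eq t htJ }
  contDiffOn := fun t ht => by
    obtain ⟨γ', Y', J', hJ', htJ, hY', e1, e2⟩ := H t ht
    exact ((hY'.contDiffOn.contDiffAt (hJ'.mem_nhds htJ)).congr_of_eventuallyEq
      e2).contDiffWithinAt
  jacobi_eq := fun t ht => by
    obtain ⟨γ', Y', J', hJ', htJ, hY', e1, e2⟩ := H t ht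
    rw [(covDeriv_congr e1 (covDeriv_congr e1 e2)).self_of_nhds, e1.self_of_nhds,
      e2.self_of_nhds, e1.deriv.self_of_nhds]
    exact hY'.jacobi_eq t htJ

theorem IsJacobiOn.congr {J : Set ℝ} (hJ : IsOpen J) (hY : IsJacobiOn g U γ Y J)
    (h1 : EqOn γ' γ J) (h2 : EqOn Y' Y J) : IsJacobiOn g U γ' Y' J :=
  IsJacobiOn.of_local fun _ ht => ⟨γ, Y, J, hJ, ht, hY,
    h1.eventuallyEq_of_mem (hJ.mem_nhds ht), h2.eventuallyEq_of_mem (hJ.mem_nhds ht)⟩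

theorem IsJacobiOn.mono {J J' : Set ℝ} (hJ : IsOpen J) (hY : IsJacobiOn g U γ Y J)
    (h : J' ⊆ J) : IsJacobiOn g U γ Y J' :=
  IsJacobiOn.of_local fun _ ht => ⟨γ, Y, J, hJ, h ht, hY, .rfl, .rfl⟩

end Locality

section Homothety

variable {u a w c : ℝ}

theorem quad_smul (p : Plane) :
    quad u a w ((c • p) 0) ((c • p) 1) = c ^ 2 * quad u a w (p 0) (p 1) := by
  simp only [quad, Pi.smul_apply, smul_eq_mul]; ring

theorem quadLog_smul (hc : c ≠ 0) (k : Fin 2) (p : Plane) :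
    quadLog u a w k (c • p) = c⁻¹ * quadLog u a w k p := by
  have : quadD u a w k ((c • p) 0) ((c • p) 1) = c * quadD u a w k (p 0) (p 1) := by
    fin_cases k <;> simp [quadD] <;> ring
  rw [quadLog, quad_smul, this, quadLog]
  field_simp

theorem quadMixed_smul (hc : c ≠ 0) (p : Plane) :
    quadMixed u a w (c • p) = (c ^ 2)⁻¹ * quadMixed u a w p := by
  rw [quadMixed, quad_smul, quadMixed, Pi.smul_apply, Pi.smul_apply, smul_eq_mul, smul_eq_mul]
  field_simp

theorem covDeriv_smul (hc : c ≠ 0) {γ Y : ℝ → Plane} {t : ℝ}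
    (ht : quad u a w (γ t 0) (γ t 1) ≠ 0) :
    covDeriv (quadMetric u a w) (fun s => c • γ s) (fun s => c • Y s) t
      = c • covDeriv (quadMetric u a w) γ Y t := by
  have hd : ∀ Z : ℝ → Plane, deriv (fun s => c • Z s) t = c • deriv Z t := fun Z =>
    deriv_fun_const_smul_field c Z
  have ht' : quad u a w ((c • γ t) 0) ((c • γ t) 1) ≠ 0 := by
    rw [quad_smul]; exact mul_ne_zero (pow_ne_zero 2 hc) ht
  funext k
  change _ = c * covDeriv (quadMetric u a w) γ Y t k
  rw [covDeriv_quadMetric ht', covDeriv_quadMetric ht, quadLog_smul hc, hd, hd]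
  simp only [Pi.smul_apply, smul_eq_mul]
  field_simp

theorem IsJacobiOn.smul (hu : 0 < u) (h : u * w - a ^ 2 = 1) (hc : c ≠ 0) {γ Y : ℝ → Plane}
    {J : Set ℝ} (hJ : IsOpen J) (hY : IsJacobiOn (quadMetric u a w) punctured γ Y J) :
    IsJacobiOn (quadMetric u a w) punctured (fun s => c • γ s) (fun s => c • Y s) J where
  geodesic :=
    { contDiffOn := hY.geodesic.contDiffOn.const_smul c
      mapsTo := fun _ ht => smul_ne_zero hc (hY.geodesic.mapsTo ht)
      geodesic_eq := fun t ht => by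
        have : deriv (fun s => c • γ s) = fun s => c • deriv γ s := by
          funext s
          exact deriv_fun_const_smul_field c γ
        rw [this, covDeriv_smul hc (hY.geodesic.quad_ne_zero hu h ht),
          hY.geodesic.geodesic_eq t ht, smul_zero] }
  contDiffOn := hY.contDiffOn.const_smul c
  jacobi_eq := fun t ht => by
    have hq := hY.geodesic.quad_ne_zero hu h ht
    have he : covDeriv (quadMetric u a w) (fun s => c • γ s) (fun s => c • Y s) =ᶠ[𝓝 t]
        fun s => c • covDeriv (quadMetric u a w) γ Y s := by
      filter_upwards [hJ.mem_nhds ht] with s hs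
      exact covDeriv_smul hc (hY.geodesic.quad_ne_zero hu h hs)
    have hd : deriv (fun s => c • γ s) t = c • deriv γ t := deriv_fun_const_smul_field c γ
    have hq' : quad u a w ((c • γ t) 0) ((c • γ t) 1) ≠ 0 := by
      rw [quad_smul]; exact mul_ne_zero (pow_ne_zero 2 hc) hq
    have h1 := hY.jacobi_eq t ht
    rw [curvature_quadMetric h hq] at h1
    rw [(covDeriv_congr Filter.EventuallyEq.rfl he).self_of_nhds, covDeriv_smul hc hq,
      curvature_quadMetric h hq', quadMixed_smul hc, hd]
    refine Eq.trans ?_ ((congrArg (c • ·) h1).trans (smul_zero c))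
    simp only [smul_add]
    congr 1
    ext k
    fin_cases k <;> simp <;> field_simp

end Homothety

/-- `(γ, W)` is a lift, on `J`, of a curve of the torus with a field along it. -/
def IsLiftOn (g : MetricTensor) (c : ℝˣ) (κ : ℝ → HomothetyTorus c) (Y : ℝ → TorusTangent c)
    (γ W : ℝ → Plane) (J : Set ℝ) : Prop :=
  IsJacobiOn g punctured γ W J ∧ ∀ s ∈ J, ∃ h : γ s ∈ punctured,
    κ s = HomothetyTorus.mk c ⟨γ s, h⟩ ∧ Y s = TorusTangent.mk c ⟨γ s, h⟩ (W s)

section Lift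

variable {u a w : ℝ} {c : ℝˣ} {κ : ℝ → HomothetyTorus c} {Y : ℝ → TorusTangent c}
  {γ W γ' W' : ℝ → Plane}

theorem TorusTangent.mk_eq_iff {p q : punctured} {v v' : Plane} :
    TorusTangent.mk c p v = TorusTangent.mk c q v' ↔
      ∃ n : ℤ, q.1 = ((c ^ n : ℝˣ) : ℝ) • p.1 ∧ v' = ((c ^ n : ℝˣ) : ℝ) • v :=
  Quotient.eq

theorem HomothetyTorus.mk_eq_iff {p q : punctured} :
    HomothetyTorus.mk c p = HomothetyTorus.mk c q ↔
      ∃ n : ℤ, q.1 = ((c ^ n : ℝˣ) : ℝ) • p.1 :=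
  Quotient.eq

theorem TorusTangent.isZero_mk_iff {p : punctured} {v : Plane} :
    (TorusTangent.mk c p v).IsZero ↔ v = 0 := by
  constructor
  · rintro ⟨q, hq⟩
    obtain ⟨n, -, hn⟩ := TorusTangent.mk_eq_iff.1 hq
    exact (smul_eq_zero.1 hn.symm).resolve_left (c ^ n).ne_zero
  · rintro rfl
    exact ⟨p, rfl⟩

theorem IsLiftOn.mono {g : MetricTensor} {J J' : Set ℝ} (hJ : IsOpen J)
    (H : IsLiftOn g c κ Y γ W J) (h : J' ⊆ J) : IsLiftOn g c κ Y γ W J' :=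
  ⟨H.1.mono hJ h, fun s hs => H.2 s (h hs)⟩

theorem IsLiftOn.congr {g : MetricTensor} {J : Set ℝ} (hJ : IsOpen J)
    (H : IsLiftOn g c κ Y γ W J) (h1 : EqOn γ' γ J) (h2 : EqOn W' W J) :
    IsLiftOn g c κ Y γ' W' J := by
  refine ⟨H.1.congr hJ h1 h2, fun s hs => ?_⟩
  rw [h2 hs]
  simp only [h1 hs]
  exact H.2 s hs

theorem IsLiftOn.smul (hu : 0 < u) (h : u * w - a ^ 2 = 1) {J : Set ℝ} (hJ : IsOpen J)
    (H : IsLiftOn (quadMetric u a w) c κ Y γ W J) (n : ℤ) :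
    IsLiftOn (quadMetric u a w) c κ Y (fun s => ((c ^ n : ℝˣ) : ℝ) • γ s)
      (fun s => ((c ^ n : ℝˣ) : ℝ) • W s) J := by
  refine ⟨H.1.smul hu h (c ^ n).ne_zero hJ, fun s hs => ?_⟩
  obtain ⟨hp, h1, h2⟩ := H.2 s hs
  refine ⟨smul_ne_zero (c ^ n).ne_zero hp, ?_, ?_⟩
  · rw [h1]
    exact HomothetyTorus.mk_eq_iff.2 ⟨n, rfl⟩
  · rw [h2]
    exact TorusTangent.mk_eq_iff.2 ⟨n, rfl, rfl⟩

/-- Two lifts over an interval differ by one deck transformation. -/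
theorem IsLiftOn.exists_zpow {g : MetricTensor} (hc : |(c : ℝ)| ≠ 1) {b d : ℝ}
    (H : IsLiftOn g c κ Y γ W (Ioo b d)) (H' : IsLiftOn g c κ Y γ' W' (Ioo b d)) (hbd : b < d) :
    ∃ n : ℤ, ∀ s ∈ Ioo b d, γ' s = ((c ^ n : ℝˣ) : ℝ) • γ s ∧
      W' s = ((c ^ n : ℝˣ) : ℝ) • W s := by
  have hn : ∀ s ∈ Ioo b d, ∃ n : ℤ, γ' s = ((c ^ n : ℝˣ) : ℝ) • γ s ∧
      W' s = ((c ^ n : ℝˣ) : ℝ) • W s := by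
    intro s hs
    obtain ⟨h1, -, h2⟩ := H.2 s hs
    obtain ⟨h1', -, h2'⟩ := H'.2 s hs
    exact TorusTangent.mk_eq_iff.1 (h2.symm.trans h2')
  have hlog : Real.log |(c : ℝ)| ≠ 0 :=
    Real.log_ne_zero_of_pos_of_ne_one (abs_pos.2 c.ne_zero) hc
  -- F recovers the exponent of the deck transformation from the norms. It is continuous and
  -- integer-valued on the interval, hence constant; the condition |c| ≠ 1 keeps the denominator
  -- nonzero.
  set F : ℝ → ℝ := fun s => Real.log (‖γ' s‖ / ‖γ s‖) / Real.log |(c : ℝ)| with hF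
  have hγ : ∀ s ∈ Ioo b d, ‖γ s‖ ≠ 0 := fun s hs => norm_ne_zero_iff.2 (H.2 s hs).1
  have hγ' : ∀ s ∈ Ioo b d, ‖γ' s‖ ≠ 0 := fun s hs => norm_ne_zero_iff.2 (H'.2 s hs).1
  have hFn : ∀ s ∈ Ioo b d, ∀ n : ℤ, γ' s = ((c ^ n : ℝˣ) : ℝ) • γ s → F s = n := by
    intro s hs n hn
    simp only [hF]
    rw [hn, norm_smul, mul_div_cancel_right₀ _ (hγ s hs), Units.val_zpow_eq_zpow_val, norm_zpow,
      Real.log_zpow, Real.norm_eq_abs, mul_div_cancel_right₀ _ hlog]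
  have hcont : ContinuousOn F (Ioo b d) := by
    refine ContinuousOn.div_const (ContinuousOn.log (ContinuousOn.div
      H'.1.geodesic.contDiffOn.continuousOn.norm H.1.geodesic.contDiffOn.continuousOn.norm hγ)
      fun s hs => div_ne_zero (hγ' s hs) (hγ s hs)) _
  have hmid : (b + d) / 2 ∈ Ioo b d := ⟨by linarith, by linarith⟩
  obtain ⟨n, hn0⟩ := hn _ hmid
  refine ⟨n, fun s hs => ?_⟩
  obtain ⟨k, hk⟩ := hn s hs
  have key : ∀ s₁ ∈ Ioo b d, ∀ s₂ ∈ Ioo b d, ∀ n₁ n₂ : ℤ, F s₁ = n₁ → F s₂ = n₂ → n₂ ≤ n₁ := by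
    intro s₁ h₁ s₂ h₂ n₁ n₂ e₁ e₂
    by_contra! hlt
    have hlt' : (n₁ : ℝ) + 1 ≤ n₂ := by exact_mod_cast hlt
    obtain ⟨r, hr, hr'⟩ := isPreconnected_Ioo.intermediate_value h₁ h₂ hcont
      (show (n₁ : ℝ) + 1 / 2 ∈ Icc (F s₁) (F s₂) from ⟨by linarith, by linarith⟩)
    obtain ⟨j, hj, -⟩ := hn r hr
    have := hFn r hr j hj
    rw [hr'] at this
    have h2 : ((2 * n₁ + 1 : ℤ) : ℝ) = ((2 * j : ℤ) : ℝ) := by push_cast; linarith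
    have h3 : 2 * n₁ + 1 = 2 * j := by exact_mod_cast h2
    omega
  have e1 := hFn _ hmid n hn0.1
  have e2 := hFn s hs k hk.1
  have : k = n := le_antisymm (key _ hmid _ hs _ _ e1 e2) (key _ hs _ hmid _ _ e2 e1)
  rwa [← this]

/-- Moving the second lift by the deck transformation found on the overlap makes the two coincide
there. They are then spliced at the midpoint of the overlap. -/
theorem IsLiftOn.glue (hu : 0 < u) (h : u * w - a ^ 2 = 1) (hc : |(c : ℝ)| ≠ 1) {b d b' d' : ℝ}
    (H : IsLiftOn (quadMetric u a w) c κ Y γ W (Ioo b d))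
    (H' : IsLiftOn (quadMetric u a w) c κ Y γ' W' (Ioo b' d')) (h1 : b ≤ b') (h2 : b' < d)
    (h3 : d ≤ d') : ∃ γ₁ W₁, IsLiftOn (quadMetric u a w) c κ Y γ₁ W₁ (Ioo b d') := by
  obtain ⟨n, hn⟩ := (H'.mono isOpen_Ioo (Ioo_subset_Ioo_right h3)).exists_zpow hc
    (H.mono isOpen_Ioo (Ioo_subset_Ioo_left h1)) h2
  have H₂ := H'.smul hu h isOpen_Ioo n
  set γ₂ : ℝ → Plane := fun s => ((c ^ n : ℝˣ) : ℝ) • γ' s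
  set W₂ : ℝ → Plane := fun s => ((c ^ n : ℝˣ) : ℝ) • W' s
  have e1 : ∀ (Z Z₂ : ℝ → Plane), EqOn Z Z₂ (Ioo b' d) →
      EqOn (fun s => if s < (b' + d) / 2 then Z s else Z₂ s) Z (Ioo b d) := by
    intro Z Z₂ hZ s hs
    simp only
    split_ifs with hlt
    · rfl
    · exact (hZ ⟨by linarith, hs.2⟩).symm
  have e2 : ∀ (Z Z₂ : ℝ → Plane), EqOn Z Z₂ (Ioo b' d) →
      EqOn (fun s => if s < (b' + d) / 2 then Z s else Z₂ s) Z₂ (Ioo b' d') := by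
    intro Z Z₂ hZ s hs
    simp only
    split_ifs with hlt
    · exact hZ ⟨hs.1, by linarith⟩
    · rfl
  have hγ : EqOn γ γ₂ (Ioo b' d) := fun s hs => (hn s hs).1
  have hW : EqOn W W₂ (Ioo b' d) := fun s hs => (hn s hs).2
  have K1 := H.congr isOpen_Ioo (e1 γ γ₂ hγ) (e1 W W₂ hW)
  have K2 := H₂.congr isOpen_Ioo (e2 γ γ₂ hγ) (e2 W W₂ hW)
  have hcase : ∀ t ∈ Ioo b d', t ∈ Ioo b d ∨ t ∈ Ioo b' d' := by
    intro t ht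
    rcases lt_or_ge t d with h4 | h4
    · exact .inl ⟨ht.1, h4⟩
    · exact .inr ⟨h2.trans_le h4, ht.2⟩
  refine ⟨fun s => if s < (b' + d) / 2 then γ s else γ₂ s,
    fun s => if s < (b' + d) / 2 then W s else W₂ s,
    IsJacobiOn.of_local fun t ht => ?_, fun t ht => ?_⟩
  · rcases hcase t ht with h4 | h4
    · exact ⟨_, _, _, isOpen_Ioo, h4, K1.1, .rfl, .rfl⟩
    · exact ⟨_, _, _, isOpen_Ioo, h4, K2.1, .rfl, .rfl⟩
  · rcases hcase t ht with h4 | h4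
    · exact K1.2 t h4
    · exact K2.2 t h4

/-- Consider the supremum of the times in [s, r] reached by a single lift. A local lift around the
supremum, glued on, carries the lift strictly past it, so the supremum is r and is itself reached.
-/
theorem IsTorusJacobiOn.exists_lift (hu : 0 < u) (h : u * w - a ^ 2 = 1) (hc : |(c : ℝ)| ≠ 1)
    {J : Set ℝ} (hJ : J.OrdConnected) (H : IsTorusJacobiOn (quadMetric u a w) c κ Y J)
    {s r : ℝ} (hs : s ∈ J) (hr : r ∈ J) (hsr : s ≤ r) :
    ∃ b d γ W, b < s ∧ r < d ∧ IsLiftOn (quadMetric u a w) c κ Y γ W (Ioo b d) := by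
  set P : ℝ → Prop := fun t =>
    ∃ b d γ W, b < s ∧ t < d ∧ IsLiftOn (quadMetric u a w) c κ Y γ W (Ioo b d) with hP
  set S : Set ℝ := {t | t ∈ Icc s r ∧ P t} with hS
  have hbdd : BddAbove S := ⟨r, fun t ht => ht.1.2⟩
  have hsS : s ∈ S := by
    obtain ⟨ε, hε, -, γ, W, h1, h2⟩ := H s hs
    exact ⟨⟨le_rfl, hsr⟩, s - ε, s + ε, γ, W, by linarith, by linarith, h1, h2⟩
  have hT1 : s ≤ sSup S := le_csSup hbdd hsS
  have hT2 : sSup S ≤ r := csSup_le ⟨s, hsS⟩ fun t ht => ht.1.2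
  obtain ⟨ε, hε, -, γ', W', h1', h2'⟩ := H (sSup S) (hJ.out hs hr ⟨hT1, hT2⟩)
  have H' : IsLiftOn (quadMetric u a w) c κ Y γ' W' (Ioo (sSup S - ε) (sSup S + ε)) := ⟨h1', h2'⟩
  obtain ⟨t, ⟨⟨ht1, ht2⟩, b, d, γ, W, hb, hd, Ht⟩, htε⟩ :=
    exists_lt_of_lt_csSup ⟨s, hsS⟩ (show sSup S - ε < sSup S by linarith)
  have hext : ∃ d' γ W, sSup S < d' ∧ IsLiftOn (quadMetric u a w) c κ Y γ W (Ioo b d') := by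
    rcases lt_or_ge (sSup S) d with h4 | h4
    · exact ⟨d, γ, W, h4, Ht⟩
    · obtain ⟨γ₁, W₁, H₁⟩ := Ht.glue hu h hc
        -- The left end is raised to at least b because gluing requires the second interval not to
        -- start before the first.
        (H'.mono isOpen_Ioo (Ioo_subset_Ioo_left (le_max_right b (sSup S - ε))))
        (le_max_left _ _) (max_lt (by linarith) (by linarith)) (by linarith)
      exact ⟨sSup S + ε, γ₁, W₁, by linarith, H₁⟩
  obtain ⟨d', γ₁, W₁, hd', H₁⟩ := hext
  rcases hT2.eq_or_lt with h5 | h5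
  · exact ⟨b, d', γ₁, W₁, hb, h5 ▸ hd', H₁⟩
  · exfalso
    obtain ⟨t', ht'1, ht'2⟩ := exists_between (lt_min h5 hd')
    have : t' ∈ S := ⟨⟨by linarith, (ht'2.trans_le (min_le_left _ _)).le⟩, b, d', γ₁, W₁, hb,
      ht'2.trans_le (min_le_right _ _), H₁⟩
    linarith [le_csSup hbdd this]

theorem torusNoConjugatePoints_quadMetric (hu : 0 < u) (h : u * w - a ^ 2 = 1) (c : ℝˣ)
    (hc : |(c : ℝ)| ≠ 1) : TorusNoConjugatePoints (quadMetric u a w) c := by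
  intro J κ Y _ hJ' H t₀ h₀ t₁ h₁ h01 hz₀ hz₁ t ht
  have hmin : min t (min t₀ t₁) ∈ J := by
    rcases min_choice t (min t₀ t₁) with e | e
    · rwa [e]
    · rw [e]
      rcases min_choice t₀ t₁ with e | e <;> rwa [e]
  have hmax : max t (max t₀ t₁) ∈ J := by
    rcases max_choice t (max t₀ t₁) with e | e
    · rwa [e]
    · rw [e]
      rcases max_choice t₀ t₁ with e | e <;> rwa [e]
  obtain ⟨b, d, γ, W, hb, hd, hL⟩ := H.exists_lift hu h hc hJ' hmin hmax
    ((min_le_left _ _).trans (le_max_left _ _))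
  have m : t ∈ Ioo b d := ⟨hb.trans_le (min_le_left _ _), (le_max_left _ _).trans_lt hd⟩
  have m₀ : t₀ ∈ Ioo b d := ⟨hb.trans_le ((min_le_right _ _).trans (min_le_left _ _)),
    ((le_max_left _ _).trans (le_max_right _ _)).trans_lt hd⟩
  have m₁ : t₁ ∈ Ioo b d := ⟨hb.trans_le ((min_le_right _ _).trans (min_le_right _ _)),
    ((le_max_right _ _).trans (le_max_right _ _)).trans_lt hd⟩
  have hz : ∀ s ∈ Ioo b d, (Y s).IsZero ↔ W s = 0 := by
    intro s hs
    obtain ⟨hp, -, e⟩ := hL.2 s hs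
    rw [e, TorusTangent.isZero_mk_iff]
  rw [hz t m]
  exact noConjugatePoints_quadMetric hu h _ γ W isOpen_Ioo ordConnected_Ioo hL.1 t₀ m₀ t₁ m₁ h01
    ((hz _ m₀).1 hz₀) ((hz _ m₁).1 hz₁) t m

end Lift

/-! ### The function f: zeros, monotonicity, symmetry, period -/

/-- The norm function of the radial field in its transverse coordinate. -/
def normFun (a : ℝ) : ℝ → ℝ := fun x => Real.sin (2 * x) - 2 * a * Real.cos x ^ 2

theorem normFun_eq (a x : ℝ) :
    normFun a x = 2 * Real.cos x * (Real.sin x - a * Real.cos x) := by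
  rw [normFun, Real.sin_two_mul]; ring

theorem sin_arctan_eq (a : ℝ) :
    Real.sin (Real.arctan a) = a * Real.cos (Real.arctan a) := by
  have h := (Real.cos_arctan_pos a).ne'
  have := Real.tan_arctan a
  rwa [Real.tan_eq_sin_div_cos, div_eq_iff h] at this

theorem cos_arctan_mul_sub (a x : ℝ) :
    Real.cos (Real.arctan a) * (Real.sin x - a * Real.cos x) = Real.sin (x - Real.arctan a) := by
  rw [Real.sin_sub, sin_arctan_eq]; ring

theorem normFun_eq_zero_iff {a x : ℝ} :
    normFun a x = 0 ↔
      (∃ k : ℤ, x = Real.pi / 2 + k * Real.pi) ∨ ∃ k : ℤ, x = Real.arctan a + k * Real.pi := by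
  have h := Real.cos_arctan_pos a
  rw [normFun_eq, mul_eq_zero, mul_eq_zero, or_iff_right (two_ne_zero' ℝ)]
  refine or_congr ?_ ?_
  · rw [Real.cos_eq_zero_iff]
    exact exists_congr fun k => by constructor <;> intro h <;> linarith
  · rw [← mul_right_inj' h.ne', mul_zero, cos_arctan_mul_sub, Real.sin_eq_zero_iff]
    exact exists_congr fun k => by constructor <;> intro h <;> linarith

theorem hasDerivAt_normFun (a x : ℝ) :
    HasDerivAt (normFun a) (2 * Real.cos (2 * x) + 2 * a * Real.sin (2 * x)) x := by
  have h2 : HasDerivAt (fun x : ℝ => 2 * x) 2 x := by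
    simpa using (hasDerivAt_id x).const_mul (2 : ℝ)
  refine (h2.sin.sub (((Real.hasDerivAt_cos x).pow 2).const_mul (2 * a))).congr_deriv ?_
  rw [Real.sin_two_mul]
  simp
  ring

theorem deriv_normFun (a : ℝ) :
    deriv (normFun a) = fun x => 2 * Real.cos (2 * x) + 2 * a * Real.sin (2 * x) :=
  funext fun x => (hasDerivAt_normFun a x).deriv

theorem deriv_trig (b c : ℝ) :
    deriv (fun x => b * Real.cos (2 * x) + c * Real.sin (2 * x))
      = fun x => (2 * c) * Real.cos (2 * x) + (-2 * b) * Real.sin (2 * x) := by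
  funext x
  have h2 : HasDerivAt (fun x : ℝ => 2 * x) 2 x := by
    simpa using (hasDerivAt_id x).const_mul (2 : ℝ)
  refine ((h2.cos.const_mul b).add (h2.sin.const_mul c)).deriv.trans ?_
  ring

/-- Up to an additive constant f is a combination of cos 2x and sin 2x. Hence f' f''' = -4 f'² ≤ 0.
-/
theorem iteratedDeriv_three_normFun (a x : ℝ) :
    iteratedDeriv 3 (normFun a) x = -4 * deriv (normFun a) x := by
  rw [iteratedDeriv_succ, iteratedDeriv_succ, iteratedDeriv_succ, iteratedDeriv_zero,
    deriv_normFun, deriv_trig, deriv_trig]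
  ring

theorem cos_arctan_mul_deriv_normFun (a x : ℝ) :
    Real.cos (Real.arctan a) * deriv (normFun a) x = 2 * Real.cos (2 * x - Real.arctan a) := by
  rw [deriv_normFun, Real.cos_sub, sin_arctan_eq]; ring

theorem deriv_normFun_pos {a x : ℝ} (k : ℤ)
    (h : 2 * x - Real.arctan a - k * (2 * Real.pi) ∈ Ioo (-(Real.pi / 2)) (Real.pi / 2)) :
    0 < deriv (normFun a) x := by
  have h1 := Real.cos_pos_of_mem_Ioo h
  rw [Real.cos_sub_int_mul_two_pi] at h1
  have h2 := cos_arctan_mul_deriv_normFun a x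
  exact pos_of_mul_pos_right (by rw [h2]; linarith) (Real.cos_arctan_pos a).le

theorem deriv_normFun_neg {a x : ℝ} (k : ℤ)
    (h : 2 * x - Real.arctan a - k * (2 * Real.pi) ∈ Ioo (Real.pi / 2) (Real.pi + Real.pi / 2)) :
    deriv (normFun a) x < 0 := by
  have h1 := Real.cos_neg_of_pi_div_two_lt_of_lt h.1 h.2
  rw [Real.cos_sub_int_mul_two_pi] at h1
  have h2 := cos_arctan_mul_deriv_normFun a x
  exact neg_of_mul_neg_right (by rw [h2]; linarith) (Real.cos_arctan_pos a).le

/-- As arctan a lies in (-π/2, π/2), the zeros arctan a + kπ and π/2 + kπ alternate. Since f' is a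
positive multiple of cos(2x - arctan a), its sign changes at the midpoint of two consecutive zeros.
-/
theorem changesSignOnce_normFun {a p q : ℝ} (hpq : p < q) (hp : normFun a p = 0)
    (hq : normFun a q = 0) (h0 : ∀ t ∈ Ioo p q, normFun a t ≠ 0) :
    ChangesSignOnce (deriv (normFun a)) p q := by
  have hπ := Real.pi_pos
  have hα1 := Real.neg_pi_div_two_lt_arctan a
  have hα2 := Real.arctan_lt_pi_div_two a
  have hcast : ∀ {m n : ℤ}, m + 1 ≤ n → (m : ℝ) * Real.pi + Real.pi ≤ n * Real.pi := by
    intro m n h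
    have : (m : ℝ) + 1 ≤ n := by exact_mod_cast h
    nlinarith
  rw [normFun_eq_zero_iff] at hp hq
  rcases hp with ⟨k, rfl⟩ | ⟨k, rfl⟩
  · have hq1 : q ≤ Real.arctan a + (k + 1 : ℤ) * Real.pi := by
      by_contra! h
      exact h0 _ ⟨by push_cast; linarith, h⟩ (normFun_eq_zero_iff.2 (.inr ⟨k + 1, rfl⟩))
    push_cast at hq1
    have hq' : q = Real.arctan a + (k + 1) * Real.pi := by
      refine le_antisymm hq1 ?_
      rcases hq with ⟨j, rfl⟩ | ⟨j, rfl⟩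
      · have h1 : k + 1 ≤ j := by
          have : (k : ℝ) < j := by
            by_contra! h
            nlinarith
          exact_mod_cast this
        linarith [hcast h1]
      · have h1 : k + 1 ≤ j := by
          have : (k : ℝ) < j := by
            by_contra! h
            nlinarith
          exact_mod_cast this
        linarith [hcast h1]
    subst hq'
    have hneg : ∀ t ∈ Ioo (Real.pi / 2 + k * Real.pi)
        ((Real.pi / 2 + k * Real.pi + (Real.arctan a + (k + 1) * Real.pi)) / 2),
        deriv (normFun a) t < 0 := fun t ht =>
      deriv_normFun_neg k ⟨by linarith [ht.1], by linarith [ht.2]⟩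
    have hpos : ∀ t ∈ Ioo ((Real.pi / 2 + k * Real.pi + (Real.arctan a + (k + 1) * Real.pi)) / 2)
        (Real.arctan a + (k + 1) * Real.pi), 0 < deriv (normFun a) t := fun t ht =>
      deriv_normFun_pos (k + 1) ⟨by push_cast; linarith [ht.1], by push_cast; linarith [ht.2]⟩
    obtain ⟨r, hr1, hr2⟩ := exists_between (show Real.pi / 2 + k * Real.pi
      < (Real.pi / 2 + k * Real.pi + (Real.arctan a + (k + 1) * Real.pi)) / 2 by linarith)
    obtain ⟨s, hs1, hs2⟩ := exists_between
      (show (Real.pi / 2 + k * Real.pi + (Real.arctan a + (k + 1) * Real.pi)) / 2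
        < Real.arctan a + (k + 1) * Real.pi by linarith)
    exact ⟨⟨s, ⟨by linarith, hs2⟩, hpos s ⟨hs1, hs2⟩⟩, ⟨r, ⟨hr1, by linarith⟩, hneg r ⟨hr1, hr2⟩⟩,
      _, ⟨by linarith, by linarith⟩, .inr ⟨fun t ht => (hneg t ht).le, fun t ht => (hpos t ht).le⟩⟩
  · have hq1 : q ≤ Real.pi / 2 + k * Real.pi := by
      by_contra! h
      exact h0 _ ⟨by linarith, h⟩ (normFun_eq_zero_iff.2 (.inl ⟨k, rfl⟩))
    have hq' : q = Real.pi / 2 + k * Real.pi := by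
      refine le_antisymm hq1 ?_
      rcases hq with ⟨j, rfl⟩ | ⟨j, rfl⟩
      · have h1 : k ≤ j := by
          have : (k : ℝ) < j + 1 := by
            by_contra! h
            nlinarith
          exact Int.lt_add_one_iff.1 (by exact_mod_cast this)
        have : (k : ℝ) ≤ j := by exact_mod_cast h1
        nlinarith
      · have h1 : k + 1 ≤ j := by
          have : (k : ℝ) < j := by
            by_contra! h
            nlinarith
          exact_mod_cast this
        linarith [hcast h1]
    subst hq'
    have hpos : ∀ t ∈ Ioo (Real.arctan a + k * Real.pi)
        ((Real.arctan a + k * Real.pi + (Real.pi / 2 + k * Real.pi)) / 2),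
        0 < deriv (normFun a) t := fun t ht =>
      deriv_normFun_pos k ⟨by linarith [ht.1], by linarith [ht.2]⟩
    have hneg : ∀ t ∈ Ioo ((Real.arctan a + k * Real.pi + (Real.pi / 2 + k * Real.pi)) / 2)
        (Real.pi / 2 + k * Real.pi), deriv (normFun a) t < 0 := fun t ht =>
      deriv_normFun_neg k ⟨by linarith [ht.1], by linarith [ht.2]⟩
    obtain ⟨r, hr1, hr2⟩ := exists_between (show Real.arctan a + k * Real.pi
      < (Real.arctan a + k * Real.pi + (Real.pi / 2 + k * Real.pi)) / 2 by linarith)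
    obtain ⟨s, hs1, hs2⟩ := exists_between
      (show (Real.arctan a + k * Real.pi + (Real.pi / 2 + k * Real.pi)) / 2
        < Real.pi / 2 + k * Real.pi by linarith)
    exact ⟨⟨r, ⟨hr1, by linarith⟩, hpos r ⟨hr1, hr2⟩⟩, ⟨s, ⟨by linarith, hs2⟩, hneg s ⟨hs1, hs2⟩⟩,
      _, ⟨by linarith, by linarith⟩, .inl ⟨fun t ht => (hpos t ht).le, fun t ht => (hneg t ht).le⟩⟩

theorem normFun_periodic (a : ℝ) : Function.Periodic (normFun a) Real.pi := by
  intro x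
  rw [normFun, Real.cos_add_pi, mul_add, Real.sin_add_two_pi, neg_sq, normFun]

/-- Periodicity tested at 0 and π/4 gives two linear equations for sin 2T and cos 2T. Eliminating
the sine yields (1 + a²) cos 2T = 1 + a². -/
theorem pi_le_of_periodic_normFun {a T : ℝ} (hT : 0 < T)
    (h : Function.Periodic (normFun a) T) : Real.pi ≤ T := by
  have hform : ∀ x, normFun a x = Real.sin (2 * x) - a * Real.cos (2 * x) - a := by
    intro x
    rw [normFun, Real.cos_sq]; ring
  have h1 := h 0
  have h2 := h (Real.pi / 4)
  rw [hform, hform] at h1 h2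
  rw [show 2 * (Real.pi / 4 + T) = 2 * T + Real.pi / 2 by ring, Real.sin_add_pi_div_two,
    Real.cos_add_pi_div_two, show 2 * (Real.pi / 4) = Real.pi / 2 by ring, Real.sin_pi_div_two,
    Real.cos_pi_div_two] at h2
  simp only [zero_add, mul_zero, Real.sin_zero, Real.cos_zero] at h1
  have h3 : Real.cos (2 * T) = 1 := by
    have h4 := sq_nonneg a
    have : (1 + a ^ 2) * Real.cos (2 * T) = 1 + a ^ 2 := by linear_combination h2 - a * h1
    exact mul_left_cancel₀ (by positivity) (this.trans (mul_one _).symm)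
  obtain ⟨n, hn⟩ := (Real.cos_eq_one_iff _).1 h3
  have hn0 : 0 < (n : ℝ) := by
    by_contra! h5
    nlinarith [Real.pi_pos]
  have : (1 : ℝ) ≤ n := by exact_mod_cast (by exact_mod_cast hn0 : (0 : ℤ) < n)
  nlinarith [Real.pi_pos]

theorem ncard_zeros_normFun (a : ℝ) : {t ∈ Ico 0 Real.pi | normFun a t = 0}.ncard = 2 := by
  have hπ := Real.pi_pos
  have hα1 := Real.neg_pi_div_two_lt_arctan a
  have hα2 := Real.arctan_lt_pi_div_two a
  -- β is the representative of arctan a modulo π in [0, π). The shift by π is needed exactly when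
  -- arctan a is negative.
  obtain ⟨β, hβ, hβ0, hβne, j, hj⟩ : ∃ β ∈ Ico 0 Real.pi, normFun a β = 0 ∧ Real.pi / 2 ≠ β ∧
      ∃ j : ℤ, β = Real.arctan a + j * Real.pi := by
    rcases le_or_gt 0 (Real.arctan a) with h | h
    · exact ⟨Real.arctan a, ⟨h, by linarith⟩, normFun_eq_zero_iff.2 (.inr ⟨0, by simp⟩), hα2.ne',
        0, by simp⟩
    · exact ⟨Real.arctan a + Real.pi, ⟨by linarith, by linarith⟩,
        normFun_eq_zero_iff.2 (.inr ⟨1, by simp⟩), by intro h; linarith, 1, by simp⟩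
  have huniq : ∀ {b : ℝ} {m n : ℤ}, b + m * Real.pi ∈ Ico 0 Real.pi →
      b + n * Real.pi ∈ Ico 0 Real.pi → m ≤ n := by
    intro b m n hm hn
    have : (m : ℝ) < n + 1 := by
      by_contra! h
      nlinarith [hm.2, hn.1]
    exact Int.lt_add_one_iff.1 (by exact_mod_cast this)
  have : {t ∈ Ico 0 Real.pi | normFun a t = 0} = {Real.pi / 2, β} := by
    ext t
    simp only [mem_ofPred_eq, mem_insert_iff, mem_singleton_iff]
    constructor
    · rintro ⟨ht, h⟩
      rcases normFun_eq_zero_iff.1 h with ⟨k, rfl⟩ | ⟨k, rfl⟩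
      · left
        have h0 : Real.pi / 2 + (0 : ℤ) * Real.pi ∈ Ico 0 Real.pi := by
          push_cast; constructor <;> linarith
        rw [le_antisymm (huniq ht h0) (huniq h0 ht)]
        simp
      · right
        rw [hj] at hβ ⊢
        rw [le_antisymm (huniq ht hβ) (huniq hβ ht)]
    · rintro (rfl | rfl)
      · exact ⟨⟨by linarith, by linarith⟩, normFun_eq_zero_iff.2 (.inl ⟨0, by simp⟩)⟩
      · exact ⟨hβ, hβ0⟩
  rw [this, ncard_pair hβne]

theorem inFamily_normFun (a : ℝ) : InFamily (normFun a) where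
  smooth := by
    unfold normFun
    fun_prop
  simple_zeros t ht h := by
    rw [deriv_normFun] at h
    rw [normFun, Real.cos_sq] at ht
    have h1 := Real.sin_sq_add_cos_sq (2 * t)
    have e1 : Real.sin (2 * t) = a + a * Real.cos (2 * t) := by linarith
    have e2 : Real.cos (2 * t) = -(a * Real.sin (2 * t)) := by
      simp only at h; linarith
    have e3 : a * Real.sin (2 * t) = 1 := by
      linear_combination h1 - Real.sin (2 * t) * e1 - Real.cos (2 * t) * e2
    rw [e2, e3] at e1
    have e4 : Real.sin (2 * t) = 0 := by linarith
    rw [e4, mul_zero] at e3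
    exact zero_ne_one e3
  deriv_sign p q hpq hp hq h0 := changesSignOnce_normFun hpq hp hq h0
  deriv_mul_le t := by
    rw [iteratedDeriv_three_normFun]
    nlinarith [sq_nonneg (deriv (normFun a) t)]
  symmetric := by
    -- The point where 2x - arctan a = π/2, a maximum of the sine to which f reduces.
    refine ⟨Real.arctan a / 2 + Real.pi / 4, fun t => ?_⟩
    have h := (Real.cos_arctan_pos a).ne'
    have key : ∀ x, Real.cos (Real.arctan a) * normFun a x
        = Real.sin (2 * x - Real.arctan a) - Real.sin (Real.arctan a) := by
      intro x
      rw [normFun, Real.cos_sq, Real.sin_sub, sin_arctan_eq]; ring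
    apply mul_left_cancel₀ h
    rw [key, key]
    congr 1
    rw [show 2 * (Real.arctan a / 2 + Real.pi / 4 + t) - Real.arctan a
      = 2 * t + Real.pi / 2 by ring, show 2 * (Real.arctan a / 2 + Real.pi / 4 - t)
      - Real.arctan a = -(2 * t) + Real.pi / 2 by ring, Real.sin_add_pi_div_two,
      Real.sin_add_pi_div_two, Real.cos_neg]
  two_zeros := ⟨Real.pi, ⟨⟨Real.pi_pos, normFun_periodic a⟩,
    fun _ hT => pi_le_of_periodic_normFun hT.1 hT.2⟩, ncard_zeros_normFun a⟩

/-! ### The metric on the universal cover -/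

/-- The restriction of the quadratic form to the unit circle. -/
def circleQuad (u a w θ : ℝ) : ℝ := quad u a w (Real.cos θ) (Real.sin θ)

section Cover

variable {u a w : ℝ}

theorem circleQuad_pos (hu : 0 < u) (h : u * w - a ^ 2 = 1) (θ : ℝ) : 0 < circleQuad u a w θ := by
  refine quad_pos hu h ?_
  by_contra! h0
  have := Real.sin_sq_add_cos_sq θ
  simp [h0.1, h0.2] at this

theorem contDiff_circleQuad : ContDiff ℝ ∞ (circleQuad u a w) := by
  unfold circleQuad quad; fun_prop

theorem jacobian_polar (p : Plane) :
    jacobian polar p = Real.exp (p 0) • !![Real.cos (p 1), -Real.sin (p 1);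
      Real.sin (p 1), Real.cos (p 1)] := by
  have h0 : HasFDerivAt (fun q : Plane => q 0) (ContinuousLinearMap.proj (R := ℝ) 0) p :=
    hasFDerivAt_apply 0 p
  have h1 : HasFDerivAt (fun q : Plane => q 1) (ContinuousLinearMap.proj (R := ℝ) 1) p :=
    hasFDerivAt_apply 1 p
  have hx : fderiv ℝ (fun q : Plane => Real.exp (q 0) * Real.cos (q 1)) p = _ :=
    (h0.exp.mul h1.cos).fderiv
  have hy : fderiv ℝ (fun q : Plane => Real.exp (q 0) * Real.sin (q 1)) p = _ :=
    (h0.exp.mul h1.sin).fderiv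
  ext i j
  fin_cases i <;> fin_cases j <;> simp [jacobian, pd, polar, hx, hy] <;> ring

theorem quad_polar (p : Plane) :
    quad u a w (polar p 0) (polar p 1) = Real.exp (p 0) ^ 2 * circleQuad u a w (p 1) := by
  simp [polar, circleQuad, quad]; ring

theorem pullback_polar (p : Plane) :
    pullback polar (quadMetric u a w) p = (circleQuad u a w (p 1))⁻¹ •
      !![Real.sin (2 * p 1), Real.cos (2 * p 1); Real.cos (2 * p 1), -Real.sin (2 * p 1)] := by
  have he := (Real.exp_pos (p 0)).ne'
  rw [pullback, jacobian_polar, quadMetric, quad_polar, Real.sin_two_mul, Real.cos_two_mul']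
  ext i j
  fin_cases i <;> fin_cases j <;> simp [Matrix.mul_apply] <;> field_simp <;> ring

theorem ip_pullback_polar (p v v' : Plane) :
    ip (pullback polar (quadMetric u a w)) p v v' = (circleQuad u a w (p 1))⁻¹ *
      (Real.sin (2 * p 1) * (v 0 * v' 0) + Real.cos (2 * p 1) * (v 0 * v' 1 + v 1 * v' 0)
        - Real.sin (2 * p 1) * (v 1 * v' 1)) := by
  rw [ip, pullback_polar]
  simp [Matrix.mulVec, dotProduct]
  ring

theorem ip_liftedRadial (p : Plane) :
    ip (pullback polar (quadMetric u a w)) p (liftedRadial p) (liftedRadial p)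
      = Real.sin (2 * p 1) / circleQuad u a w (p 1) := by
  rw [ip_pullback_polar]
  simp [liftedRadial]
  ring

theorem det_pullback_polar (p : Plane) :
    (pullback polar (quadMetric u a w) p).det = -((circleQuad u a w (p 1))⁻¹ ^ 2) := by
  rw [pullback_polar, Matrix.det_fin_two]
  simp
  linear_combination (-(circleQuad u a w (p 1))⁻¹ ^ 2) * Real.sin_sq_add_cos_sq (2 * p 1)

end Cover

/-! ### The transverse coordinate -/

/-- Half of the derivative of `circleQuad`. -/
def circleSlope (u a w θ : ℝ) : ℝ :=
  (w - u) * (Real.sin θ * Real.cos θ) + a * (Real.cos θ ^ 2 - Real.sin θ ^ 2)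

/-- The transverse coordinate, a primitive of `1 / circleQuad`. -/
def transverse (u a w θ : ℝ) : ℝ :=
  θ + Real.arctan (circleSlope u a w θ / (circleQuad u a w θ + 1))
    + (Real.arctan a - Real.arctan (a / (u + 1)))

section Transverse

variable {u a w : ℝ}

theorem hasDerivAt_circleQuad (θ : ℝ) :
    HasDerivAt (circleQuad u a w) (2 * circleSlope u a w θ) θ := by
  have hc := Real.hasDerivAt_cos θ
  have hs := Real.hasDerivAt_sin θ
  unfold circleQuad quad
  refine ((((hc.pow 2).const_mul u).add ((hc.const_mul (2 * a)).mul hs)).add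
    ((hs.pow 2).const_mul w)).congr_deriv ?_
  simp [circleSlope]
  ring

theorem hasDerivAt_circleSlope (θ : ℝ) :
    HasDerivAt (circleSlope u a w) (u + w - 2 * circleQuad u a w θ) θ := by
  have hc := Real.hasDerivAt_cos θ
  have hs := Real.hasDerivAt_sin θ
  have h1 := Real.sin_sq_add_cos_sq θ
  unfold circleSlope
  refine (((hs.mul hc).const_mul (w - u)).add (((hc.pow 2).sub (hs.pow 2)).const_mul a)).congr_deriv
    ?_
  simp [circleQuad, quad]
  linear_combination (u + w) * h1

/-- Equivalently, (q - (u + w)/2)² + (q'/2)² is the constant ((u + w)/2)² - 1: the restriction of Q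
to the circle oscillates about half the trace. -/
theorem circleSlope_sq (h : u * w - a ^ 2 = 1) (θ : ℝ) :
    circleSlope u a w θ ^ 2 = circleQuad u a w θ * (u + w - circleQuad u a w θ) - 1 := by
  have h1 := Real.sin_sq_add_cos_sq θ
  have h2 : Real.sin θ ^ 2 = 1 - Real.cos θ ^ 2 := by linarith
  have e1 : circleQuad u a w θ = u * Real.cos θ ^ 2 + 2 * a * Real.cos θ * Real.sin θ
    + w * (1 - Real.cos θ ^ 2) := by rw [← h2]; rfl
  have e2 : circleSlope u a w θ = (w - u) * (Real.sin θ * Real.cos θ)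
    + a * (2 * Real.cos θ ^ 2 - 1) := by rw [circleSlope, h2]; ring
  rw [e1, e2]
  linear_combination ((w - u) ^ 2 * Real.cos θ ^ 2 + 4 * a ^ 2 * Real.cos θ ^ 2) * h2 - h

/-- The obvious primitive arctan(w tan θ + a) jumps at odd multiples of π/2, whereas the form used
here is smooth because q + 1 > 0. The derivative collapses thanks to (q + 1)² + (q'/2)² = q(u + w +
2). -/
theorem hasDerivAt_transverse (hu : 0 < u) (h : u * w - a ^ 2 = 1) (θ : ℝ) :
    HasDerivAt (transverse u a w) (circleQuad u a w θ)⁻¹ θ := by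
  have hq := circleQuad_pos hu h θ
  have hw : 0 < w := by
    have : 0 < u * w := by nlinarith [sq_nonneg a]
    exact pos_of_mul_pos_right this hu.le
  have hq1 : circleQuad u a w θ + 1 ≠ 0 := by positivity
  have hsq := circleSlope_sq h θ
  refine (((hasDerivAt_id θ).add (((hasDerivAt_circleSlope θ).div
    ((hasDerivAt_circleQuad θ).add_const 1) hq1).arctan)).add_const _).congr_deriv ?_
  have hden : (circleQuad u a w θ + 1) ^ 2 + circleSlope u a w θ ^ 2
      = circleQuad u a w θ * (u + w + 2) := by rw [hsq]; ring
  have hden0 : (circleQuad u a w θ + 1) ^ 2 + circleSlope u a w θ ^ 2 ≠ 0 := by positivity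
  have e1 : 1 / (1 + (circleSlope u a w θ / (circleQuad u a w θ + 1)) ^ 2)
      = (circleQuad u a w θ + 1) ^ 2
        / ((circleQuad u a w θ + 1) ^ 2 + circleSlope u a w θ ^ 2) := by
    field_simp
  simp only [Pi.div_apply]
  rw [e1, hden]
  field_simp
  linear_combination (-2) * hsq

theorem contDiff_transverse (hu : 0 < u) (h : u * w - a ^ 2 = 1) :
    ContDiff ℝ ∞ (transverse u a w) := by
  have h1 : ContDiff ℝ ∞ (circleSlope u a w) := by unfold circleSlope; fun_prop
  have h2 : ContDiff ℝ ∞ (fun θ => circleSlope u a w θ / (circleQuad u a w θ + 1)) :=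
    h1.div (contDiff_circleQuad.add contDiff_const) fun θ => by
      have := circleQuad_pos hu h θ
      positivity
  exact (contDiff_id.add h2.arctan).add contDiff_const

theorem strictMono_transverse (hu : 0 < u) (h : u * w - a ^ 2 = 1) :
    StrictMono (transverse u a w) :=
  strictMono_of_deriv_pos fun θ => by
    rw [(hasDerivAt_transverse hu h θ).deriv]
    exact inv_pos.2 (circleQuad_pos hu h θ)

theorem transverse_surjective (hu : 0 < u) (h : u * w - a ^ 2 = 1) :
    Function.Surjective (transverse u a w) := by
  intro t
  set k := Real.arctan a - Real.arctan (a / (u + 1)) with hk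
  refine mem_range_of_exists_le_of_exists_ge (contDiff_transverse hu h).continuous
    ⟨t - Real.pi / 2 - k, ?_⟩ ⟨t + Real.pi / 2 - k, ?_⟩
  · have := Real.arctan_lt_pi_div_two (circleSlope u a w (t - Real.pi / 2 - k)
      / (circleQuad u a w (t - Real.pi / 2 - k) + 1))
    rw [transverse, ← hk]
    linarith
  · have := Real.neg_pi_div_two_lt_arctan (circleSlope u a w (t + Real.pi / 2 - k)
      / (circleQuad u a w (t + Real.pi / 2 - k) + 1))
    rw [transverse, ← hk]
    linarith

/-- Both pairs solve the rotation system P' = -S/q, S' = P/q and agree at θ = 0. The additive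
constant of the transverse coordinate is chosen so that its value there is arctan a. -/
theorem cos_sin_transverse (hu : 0 < u) (h : u * w - a ^ 2 = 1) (θ : ℝ) :
    Real.cos (transverse u a w θ) = Real.cos θ / √(w * circleQuad u a w θ) ∧
    Real.sin (transverse u a w θ)
      = (w * Real.sin θ + a * Real.cos θ) / √(w * circleQuad u a w θ) := by
  have hw : 0 < w := by
    have : 0 < u * w := by nlinarith [sq_nonneg a]
    exact pos_of_mul_pos_right this hu.le
  have hR : ∀ θ, 0 < w * circleQuad u a w θ := fun θ => mul_pos hw (circleQuad_pos hu h θ)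
  have hS : ∀ θ, 0 < √(w * circleQuad u a w θ) := fun θ => Real.sqrt_pos.2 (hR θ)
  have hSS : ∀ θ, √(w * circleQuad u a w θ) ^ 2 = w * circleQuad u a w θ := fun θ =>
    Real.sq_sqrt (hR θ).le
  have dR : ∀ θ, HasDerivAt (fun θ => √(w * circleQuad u a w θ))
      (w * (2 * circleSlope u a w θ) / (2 * √(w * circleQuad u a w θ))) θ := fun θ =>
    ((hasDerivAt_circleQuad θ).const_mul w).sqrt (hR θ).ne'
  have dP : ∀ θ, HasDerivAt (fun θ => Real.cos θ / √(w * circleQuad u a w θ))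
      (-((w * Real.sin θ + a * Real.cos θ) / √(w * circleQuad u a w θ))
        / circleQuad u a w θ) θ := by
    intro θ
    refine ((Real.hasDerivAt_cos θ).div (dR θ) (hS θ).ne').congr_deriv ?_
    have h1 := hS θ
    have h2 := hSS θ
    have h3 := circleQuad_pos hu h θ
    have h4 : Real.sin θ * circleQuad u a w θ + Real.cos θ * circleSlope u a w θ
        = w * Real.sin θ + a * Real.cos θ := by
      unfold circleQuad quad circleSlope
      linear_combination (w * Real.sin θ + a * Real.cos θ) * Real.sin_sq_add_cos_sq θ
    generalize √(w * circleQuad u a w θ) = R at h1 h2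
    field_simp
    rw [h2]
    linear_combination (-w * circleQuad u a w θ) * h4
  have dS : ∀ θ, HasDerivAt (fun θ => (w * Real.sin θ + a * Real.cos θ)
      / √(w * circleQuad u a w θ))
      (Real.cos θ / √(w * circleQuad u a w θ) / circleQuad u a w θ) θ := by
    intro θ
    refine ((((Real.hasDerivAt_sin θ).const_mul w).add ((Real.hasDerivAt_cos θ).const_mul a)).div
      (dR θ) (hS θ).ne').congr_deriv ?_
    have h1 := hS θ
    have h2 := hSS θ
    have h3 := circleQuad_pos hu h θ
    have h4 : (w * Real.cos θ - a * Real.sin θ) * circleQuad u a w θ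
        - (w * Real.sin θ + a * Real.cos θ) * circleSlope u a w θ = Real.cos θ := by
      unfold circleQuad quad circleSlope
      linear_combination ((u * w - a ^ 2) * Real.cos θ) * Real.sin_sq_add_cos_sq θ
        + Real.cos θ * h
    generalize √(w * circleQuad u a w θ) = R at h1 h2
    simp only [Pi.add_apply]
    field_simp
    rw [h2]
    linear_combination (w * circleQuad u a w θ) * h4
  -- The squared distance between two solutions of a rotation system is constant.
  set H : ℝ → ℝ := fun θ =>
    (Real.cos θ / √(w * circleQuad u a w θ) - Real.cos (transverse u a w θ)) ^ 2
    + ((w * Real.sin θ + a * Real.cos θ) / √(w * circleQuad u a w θ)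
      - Real.sin (transverse u a w θ)) ^ 2 with hH
  have dH : ∀ θ, HasDerivAt H 0 θ := by
    intro θ
    have dφ := hasDerivAt_transverse hu h θ
    refine ((((dP θ).sub dφ.cos).pow 2).add (((dS θ).sub dφ.sin).pow 2)).congr_deriv ?_
    simp
    ring
  have hH0 : H 0 = 0 := by
    have e0 : transverse u a w 0 = Real.arctan a := by
      simp [transverse, circleSlope, circleQuad, quad]
    have e1 : w * circleQuad u a w 0 = 1 + a ^ 2 := by
      simp [circleQuad, quad]; linarith
    simp only [hH, e0, e1, Real.cos_arctan, Real.sin_arctan, Real.cos_zero, Real.sin_zero]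
    ring
  have hHθ : H θ = 0 := by
    rw [← hH0]
    exact is_const_of_deriv_eq_zero (fun θ => (dH θ).differentiableAt) (fun θ => (dH θ).deriv) _ _
  simp only [hH] at hHθ
  constructor <;> nlinarith [sq_nonneg (Real.cos θ / √(w * circleQuad u a w θ)
    - Real.cos (transverse u a w θ)), sq_nonneg ((w * Real.sin θ + a * Real.cos θ)
      / √(w * circleQuad u a w θ) - Real.sin (transverse u a w θ))]

theorem normFun_transverse (hu : 0 < u) (h : u * w - a ^ 2 = 1) (θ : ℝ) :
    normFun a (transverse u a w θ) = Real.sin (2 * θ) / circleQuad u a w θ := by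
  have hw : 0 < w := by
    have : 0 < u * w := by nlinarith [sq_nonneg a]
    exact pos_of_mul_pos_right this hu.le
  have hR : 0 < w * circleQuad u a w θ := mul_pos hw (circleQuad_pos hu h θ)
  have hq := circleQuad_pos hu h θ
  have h1 := Real.sqrt_pos.2 hR
  have h2 := Real.sq_sqrt hR.le
  obtain ⟨hc, hs⟩ := cos_sin_transverse hu h θ
  rw [normFun_eq, hc, hs, Real.sin_two_mul]
  generalize √(w * circleQuad u a w θ) = R at h1 h2
  field_simp
  rw [h2]
  ring

end Transverse

/-! ### The ribbon atlas of the universal cover -/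

theorem cos_pos_of_mem_band {k : ℤ} {θ : ℝ}
    (h : θ ∈ Ioo (((k : ℝ) - 1) * (Real.pi / 2)) (((k : ℝ) + 1) * (Real.pi / 2))) :
    0 < Real.cos (θ - k * (Real.pi / 2)) :=
  Real.cos_pos_of_mem_Ioo ⟨by linarith [h.1], by linarith [h.2]⟩

theorem cos_two_mul_shift (k : ℤ) (θ : ℝ) :
    Real.cos (2 * θ) = (-1) ^ k * Real.cos (2 * (θ - k * (Real.pi / 2))) := by
  have : 2 * θ = 2 * (θ - k * (Real.pi / 2)) + k * Real.pi := by ring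
  conv_lhs => rw [this, Real.cos_add_int_mul_pi]

theorem sin_two_mul_shift (k : ℤ) (θ : ℝ) :
    Real.sin (2 * θ) = (-1) ^ k * Real.sin (2 * (θ - k * (Real.pi / 2))) := by
  have : 2 * θ = 2 * (θ - k * (Real.pi / 2)) + k * Real.pi := by ring
  conv_lhs => rw [this, Real.sin_add_int_mul_pi]

theorem sin_two_mul_half_pi (k : ℤ) : Real.sin (2 * (k * (Real.pi / 2))) = 0 := by
  rw [show 2 * (k * (Real.pi / 2)) = k * Real.pi by ring, Real.sin_int_mul_pi]

theorem sin_two_mul_ne_zero {k : ℤ} {θ : ℝ}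
    (h : θ ∈ Ioo ((k : ℝ) * (Real.pi / 2)) (((k : ℝ) + 1) * (Real.pi / 2))) :
    Real.sin (2 * θ) ≠ 0 := by
  rw [sin_two_mul_shift k]
  exact mul_ne_zero (zpow_ne_zero _ (by norm_num))
    (Real.sin_pos_of_pos_of_lt_pi (by linarith [h.1]) (by linarith [h.2])).ne'

/-- A chart carrying ∂_s to ∂_y has y = s + h(θ). Comparing the products with ∂_s forces h' = (cos
2θ - (-1)^k)/sin 2θ = -tan(θ - kπ/2), whence h = log cos(θ - kπ/2), defined for |θ - kπ/2| < π/2. -/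
theorem isModeledOnEuf_pullback {u a w : ℝ} (hu : 0 < u) (h : u * w - a ^ 2 = 1) :
    IsModeledOnEuf (pullback polar (quadMetric u a w)) liftedRadial (normFun a) := by
  have hπ := Real.pi_pos
  have hmono := strictMono_transverse hu h
  have hd1 : ∀ m : Plane, HasFDerivAt (fun q : Plane => q 1)
      (ContinuousLinearMap.proj (R := ℝ) (φ := fun _ : Fin 2 => ℝ) 1) m := fun m =>
    hasFDerivAt_apply 1 m
  have hd0 : ∀ m : Plane, HasFDerivAt (fun q : Plane => q 0)
      (ContinuousLinearMap.proj (R := ℝ) (φ := fun _ : Fin 2 => ℝ) 0) m := fun m =>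
    hasFDerivAt_apply 0 m
  have dx : ∀ m v : Plane, fderiv ℝ (fun p : Plane => transverse u a w (p 1)) m v
      = (circleQuad u a w (m 1))⁻¹ * v 1 := by
    intro m v
    have := ((hasDerivAt_transverse hu h (m 1)).comp_hasFDerivAt m (hd1 m)).fderiv
    refine (congrArg (fun L : Plane →L[ℝ] ℝ => L v) this).trans ?_
    simp
  have hmem : ∀ (k : ℤ) (m : Plane), transverse u a w (m 1) ∈
      Ioo (transverse u a w (((k : ℝ) - 1) * (Real.pi / 2)))
        (transverse u a w (((k : ℝ) + 1) * (Real.pi / 2))) →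
      m 1 ∈ Ioo (((k : ℝ) - 1) * (Real.pi / 2)) (((k : ℝ) + 1) * (Real.pi / 2)) := fun k m hm =>
    ⟨hmono.lt_iff_lt.1 hm.1, hmono.lt_iff_lt.1 hm.2⟩
  have dy : ∀ (k : ℤ) (m : Plane), m 1 ∈ Ioo (((k : ℝ) - 1) * (Real.pi / 2))
      (((k : ℝ) + 1) * (Real.pi / 2)) → ∀ v : Plane,
      fderiv ℝ (fun p : Plane => p 0 + Real.log (Real.cos (p 1 - k * (Real.pi / 2)))) m v
        = v 0 - Real.sin (m 1 - k * (Real.pi / 2)) / Real.cos (m 1 - k * (Real.pi / 2)) * v 1 := by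
    intro k m hm v
    have hc := cos_pos_of_mem_band hm
    have := ((hd0 m).add (((hd1 m).sub_const (k * (Real.pi / 2))).cos.log hc.ne')).fderiv
    refine (congrArg (fun L : Plane →L[ℝ] ℝ => L v) this).trans ?_
    simp
    ring
  refine ⟨fun p => transverse u a w (p 1), ⟨?_, 1, .inl rfl, ?_⟩, ?_,
    fun k => transverse u a w (((k : ℝ) - 1) * (Real.pi / 2)),
    fun k => transverse u a w (((k : ℝ) + 1) * (Real.pi / 2)),
    fun k p => p 0 + Real.log (Real.cos (p 1 - k * (Real.pi / 2))), ?_⟩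
  · exact (contDiff_transverse hu h).comp (contDiff_apply ℝ ℝ 1)
  · intro p v
    have hq := circleQuad_pos hu h (p 1)
    rw [dx, det_pullback_polar, abs_neg, abs_sq, Real.sqrt_sq (inv_pos.2 hq).le]
    simp [liftedRadial]
  · intro p
    rw [ip_liftedRadial, normFun_transverse hu h]
  · exact
    { zero_left := fun k => by
        have := sin_two_mul_half_pi (k - 1)
        push_cast at this
        rw [normFun_transverse hu h, this, zero_div]
      zero_right := fun k => by
        have := sin_two_mul_half_pi (k + 1)
        push_cast at this
        rw [normFun_transverse hu h, this, zero_div]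
      left_lt := fun k => hmono (by push_cast; linarith)
      overlap := fun k => hmono (by push_cast; linarith)
      no_triple := fun k => by
        refine le_of_eq ?_
        congr 1
        push_cast
        ring
      overlap_ne_zero := fun k t ht => by
        obtain ⟨θ, rfl⟩ := transverse_surjective hu h t
        rw [normFun_transverse hu h]
        refine div_ne_zero (sin_two_mul_ne_zero (k := k) ⟨?_, hmono.lt_iff_lt.1 ht.2⟩)
          (circleQuad_pos hu h θ).ne'
        have := hmono.lt_iff_lt.1 ht.1
        push_cast at this
        linarith
      cover := fun t => by
        obtain ⟨θ, rfl⟩ := transverse_surjective hu h t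
        have h1 := abs_le.1 (abs_sub_round (θ / (Real.pi / 2)))
        have h2 : θ / (Real.pi / 2) * (Real.pi / 2) = θ := div_mul_cancel₀ _ (by positivity)
        -- In units of π/2 the k-th interval is (k - 1, k + 1), and the nearest integer is at
        -- distance at most 1/2.
        refine ⟨round (θ / (Real.pi / 2)), hmono ?_, hmono ?_⟩ <;> nlinarith [h1.1, h1.2]
      smooth := fun k => by
        intro m hm
        have hc := cos_pos_of_mem_band (hmem k m hm)
        refine ContDiffAt.contDiffWithinAt ?_
        refine (contDiff_apply ℝ ℝ (0 : Fin 2)).contDiffAt.add (ContDiffAt.log ?_ hc.ne')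
        have : ContDiff ℝ ∞ fun p : Plane => Real.cos (p 1 - k * (Real.pi / 2)) := by fun_prop
        exact this.contDiffAt
      bijOn := fun k => by
        refine ⟨fun m hm => ⟨hm, mem_univ _⟩, ?_, ?_⟩
        · intro m _ m' _ hmm
          obtain ⟨e1, e2⟩ := Prod.mk.inj hmm
          have e3 : m 1 = m' 1 := hmono.injective e1
          rw [e3, add_left_inj] at e2
          ext i
          fin_cases i
          · exact e2
          · exact e3
        · rintro ⟨t, y⟩ ⟨ht, -⟩
          obtain ⟨θ, rfl⟩ := transverse_surjective hu h t
          exact ⟨![y - Real.log (Real.cos (θ - k * (Real.pi / 2))), θ], ht, by simp⟩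
      isometry := fun k m hm v v' => by
        have hc := (cos_pos_of_mem_band (hmem k m hm)).ne'
        have hq := (circleQuad_pos hu h (m 1)).ne'
        rw [dx, dx, dy k m (hmem k m hm), dy k m (hmem k m hm), ip_pullback_polar,
          normFun_transverse hu h, sin_two_mul_shift k, cos_two_mul_shift k, Real.sin_two_mul,
          Real.cos_two_mul]
        have h1 := Real.sin_sq_add_cos_sq (m 1 - k * (Real.pi / 2))
        generalize Real.cos (m 1 - k * (Real.pi / 2)) = C at hc h1 ⊢
        obtain ⟨T, hT⟩ : ∃ T, Real.sin (m 1 - k * (Real.pi / 2)) = T * C :=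
          ⟨_, (div_mul_cancel₀ _ hc).symm⟩
        rw [hT] at h1 ⊢
        rw [mul_div_cancel_right₀ _ hc, div_eq_mul_inv]
        linear_combination (circleQuad u a w (m 1))⁻¹ * (-1 : ℝ) ^ k
          * (2 * (v 0 * v' 1 + v 1 * v' 0) - 2 * T * (v 1 * v' 1)) * h1
      killing_x := fun k m _ => by rw [dx]; simp [liftedRadial]
      killing_y := fun k m hm => by rw [dy k m (hmem k m hm)]; simp [liftedRadial] }

/-! ### Bands of the universal cover -/

/-- The strip `k π / 2 ≤ θ ≤ (k + 1) π / 2`. -/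
def strip (k : ℤ) : Set Plane :=
  {p | p 1 ∈ Icc ((k : ℝ) * (Real.pi / 2)) (((k : ℝ) + 1) * (Real.pi / 2))}

theorem sin_two_mul_eq_zero_iff_of_mem_strip {k : ℤ} {p : Plane} (hp : p ∈ strip k) :
    Real.sin (2 * p 1) = 0 ↔
      p 1 = k * (Real.pi / 2) ∨ p 1 = ((k : ℝ) + 1) * (Real.pi / 2) := by
  constructor
  · intro h
    by_contra! hne
    exact sin_two_mul_ne_zero (k := k) ⟨hp.1.lt_of_ne' hne.1, hp.2.lt_of_ne hne.2⟩ h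
  · rintro (h | h)
    · rw [h, sin_two_mul_half_pi]
    · have := sin_two_mul_half_pi (k + 1)
      push_cast at this
      rw [h, this]

/-- The θ-image of the component is an interval avoiding all multiples of π/2, so the component lies
in one open strip. That strip is convex, hence connected. -/
theorem closure_component {p : Plane} (hp : Real.sin (2 * p 1) ≠ 0) :
    ∃ k : ℤ, closure (connectedComponentIn {q : Plane | Real.sin (2 * q 1) ≠ 0} p) = strip k := by
  have hπ := Real.pi_pos
  set k : ℤ := ⌊p 1 / (Real.pi / 2)⌋ with hk
  have h2 : p 1 / (Real.pi / 2) * (Real.pi / 2) = p 1 := div_mul_cancel₀ _ (by positivity)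
  have hpk : p 1 ∈ Ioo ((k : ℝ) * (Real.pi / 2)) (((k : ℝ) + 1) * (Real.pi / 2)) := by
    have h3 := Int.floor_le (p 1 / (Real.pi / 2))
    have h4 := Int.lt_floor_add_one (p 1 / (Real.pi / 2))
    rw [← hk] at h3 h4
    refine ⟨lt_of_le_of_ne (by nlinarith) ?_, by nlinarith⟩
    intro h5
    rw [← h5, sin_two_mul_half_pi] at hp
    exact hp rfl
  set I : Set Plane := (fun q : Plane => q 1) ⁻¹'
    Ioo ((k : ℝ) * (Real.pi / 2)) (((k : ℝ) + 1) * (Real.pi / 2)) with hI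
  refine ⟨k, ?_⟩
  have hcomp : connectedComponentIn {q : Plane | Real.sin (2 * q 1) ≠ 0} p = I := by
    apply Subset.antisymm
    · intro q hq
      have hpre := (isPreconnected_connectedComponentIn
        (F := {q : Plane | Real.sin (2 * q 1) ≠ 0}) (x := p)).image (fun q : Plane => q 1)
        (continuous_apply 1).continuousOn
      have hsub := connectedComponentIn_subset {q : Plane | Real.sin (2 * q 1) ≠ 0} p
      have hord := hpre.ordConnected
      have hp' : p 1 ∈ (fun q : Plane => q 1) ''
        connectedComponentIn {q : Plane | Real.sin (2 * q 1) ≠ 0} p :=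
        ⟨p, mem_connectedComponentIn hp, rfl⟩
      have hq' : q 1 ∈ (fun q : Plane => q 1) ''
        connectedComponentIn {q : Plane | Real.sin (2 * q 1) ≠ 0} p := ⟨q, hq, rfl⟩
      have hno : ∀ j : ℤ, (j : ℝ) * (Real.pi / 2) ∉ (fun q : Plane => q 1) ''
          connectedComponentIn {q : Plane | Real.sin (2 * q 1) ≠ 0} p := by
        rintro j ⟨r, hr, hrj⟩
        apply hsub hr
        simp only at hrj
        rw [hrj, sin_two_mul_half_pi]
      constructor
      · by_contra! h
        exact hno k (hord.out hq' hp' ⟨h, hpk.1.le⟩)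
      · by_contra! h
        refine hno (k + 1) ?_
        push_cast
        exact hord.out hp' hq' ⟨hpk.2.le, h⟩
    · refine IsPreconnected.subset_connectedComponentIn ?_ hpk fun q hq => sin_two_mul_ne_zero hq
      exact ((convex_Ioo _ _).linear_preimage
        (LinearMap.proj (R := ℝ) (φ := fun _ : Fin 2 => ℝ) 1)).isPreconnected
  rw [hcomp, hI, ← (isOpenMap_eval (1 : Fin 2)).preimage_closure_eq_closure_preimage
    (continuous_apply 1), closure_Ioo (by nlinarith)]
  rfl

/-- A strip is homeomorphic to `[0, 1] × ℝ`. -/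
def stripHomeo (k : ℤ) : strip k ≃ₜ Icc (0 : ℝ) 1 × ℝ where
  toFun p := (⟨(p.1 1 - k * (Real.pi / 2)) / (Real.pi / 2), by
    have hπ := Real.pi_pos
    have h := p.2
    rw [mem_Icc, le_div_iff₀ (by positivity), div_le_iff₀ (by positivity)]
    exact ⟨by linarith [h.1], by linarith [h.2]⟩⟩, 2 / Real.pi * p.1 0)
  invFun P := ⟨![Real.pi / 2 * P.2, k * (Real.pi / 2) + P.1 * (Real.pi / 2)], by
    have hπ := Real.pi_pos
    have h := P.1.2
    constructor <;> simp <;> nlinarith [h.1, h.2]⟩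
  left_inv p := by
    have hπ := Real.pi_pos.ne'
    ext i
    fin_cases i
    · simp
      field_simp
    · simp
  right_inv P := by
    have hπ := Real.pi_pos.ne'
    ext
    · simp
    · simp
      field_simp
  continuous_toFun := by
    have hc : ∀ i, Continuous fun p : strip k => p.1 i := fun i =>
      (continuous_apply i).comp continuous_subtype_val
    exact Continuous.prodMk (Continuous.subtype_mk (((hc 1).sub continuous_const).div_const _) _)
      (continuous_const.mul (hc 0))
  continuous_invFun := by
    refine Continuous.subtype_mk ?_ _
    refine continuous_pi fun i => ?_
    fin_cases i <;> simp <;> fun_prop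

theorem stripHomeo_fst (k : ℤ) (p : strip k) :
    ((stripHomeo k p).1 : ℝ) = (p.1 1 - k * (Real.pi / 2)) / (Real.pi / 2) := rfl

theorem stripHomeo_snd (k : ℤ) (p : strip k) :
    (stripHomeo k p).2 = 2 / Real.pi * p.1 0 := rfl

theorem stripHomeo_fst_eq_zero {k : ℤ} {p : strip k} :
    ((stripHomeo k p).1 : ℝ) = 0 ↔ p.1 1 = k * (Real.pi / 2) := by
  have hπ := Real.pi_pos
  rw [stripHomeo_fst, div_eq_zero_iff, or_iff_left (by positivity), sub_eq_zero]

theorem stripHomeo_fst_eq_one {k : ℤ} {p : strip k} :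
    ((stripHomeo k p).1 : ℝ) = 1 ↔ p.1 1 = ((k : ℝ) + 1) * (Real.pi / 2) := by
  have hπ := Real.pi_pos
  rw [stripHomeo_fst, div_eq_one_iff_eq (by positivity)]
  constructor <;> intro h <;> linarith

theorem constant_on_unitInterval {F F' : ℝ → ℝ} (hF : ∀ t, HasDerivAt F (F' t) t)
    (h0 : ∀ t ∈ Icc (0 : ℝ) 1, F' t = 0) {t : ℝ} (ht : t ∈ Icc (0 : ℝ) 1) : F t = F 0 :=
  constant_of_has_deriv_right_zero (fun t _ => (hF t).continuousAt.continuousWithinAt)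
    (fun t ht => by
      have := hF t
      rw [h0 t (Ico_subset_Icc_self ht)] at this
      exact this.hasDerivWithinAt) t ht

theorem hasDerivAt_apply_of_contDiff {c : ℝ → Plane} (hc : ContDiff ℝ 1 c) (k : Fin 2) (t : ℝ) :
    HasDerivAt (fun t => c t k) (deriv c t k) t :=
  hasDerivAt_pi.1 (hc.differentiable (by norm_num)).differentiableAt.hasDerivAt k

theorem SameLeaf.kLine_eq {B : Set Plane} {p q : Plane}
    (h : SameLeaf (kLine liftedRadial) B p q) : p 1 = q 1 := by
  obtain ⟨c, hc, rfl, rfl, ht⟩ := h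
  refine (constant_on_unitInterval (hasDerivAt_apply_of_contDiff hc 1) (fun t h => ?_)
    (right_mem_Icc.2 zero_le_one)).symm
  obtain ⟨r, hr⟩ := (ht t h).2
  rw [hr]
  simp [liftedRadial]

theorem sameLeaf_of_segment {D : Plane → Set Plane} {B : Set Plane} {p q : Plane}
    (h : p 1 = q 1) (hB : ∀ r : Plane, r 1 = p 1 → r ∈ B ∧ (![q 0 - p 0, 0] : Plane) ∈ D r) :
    SameLeaf D B p q := by
  have hd : ∀ t : ℝ, HasDerivAt (fun t : ℝ => p + t • (![q 0 - p 0, 0] : Plane))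
      (![q 0 - p 0, 0] : Plane) t := by
    intro t
    simpa using ((hasDerivAt_id t).smul_const (![q 0 - p 0, 0] : Plane)).const_add p
  refine ⟨fun t => p + t • (![q 0 - p 0, 0] : Plane), by fun_prop, by simp, ?_, fun t _ => ?_⟩
  · ext i
    fin_cases i
    · simp
    · simpa using h
  · rw [(hd t).deriv]
    exact hB _ (by simp)

theorem sameLeaf_kLine_iff {B : Set Plane} {p q : Plane} (hB : ∀ r : Plane, r 1 = p 1 → r ∈ B) :
    SameLeaf (kLine liftedRadial) B p q ↔ p 1 = q 1 :=
  ⟨SameLeaf.kLine_eq, fun h => sameLeaf_of_segment h fun r hr => ⟨hB r hr, q 0 - p 0, by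
    ext i; fin_cases i <;> simp [liftedRadial]⟩⟩

section Reeb

variable {u a w : ℝ}

theorem mem_kPerp_iff (hu : 0 < u) (h : u * w - a ^ 2 = 1) {p v : Plane} :
    v ∈ kPerp (pullback polar (quadMetric u a w)) liftedRadial p ↔
      Real.sin (2 * p 1) * v 0 + Real.cos (2 * p 1) * v 1 = 0 := by
  have hq := circleQuad_pos hu h (p 1)
  change ip _ p (liftedRadial p) v = 0 ↔ _
  rw [ip_pullback_polar, mul_eq_zero, or_iff_right (inv_ne_zero hq.ne')]
  simp [liftedRadial]

/-- A first integral of the foliation orthogonal to the radial field. -/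
def leafFun (p : Plane) : ℝ := Real.exp (2 * p 0) * Real.sin (2 * p 1)

theorem leafFun_eq_zero_iff {p : Plane} : leafFun p = 0 ↔ Real.sin (2 * p 1) = 0 := by
  rw [leafFun, mul_eq_zero, or_iff_right (Real.exp_pos _).ne']

/-- The differential of e^{2s} sin 2θ is 2e^{2s}(sin 2θ ds + cos 2θ dθ), a multiple of the form that
defines the orthogonal foliation. -/
theorem leafFun_const (hu : 0 < u) (h : u * w - a ^ 2 = 1) {B : Set Plane} {c : ℝ → Plane}
    (hc : ContDiff ℝ 1 c) (ht : ∀ t ∈ Icc (0 : ℝ) 1, c t ∈ B ∧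
      deriv c t ∈ kPerp (pullback polar (quadMetric u a w)) liftedRadial (c t)) {t : ℝ}
    (h1 : t ∈ Icc (0 : ℝ) 1) : leafFun (c t) = leafFun (c 0) := by
  have d := fun k => hasDerivAt_apply_of_contDiff hc k
  refine constant_on_unitInterval (F := fun t => leafFun (c t))
    (fun t => (((d 0 t).const_mul 2).exp).mul (((d 1 t).const_mul 2).sin)) (fun t h1 => ?_) h1
  have := (mem_kPerp_iff hu h).1 (ht t h1).2
  linear_combination 2 * Real.exp (2 * c t 0) * this

/-- Both coordinates of the homeomorphism are scaled by 2/π so that the first integral of the Reeb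
model becomes that of the orthogonal foliation, up to the sign of sin 2θ on the strip. -/
theorem sin_pi_mul_stripHomeo (k : ℤ) (p : strip k) :
    Real.sin (Real.pi * (stripHomeo k p).1) * Real.exp (Real.pi * (stripHomeo k p).2)
      = (-1) ^ k * leafFun p.1 := by
  have hπ := Real.pi_pos.ne'
  have e1 : Real.pi * (stripHomeo k p).1 = 2 * (p.1 1 - k * (Real.pi / 2)) := by
    rw [stripHomeo_fst]; field_simp
  have e2 : Real.pi * (stripHomeo k p).2 = 2 * p.1 0 := by
    rw [stripHomeo_snd]; field_simp
  rw [e1, e2, leafFun, sin_two_mul_shift k (p.1 1)]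
  have : ((-1 : ℝ) ^ k) * (-1) ^ k = 1 := by
    rw [← mul_zpow]; simp
  linear_combination (-Real.sin (2 * (p.1 1 - k * (Real.pi / 2))) * Real.exp (2 * p.1 0)) * this

/-- Inside a strip a level set of the first integral is a graph s = const - (log|sin 2θ|)/2 over θ,
so any two of its points are joined along it. -/
theorem sameLeaf_kPerp_of_leafFun_eq (hu : 0 < u) (h : u * w - a ^ 2 = 1) {k : ℤ} {p q : Plane}
    (hp : p ∈ strip k) (hq : q ∈ strip k) (hp0 : Real.sin (2 * p 1) ≠ 0)
    (hpq : leafFun p = leafFun q) :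
    SameLeaf (kPerp (pullback polar (quadMetric u a w)) liftedRadial) (strip k) p q := by
  have hq0 : Real.sin (2 * q 1) ≠ 0 := by
    rwa [Ne, ← leafFun_eq_zero_iff, ← hpq, leafFun_eq_zero_iff]
  have hmem : ∀ r ∈ strip k, Real.sin (2 * r 1) ≠ 0 →
      r 1 ∈ Ioo ((k : ℝ) * (Real.pi / 2)) (((k : ℝ) + 1) * (Real.pi / 2)) := by
    intro r hr h0
    rw [Ne, sin_two_mul_eq_zero_iff_of_mem_strip hr, not_or] at h0
    exact ⟨hr.1.lt_of_ne' h0.1, hr.2.lt_of_ne h0.2⟩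
  -- The curve must be C¹ on the whole line. This interpolation stays between the two end values for
  -- every real t, so sin 2θ never vanishes; `Real.log` of a negative number is the logarithm of its
  -- absolute value, which covers both signs.
  set θ : ℝ → ℝ := fun t => p 1 + (1 - Real.cos (Real.pi * t)) / 2 * (q 1 - p 1) with hθ
  have hθmem : ∀ t, θ t ∈ Ioo ((k : ℝ) * (Real.pi / 2)) (((k : ℝ) + 1) * (Real.pi / 2)) := by
    intro t
    refine (convex_Ioo _ _).add_smul_sub_mem (hmem p hp hp0) (hmem q hq hq0)
      (t := (1 - Real.cos (Real.pi * t)) / 2) ⟨?_, ?_⟩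
    · linarith [Real.cos_le_one (Real.pi * t)]
    · linarith [Real.neg_one_le_cos (Real.pi * t)]
  have hθ0 : ∀ t, Real.sin (2 * θ t) ≠ 0 := fun t => sin_two_mul_ne_zero (hθmem t)
  have hθs : ContDiff ℝ 1 θ := by rw [hθ]; fun_prop
  set c : ℝ → Plane := fun t =>
    ![p 0 + (Real.log (Real.sin (2 * p 1)) - Real.log (Real.sin (2 * θ t))) / 2, θ t] with hc
  have hcs : ContDiff ℝ 1 c := by
    refine contDiff_pi.2 fun i => ?_
    fin_cases i
    · have : ContDiff ℝ 1 fun t => Real.log (Real.sin (2 * θ t)) :=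
        ContDiff.log (by fun_prop) hθ0
      exact contDiff_const.add ((contDiff_const.sub this).div_const 2)
    · exact hθs
  have e0 : θ 0 = p 1 := by simp [hθ]
  have e1 : θ 1 = q 1 := by simp [hθ]
  refine ⟨c, hcs, ?_, ?_, fun t _ => ⟨⟨(hθmem t).1.le, (hθmem t).2.le⟩, ?_⟩⟩
  · ext i
    fin_cases i <;> simp [hc, e0]
  · have hl := congrArg Real.log hpq
    rw [leafFun, leafFun, Real.log_mul (Real.exp_pos _).ne' hp0,
      Real.log_mul (Real.exp_pos _).ne' hq0, Real.log_exp, Real.log_exp] at hl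
    ext i
    fin_cases i
    · simp [hc, e1]
      linarith
    · simp [hc, e1]
  · rw [mem_kPerp_iff hu h]
    have hd : HasDerivAt θ (deriv θ t) t :=
      (hθs.differentiable (by norm_num)).differentiableAt.hasDerivAt
    have h1 : deriv c t 1 = deriv θ t := by
      rw [← (hasDerivAt_apply_of_contDiff hcs 1 t).deriv]
      rfl
    have h0 : deriv c t 0 = -(Real.cos (2 * θ t) * deriv θ t / Real.sin (2 * θ t)) := by
      rw [← (hasDerivAt_apply_of_contDiff hcs 0 t).deriv]
      refine ((((hd.const_mul 2).sin.log (hθ0 t)).const_sub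
        (Real.log (Real.sin (2 * p 1)))).div_const 2).const_add (p 0) |>.deriv.trans ?_
      ring
    have h2 : c t 1 = θ t := rfl
    rw [h0, h1, h2]
    have := hθ0 t
    field_simp
    ring

theorem isReebComponent_strip (hu : 0 < u) (h : u * w - a ^ 2 = 1) (k : ℤ) :
    IsReebComponent (kPerp (pullback polar (quadMetric u a w)) liftedRadial) (strip k) := by
  have hπ := Real.pi_pos
  refine ⟨stripHomeo k, fun p q => ?_⟩
  have hinterior : ∀ r : strip k, ((stripHomeo k r).1 : ℝ) ∈ Ioo (0 : ℝ) 1 ↔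
      Real.sin (2 * r.1 1) ≠ 0 := by
    intro r
    rw [Ne, sin_two_mul_eq_zero_iff_of_mem_strip r.2, ← stripHomeo_fst_eq_zero,
      ← stripHomeo_fst_eq_one, not_or]
    exact ⟨fun h => ⟨h.1.ne', h.2.ne⟩, fun h => ⟨(stripHomeo k r).1.2.1.lt_of_ne' h.1,
      (stripHomeo k r).1.2.2.lt_of_ne h.2⟩⟩
  rw [ReebSameLeaf, hinterior, hinterior, sin_pi_mul_stripHomeo, sin_pi_mul_stripHomeo,
    mul_right_inj' (zpow_ne_zero k (by norm_num : (-1 : ℝ) ≠ 0)), stripHomeo_fst_eq_zero,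
    stripHomeo_fst_eq_zero, stripHomeo_fst_eq_one, stripHomeo_fst_eq_one]
  constructor
  · rintro ⟨c, hc, h0, h1, ht⟩
    have hconst : ∀ t ∈ Icc (0 : ℝ) 1, leafFun (c t) = leafFun p.1 := fun t h => by
      rw [leafFun_const hu ‹_› hc ht h, h0]
    have hpq : leafFun p.1 = leafFun q.1 := by
      rw [← hconst 1 (right_mem_Icc.2 zero_le_one), h1]
    by_cases hp0 : Real.sin (2 * p.1 1) = 0
    · have hq0 : Real.sin (2 * q.1 1) = 0 := by
        rwa [← leafFun_eq_zero_iff, ← hpq, leafFun_eq_zero_iff]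
      have hcont : ContinuousOn (fun t => c t 1) (Icc 0 1) :=
        ((continuous_apply 1).comp hc.continuous).continuousOn
      -- A leaf on which the first integral is zero cannot pass through the middle of the strip, so
      -- it cannot join the two boundary lines.
      have hmid : ((k : ℝ) + 1 / 2) * (Real.pi / 2) ∉ (fun t => c t 1) '' Icc (0 : ℝ) 1 := by
        rintro ⟨t, ht', he⟩
        have h3 := hconst t ht'
        rw [leafFun_eq_zero_iff.2 hp0, leafFun_eq_zero_iff] at h3
        simp only at he
        rw [he] at h3
        exact sin_two_mul_ne_zero (k := k) ⟨by nlinarith, by nlinarith⟩ h3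
      have hord := (isPreconnected_Icc.image _ hcont).ordConnected
      have m0 : p.1 1 ∈ (fun t => c t 1) '' Icc (0 : ℝ) 1 :=
        ⟨0, left_mem_Icc.2 zero_le_one, by simp only [h0]⟩
      have m1 : q.1 1 ∈ (fun t => c t 1) '' Icc (0 : ℝ) 1 :=
        ⟨1, right_mem_Icc.2 zero_le_one, by simp only [h1]⟩
      rcases (sin_two_mul_eq_zero_iff_of_mem_strip p.2).1 hp0 with hp1 | hp1 <;>
      rcases (sin_two_mul_eq_zero_iff_of_mem_strip q.2).1 hq0 with hq1 | hq1
      · exact .inl ⟨hp1, hq1⟩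
      · exact absurd (hord.out m0 m1 ⟨by nlinarith, by nlinarith⟩) hmid
      · exact absurd (hord.out m1 m0 ⟨by nlinarith, by nlinarith⟩) hmid
      · exact .inr (.inl ⟨hp1, hq1⟩)
    · refine .inr (.inr ⟨hp0, ?_, hpq⟩)
      rwa [Ne, ← leafFun_eq_zero_iff, ← hpq, leafFun_eq_zero_iff]
  · have hbd : p.1 1 = q.1 1 → Real.sin (2 * p.1 1) = 0 →
        SameLeaf (kPerp (pullback polar (quadMetric u a w)) liftedRadial) (strip k) p q := by
      intro hpq hp0
      refine sameLeaf_of_segment hpq fun r hr => ⟨?_, ?_⟩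
      · have := p.2
        change r 1 ∈ Icc _ _
        rw [hr]
        exact this
      · rw [mem_kPerp_iff hu h, hr, hp0]
        simp
    rintro (⟨hp, hq⟩ | ⟨hp, hq⟩ | ⟨hp, -, hpq⟩)
    · exact hbd (hp.trans hq.symm) ((sin_two_mul_eq_zero_iff_of_mem_strip p.2).2 (.inl hp))
    · exact hbd (hp.trans hq.symm) ((sin_two_mul_eq_zero_iff_of_mem_strip p.2).2 (.inr hp))
    · exact sameLeaf_kPerp_of_leafFun_eq hu h p.2 q.2 hp hpq

theorem isTypeIIBand_strip (hu : 0 < u) (h : u * w - a ^ 2 = 1) (k : ℤ) :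
    IsTypeIIBand (pullback polar (quadMetric u a w)) liftedRadial (strip k) := by
  have hsat : ∀ p ∈ strip k, ∀ q : Plane, q 1 = p 1 → q ∈ strip k := by
    intro p hp q hq
    rw [strip, mem_ofPred_eq] at hp ⊢
    rwa [hq]
  refine ⟨⟨?_, ?_, stripHomeo k, ?_⟩, ⟨stripHomeo k, ?_⟩, isReebComponent_strip hu h k⟩
  · intro p _ h0
    have := congrFun h0 0
    simp [liftedRadial] at this
  · exact fun p hp q hpq => hsat p hp q hpq.kLine_eq.symm
  · intro p
    rw [ip_liftedRadial, div_eq_zero_iff, or_iff_left (circleQuad_pos hu h _).ne',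
      sin_two_mul_eq_zero_iff_of_mem_strip p.2, stripHomeo_fst_eq_zero, stripHomeo_fst_eq_one]
  · intro p q
    have hπ := Real.pi_pos
    rw [sameLeaf_kLine_iff (hsat p p.2), Subtype.ext_iff, stripHomeo_fst, stripHomeo_fst,
      div_left_inj' (by positivity), sub_left_inj]

theorem allBandsTypeII_pullback (hu : 0 < u) (h : u * w - a ^ 2 = 1) :
    AllBandsTypeII (pullback polar (quadMetric u a w)) liftedRadial := by
  have hne : ∀ q : Plane, ip (pullback polar (quadMetric u a w)) q (liftedRadial q)
      (liftedRadial q) ≠ 0 ↔ Real.sin (2 * q 1) ≠ 0 := by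
    intro q
    rw [ip_liftedRadial, Ne, div_eq_zero_iff, or_iff_left (circleQuad_pos hu h _).ne']
  intro p hp
  simp only [hne] at hp ⊢
  obtain ⟨k, hk⟩ := closure_component hp
  rw [hk]
  exact isTypeIIBand_strip hu h k

end Reeb

end LorentzTorus

end

/-! ### Reduction to the matrix entries of Q -/

theorem mainTheorem7 (Q : QuadraticForm ℝ LorentzTorus.Plane) (hQ : Q.PosDef)
    (hdet : (QuadraticForm.toMatrix' Q).det = 1) (a : ℝ) (ha : a = QuadraticForm.toMatrix' Q 0 1)
    (f : ℝ → ℝ) (hf : f = fun x => Real.sin (2 * x) - 2 * a * Real.cos x ^ 2) :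
    (LorentzTorus.IsLorentzianOn (LorentzTorus.quadraticMetric Q) LorentzTorus.punctured ∧
      LorentzTorus.IsKillingOn (LorentzTorus.quadraticMetric Q) LorentzTorus.radial
        LorentzTorus.punctured ∧
      ∀ c : ℝˣ, LorentzTorus.HomothetyInvariant (LorentzTorus.quadraticMetric Q) c) ∧
    LorentzTorus.IsModeledOnEuf
      (LorentzTorus.pullback LorentzTorus.polar (LorentzTorus.quadraticMetric Q))
      LorentzTorus.liftedRadial f ∧
    LorentzTorus.InFamily f ∧
    LorentzTorus.AllBandsTypeII
      (LorentzTorus.pullback LorentzTorus.polar (LorentzTorus.quadraticMetric Q))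
      LorentzTorus.liftedRadial ∧
    LorentzTorus.NoConjugatePoints (LorentzTorus.quadraticMetric Q) LorentzTorus.punctured ∧
    ∀ c : ℝˣ, |(c : ℝ)| ≠ 1 →
      LorentzTorus.TorusNoConjugatePoints (LorentzTorus.quadraticMetric Q) c := by
  have hsymm := (QuadraticForm.isSymm_toMatrix' Q).apply 0 1
  have h : Q.toMatrix' 0 0 * Q.toMatrix' 1 1 - a ^ 2 = 1 := by
    rw [Matrix.det_fin_two] at hdet
    rw [ha]
    linear_combination hdet + Q.toMatrix' 0 1 * hsymm
  have hu : 0 < Q.toMatrix' 0 0 := by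
    have := hQ ![1, 0] (by simp)
    rw [LorentzTorus.quadraticForm_apply] at this
    simpa [LorentzTorus.quad] using this
  rw [LorentzTorus.quadraticMetric_eq, ← ha, hf]
  exact ⟨⟨LorentzTorus.isLorentzianOn_quadMetric hu h, LorentzTorus.isKillingOn_quadMetric hu h,
    LorentzTorus.homothetyInvariant_quadMetric _ _ _⟩,
    LorentzTorus.isModeledOnEuf_pullback hu h, LorentzTorus.inFamily_normFun a,
    LorentzTorus.allBandsTypeII_pullback hu h, LorentzTorus.noConjugatePoints_quadMetric hu h,
    LorentzTorus.torusNoConjugatePoints_quadMetric hu h⟩
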